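/- Let $K$ be a field. For $n\ge 1$ let $Q_n$ be the cyclic quiver with vertices $1,\dots,n$ and arrows $x_i:i\to i+1$ (indices modulo $n$), paths being written from left to right. A \emph{Nakayama algebra of order $n$} is $\Lambda=KQ_n/I$, where $I$ is the two-sided ideal generated by a nonempty set of paths (the \emph{relations}) of length $\ge 1$, none of which is a proper subword of another. Modules are right modules; $e_i$ is the idempotent of the vertex $i$, $P_i=e_i\Lambda$, $S_i=P_i/\operatorname{rad}P_i$, and $|P_i|$ is the composition length of $P_i$. The \emph{resolution quiver} $R(\Lambda)$ has vertices $1,\dots,n$ and one arrow $i\to j$ whenever $\operatorname{soc}P_i\cong S_{j-1}$ (indices modulo $n$). A \emph{leaf} is a vertex that is not the target of an arrow. The \emph{weight} of an oriented cycle of $R(\Lambda)$ is $\frac1n\sum|P_i|$, summed over the vertices $i$ of the cycle. We say that $R(\Lambda)$ has weight $w$ if every component contains an oriented cycle and every oriented cycle has weight $w$. A vertex $i$ is \emph{covered} by a relation if $x_{i-1}x_i$ is a subword of it. The \emph{relation complex} $L(\Lambda)$ is the simplicial complex whose vertices are the relations of length $\le n$; a nonempty set of them spans a simplex if and only if together they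 do not cover all $n$ vertices of $Q_n$. \textbf{Proposition.} Let $\Lambda$ be a Nakayama algebra of order $n$ such that the vertex $n$ is a leaf of $R(\Lambda)$ (so $n\ge2$), and let $\Lambda'=\operatorname{End}_\Lambda(P_1\oplus\cdots\oplus P_{n-1})$. Then $\Lambda'$ is a Nakayama algebra of order $n-1$: there is a $K$-algebra isomorphism from $\Lambda'$ to a Nakayama algebra of order $n-1$ that takes the projection onto the summand $P_i$ to $e_i$ for $1\le i\le n-1$. For every such presentation of $\Lambda'$ (which defines $R(\Lambda')$ and $L(\Lambda')$) the following hold. \begin{enumerate} \item $R(\Lambda')$ is $R(\Lambda)$ with the leaf $n$ removed: for $1\le i,j\le n-1$ there is an arrow $i\to j$ in $R(\Lambda')$ if and only if there is one in $R(\Lambda)$. In particular $R(\Lambda')$ has the same number of components as $R(\Lambda)$, and one fewer vertex not lying in an oriented cycle. \item $R(\Lambda')$ has the same weight as $R(\Lambda)$: there is a $w\in\mathbb Q$ such that both have weight $w$. \item The geometric realizations of $L(\Lambda')$ and $L(\Lambda)$ are homotopy equivalent, and $L(\Lambda')$ and $L(\Lambda)$ have the same Euler characteristic. \end{enumerate}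 Moreover \begin{enumerate} \item[(4)] $\operatorname{gl.dim}\Lambda'\le\operatorname{gl.dim}\Lambda\le\operatorname{gl.dim}\Lambda'+2$ (values in $\mathbb N\cup\{\infty\}$); thus $\operatorname{gl.dim}\Lambda<\infty$ if and only if $\operatorname{gl.dim}\Lambda'<\infty$. \end{enumerate} -/

import Mathlib

open CategoryTheory

universe u

namespace Nakayama

/-! ### The cyclic quiver and its path algebra

The vertices of the cyclic quiver `Q_n` are the elements of `Fin n`; the vertex written `i` in
one-based notation is the element with value `i - 1`.  There is one arrow `x_i : i ⟶ next i`
for every vertex `i`. -/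

/-- The cyclic successor of a vertex. -/
def next {n : ℕ} (i : Fin n) : Fin n :=
  ⟨(i.val + 1) % n, Nat.mod_lt _ i.pos⟩

/-- A path of `Q_n`.  Since every vertex is the source of exactly one arrow, the paths, written
from left to right, are the words `x_i x_{i+1} ⋯ x_{i+ℓ-1}`, given by their starting vertex `i`
and their length `ℓ ≥ 0` (with `ℓ = 0` for the trivial path `e_i`). -/
@[ext]
structure CPath (n : ℕ) where
  /-- the starting vertex -/
  start : Fin n
  /-- the number of arrows -/
  len : ℕ

namespace CPath

variable {n : ℕ}

/-- The end vertex of a path. -/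
def target (p : CPath n) : Fin n := next^[p.len] p.start

/-- The concatenation `p q`, meaningful when `q` starts where `p` ends. -/
def append (p q : CPath n) : CPath n := ⟨p.start, p.len + q.len⟩

/-- `p` is a subword of `q`: we have `q = u p v` for a path `u` of length `a` and a path `v`
of length `b`. -/
def IsSubword (p q : CPath n) : Prop :=
  ∃ a b : ℕ, next^[a] q.start = p.start ∧ q.len = a + p.len + b

/-- The path `p` covers the vertex `i`, i.e. `i` is an internal vertex of `p`: the word
`x_{i-1} x_i` is a subword of `p`. -/
def Covers (p : CPath n) (i : Fin n) : Prop :=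
  ∃ j : Fin n, next j = i ∧ IsSubword ⟨j, 2⟩ p

theorem target_append (p q : CPath n) (h : p.target = q.start) :
    (p.append q).target = q.target := by
  simp only [target, append] at *
  rw [Nat.add_comm, Function.iterate_add_apply, h]

end CPath

/-- The path algebra `K Q_n`: the vector space with basis the paths of `Q_n`. -/
def PathAlgebra (K : Type u) [Field K] (n : ℕ) : Type u := CPath n →₀ K

namespace PathAlgebra

variable (K : Type u) [Field K] {n : ℕ}

noncomputable instance : AddCommGroup (PathAlgebra K n) :=
  inferInstanceAs (AddCommGroup (CPath n →₀ K))

noncomputable instance : Module K (PathAlgebra K n) :=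
  inferInstanceAs (Module K (CPath n →₀ K))

/-- A path, as an element of the path algebra. -/
noncomputable def ofPath (p : CPath n) : PathAlgebra K n := Finsupp.single p (1 : K)

/-- The product of two paths: their concatenation if it is defined, and zero otherwise. -/
noncomputable def mulPath (p q : CPath n) : PathAlgebra K n :=
  if p.target = q.start then ofPath K (p.append q) else 0

/-- The bilinear extension of the product of paths. -/
noncomputable def mulBilin : PathAlgebra K n →ₗ[K] PathAlgebra K n →ₗ[K] PathAlgebra K n :=
  Finsupp.linearCombination K
    (fun p : CPath n => (Finsupp.linearCombination K (fun q : CPath n => mulPath K p q) :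
      (CPath n →₀ K) →ₗ[K] PathAlgebra K n))

noncomputable instance : Mul (PathAlgebra K n) := ⟨fun a b => mulBilin K a b⟩

noncomputable instance : One (PathAlgebra K n) := ⟨∑ i : Fin n, ofPath K ⟨i, 0⟩⟩

variable {K}

theorem mul_def (a b : PathAlgebra K n) : a * b = mulBilin K a b := rfl

theorem one_def : (1 : PathAlgebra K n) = ∑ i : Fin n, ofPath K ⟨i, 0⟩ := rfl

@[simp]
theorem ofPath_mul_ofPath (p q : CPath n) : ofPath K p * ofPath K q = mulPath K p q := by
  rw [mul_def]
  have h1 : mulBilin K (ofPath K p) = (Finsupp.linearCombination K (fun q : CPath n =>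
      mulPath K p q) : (CPath n →₀ K) →ₗ[K] PathAlgebra K n) :=
    (Finsupp.linearCombination_single K (1 : K) p).trans (one_smul K _)
  rw [h1]
  exact (Finsupp.linearCombination_single K (1 : K) q).trans (one_smul K _)

theorem induction_on {motive : PathAlgebra K n → Prop} (a : PathAlgebra K n)
    (zero : motive 0) (add : ∀ a b, motive a → motive b → motive (a + b))
    (smul : ∀ (c : K) (p : CPath n), motive (c • ofPath K p)) : motive a := by
  refine Finsupp.induction_linear (motive := motive) a zero add (fun p c => ?_)
  have h := smul c p
  have e : c • ofPath K p = Finsupp.single p c := by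
    change c • (Finsupp.single p (1 : K)) = _
    rw [Finsupp.smul_single, smul_eq_mul, mul_one]
  rw [e] at h
  exact h

theorem mul_assoc_path (p q r : CPath n) :
    ofPath K p * ofPath K q * ofPath K r = ofPath K p * (ofPath K q * ofPath K r) := by
  rw [ofPath_mul_ofPath, ofPath_mul_ofPath]
  unfold mulPath
  have hz (a : PathAlgebra K n) : a * 0 = 0 := map_zero (mulBilin K a)
  have zh (a : PathAlgebra K n) : 0 * a = 0 := by
    rw [mul_def, map_zero, LinearMap.zero_apply]
  by_cases h1 : p.target = q.start <;> by_cases h2 : q.target = r.start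
  · rw [if_pos h1, if_pos h2, ofPath_mul_ofPath, ofPath_mul_ofPath, mulPath, mulPath, if_pos,
      if_pos]
    · simp [CPath.append, Nat.add_assoc]
    · exact h1
    · rw [CPath.target_append _ _ h1, h2]
  · rw [if_pos h1, if_neg h2, ofPath_mul_ofPath, hz, mulPath, if_neg]
    rw [CPath.target_append _ _ h1]
    exact h2
  · rw [if_neg h1, if_pos h2, ofPath_mul_ofPath, zh, mulPath, if_neg]
    exact h1
  · rw [if_neg h1, if_neg h2, zh, hz]

noncomputable instance : Ring (PathAlgebra K n) :=
  { (inferInstance : AddCommGroup (PathAlgebra K n)) with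
    mul := (· * ·)
    one := 1
    zero_mul := fun a => by rw [mul_def, map_zero, LinearMap.zero_apply]
    mul_zero := fun a => map_zero (mulBilin K a)
    left_distrib := fun a b c => map_add (mulBilin K a) b c
    right_distrib := fun a b c => by
      simp only [mul_def, map_add, LinearMap.add_apply]
    mul_assoc := fun a b c => by
      induction a using induction_on with
      | zero => simp [mul_def]
      | add a a' h h' => simp only [mul_def, map_add, LinearMap.add_apply] at *; rw [h, h']
      | smul s p =>
        induction b using induction_on with
        | zero => simp [mul_def]
        | add a a' h h' => simp only [mul_def, map_add, LinearMap.add_apply] at *; rw [h, h']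
        | smul t q =>
          induction c using induction_on with
          | zero => simp [mul_def]
          | add a a' h h' => simp only [mul_def, map_add] at *; rw [h, h']
          | smul w r =>
            have := mul_assoc_path (K := K) p q r
            simp only [mul_def, map_smul, LinearMap.smul_apply] at *
            rw [this]
    one_mul := fun a => by
      induction a using induction_on with
      | zero => simp [mul_def]
      | add a a' h h' => simp only [mul_def, map_add] at *; rw [h, h']
      | smul s p =>
        have : mulBilin K (1 : PathAlgebra K n) (ofPath K p) = ofPath K p := by
          rw [one_def, map_sum, LinearMap.sum_apply, Finset.sum_eq_single p.start]
          · rw [← mul_def, ofPath_mul_ofPath, mulPath, if_pos]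
            · simp [CPath.append]
            · rfl
          · intro i _ hi
            rw [← mul_def, ofPath_mul_ofPath, mulPath, if_neg]
            exact hi
          · simp
        simp only [mul_def, map_smul, this]
    mul_one := fun a => by
      induction a using induction_on with
      | zero => simp [mul_def]
      | add a a' h h' => simp only [mul_def, map_add, LinearMap.add_apply] at *; rw [h, h']
      | smul s p =>
        have : mulBilin K (ofPath K p) (1 : PathAlgebra K n) = ofPath K p := by
          rw [one_def, map_sum, Finset.sum_eq_single p.target]
          · rw [← mul_def, ofPath_mul_ofPath, mulPath, if_pos]
            · simp [CPath.append]
            · rfl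
          · intro i _ hi
            rw [← mul_def, ofPath_mul_ofPath, mulPath, if_neg]
            exact fun h => hi h.symm
          · simp
        simp only [mul_def, map_smul, LinearMap.smul_apply, this] }

noncomputable instance : Algebra K (PathAlgebra K n) :=
  Algebra.ofModule
    (fun c a b => by simp only [mul_def, map_smul, LinearMap.smul_apply])
    (fun c a b => by simp only [mul_def, map_smul])

end PathAlgebra

/-! ### Nakayama algebras -/

/-- A nonempty irredundant set of monomial relations of positive length on `Q_n`.  (The starting
vertices of irredundant relations are pairwise distinct, so such a set is automatically finite.) -/
structure Relations (n : ℕ) where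
  /-- the relations -/
  rels : Set (CPath n)
  nonempty : rels.Nonempty
  len_pos : ∀ y ∈ rels, 1 ≤ y.len
  irredundant : ∀ y ∈ rels, ∀ z ∈ rels, y.IsSubword z → y = z

section Algebra

variable (K : Type u) [Field K] {n : ℕ} (Y : Relations n)

/-- The two-sided ideal of `K Q_n` generated by the relations. -/
noncomputable def relIdeal : TwoSidedIdeal (PathAlgebra K n) :=
  TwoSidedIdeal.span (PathAlgebra.ofPath K '' Y.rels)

/-- The Nakayama algebra `Λ = K Q_n / I` of order `n`. -/
abbrev Alg : Type u := (relIdeal K Y).ringCon.Quotient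

/-- The class in `Λ` of a path. -/
noncomputable def pathClass (p : CPath n) : Alg K Y :=
  (relIdeal K Y).ringCon.mk' (PathAlgebra.ofPath K p)

/-- The idempotent `e_i` of `Λ`. -/
noncomputable def idem (i : Fin n) : Alg K Y := pathClass K Y ⟨i, 0⟩

/-- The projective right module `P_i = e_i Λ`.  Right modules over `Λ` are modules over the
opposite ring. -/
noncomputable def proj (i : Fin n) : Submodule (Alg K Y)ᵐᵒᵖ (Alg K Y) :=
  Submodule.span (Alg K Y)ᵐᵒᵖ {idem K Y i}

/-- The simple right module `S_i` at the vertex `i`, as the top `P_i / rad P_i` of `P_i`. -/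
abbrev SimpleAt (i : Fin n) : Type u :=
  (proj K Y i) ⧸ Module.jacobson (Alg K Y)ᵐᵒᵖ (proj K Y i)

/-- The composition length `|P_i|`. -/
noncomputable def projLength (i : Fin n) : ℕ :=
  (Module.length (Alg K Y)ᵐᵒᵖ (proj K Y i)).toNat

end Algebra

/-- The socle of a module: the sum of its simple submodules. -/
def socle (R M : Type*) [Ring R] [AddCommGroup M] [Module R M] : Submodule R M :=
  sSup {N : Submodule R M | IsSimpleModule R N}

/-! ### The resolution quiver -/

section Digraphs

variable {V : Type*} (G : Digraph V)

/-- A leaf is a vertex which is not the target of any arrow. -/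
def IsLeaf (j : V) : Prop := ∀ i, ¬ G.Adj i j

/-- The connected components of (the undirected graph underlying) a digraph. -/
abbrev Component : Type _ := G.toSimpleGraphInclusive.ConnectedComponent

/-- An oriented cycle: a nonempty list of distinct vertices `j_1 → j_2 → ⋯ → j_m → j_1`
(a single vertex with a loop is a cycle). -/
def IsOrientedCycle (c : List V) : Prop :=
  c ≠ [] ∧ c.Nodup ∧ (c : Cycle V).Chain G.Adj

/-- The vertex `i` lies in some oriented cycle. -/
def OnCycle (i : V) : Prop := ∃ c : List V, IsOrientedCycle G c ∧ i ∈ c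

end Digraphs

section Resolution

variable (K : Type u) [Field K] {n : ℕ} (Y : Relations n)

/-- The resolution quiver `R(Λ)`: there is an arrow `i → j` if and only if the socle of `P_i`
is `S_{j-1}`.  It has at most one arrow from one vertex to another, and may have loops. -/
def resolutionQuiver : Digraph (Fin n) where
  Adj i j := ∃ k : Fin n, next k = j ∧
    Nonempty (socle (Alg K Y)ᵐᵒᵖ (proj K Y i) ≃ₗ[(Alg K Y)ᵐᵒᵖ] SimpleAt K Y k)

/-- The weight of an oriented cycle of `R(Λ)`. -/
noncomputable def cycleWeight (c : List (Fin n)) : ℚ :=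
  ((c.map (projLength K Y)).sum : ℚ) / n

/-- Every component of `R(Λ)` has weight `w`: every component contains an oriented cycle, and
all oriented cycles have weight `w`. -/
def HasWeight (w : ℚ) : Prop :=
  (∀ C : Component (resolutionQuiver K Y), ∃ c : List (Fin n),
    IsOrientedCycle (resolutionQuiver K Y) c ∧
      ∀ i ∈ c, (resolutionQuiver K Y).toSimpleGraphInclusive.connectedComponentMk i = C) ∧
  ∀ c : List (Fin n), IsOrientedCycle (resolutionQuiver K Y) c → cycleWeight K Y c = w

end Resolution

/-! ### The relation complex -/

section Complex

variable {n : ℕ} (Y : Relations n)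

theorem val_next_iterate (a : ℕ) (i : Fin n) : (next^[a] i).val = (i.val + a) % n := by
  induction a with
  | zero => simp [Nat.mod_eq_of_lt i.isLt]
  | succ a ih =>
    rw [Function.iterate_succ_apply']
    simp only [next, ih]
    simp [Nat.add_assoc]

/-- A path of length at most `n` does not cover its starting vertex. -/
theorem not_covers_start (p : CPath n) (h : p.len ≤ n) : ¬ p.Covers p.start := by
  rintro ⟨j, hj, a, b, ha, hb⟩
  have h1 : next^[a + 1] p.start = p.start := by
    rw [Function.iterate_succ_apply', ha]; exact hj
  have h2 := val_next_iterate (a + 1) p.start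
  rw [h1] at h2
  have h3 := p.start.isLt
  have hab : a + 1 < n := by simp only at hb; omega
  by_cases hc : p.start.val + (a + 1) < n
  · rw [Nat.mod_eq_of_lt hc] at h2; omega
  · rw [Nat.mod_eq_sub_mod (by omega), Nat.mod_eq_of_lt (by omega)] at h2; omega

/-- The vertices of the relation complex: the relations of length at most `n`. -/
abbrev ComplexVertex : Type := {y : CPath n // y ∈ Y.rels ∧ y.len ≤ n}

/-- The relation complex `L(Λ)`: a nonempty set of relations of length at most `n` spans a
simplex if and only if these relations do not cover all vertices of `Q_n`. -/
def relationComplex : AbstractSimplicialComplex (ComplexVertex Y) where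
  faces := {s | s.Nonempty ∧ ∃ i : Fin n, ∀ y ∈ s, ¬ y.val.Covers i}
  isRelLowerSet_faces := by
    rintro s ⟨hs, i, hi⟩
    exact ⟨hs, fun t hts ht => ⟨ht, i, fun y hy => hi y (hts hy)⟩⟩
  singleton_mem := by
    intro y
    refine ⟨Finset.singleton_nonempty y, y.val.start, fun z hz => ?_⟩
    rw [Finset.mem_singleton] at hz
    subst hz
    exact not_covers_start _ z.2.2

/-- The relations have distinct starting vertices. -/
theorem start_injOn : Set.InjOn CPath.start Y.rels := by
  intro y hy z hz h
  rcases le_total y.len z.len with hl | hl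
  · exact Y.irredundant y hy z hz ⟨0, z.len - y.len, h.symm, by omega⟩
  · exact (Y.irredundant z hz y hy ⟨0, y.len - z.len, h, by omega⟩).symm

instance : Finite (ComplexVertex Y) :=
  Finite.of_injective (fun y : ComplexVertex Y => y.val.start)
    (fun y z h => Subtype.ext (start_injOn Y y.2.1 z.2.1 h))

noncomputable instance : Fintype (ComplexVertex Y) := Fintype.ofFinite _

end Complex

/-- The geometric realization of a simplicial complex with finitely many vertices: the points of
the standard simplex (given by barycentric coordinates) whose support is a face. -/
def Realization {ι : Type*} [Fintype ι] (L : AbstractSimplicialComplex ι) : Type _ :=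
  {t : ι → ℝ // t ∈ stdSimplex ℝ ι ∧ ∃ s ∈ L.faces, ∀ v, v ∈ s ↔ t v ≠ 0}

instance {ι : Type*} [Fintype ι] (L : AbstractSimplicialComplex ι) :
    TopologicalSpace (Realization L) :=
  inferInstanceAs (TopologicalSpace
    {t : ι → ℝ // t ∈ stdSimplex ℝ ι ∧ ∃ s ∈ L.faces, ∀ v, v ∈ s ↔ t v ≠ 0})

open Classical in
/-- The Euler characteristic `∑ (-1) ^ dim σ` of a simplicial complex with finitely many
vertices. -/
noncomputable def eulerChar {ι : Type*} [Fintype ι] (L : AbstractSimplicialComplex ι) : ℤ :=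
  ∑ s : Finset ι with s ∈ L.faces, (-1) ^ (s.card - 1)

/-! ### Global dimension and the endomorphism algebra -/

/-- The global dimension of a ring, computed with right modules: the supremum of the projective
dimensions of all right modules. -/
noncomputable def globalDim (A : Type u) [Ring A] : WithBot ℕ∞ :=
  ⨆ M : ModuleCat.{u} Aᵐᵒᵖ, projectiveDimension M

section Endomorphisms

variable (K : Type u) [Field K] {n : ℕ} (Y : Relations (n + 1))

/-- The right `Λ`-module `P' = P_1 ⊕ ⋯ ⊕ P_n` for `Λ` of order `n + 1`: the direct sum of all
indecomposable projectives except the one at the last vertex. -/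
abbrev PPrime : Type u := (i : Fin n) → proj K Y i.castSucc

/-- The algebra `Λ' = End_Λ(P')`, whose product is composition. -/
abbrev EndAlg : Type u := Module.End (Alg K Y)ᵐᵒᵖ (PPrime K Y)

/-- The idempotent of `Λ'` given by the projection of `P'` to its summand `P_i`. -/
noncomputable def endIdem (i : Fin n) : EndAlg K Y :=
  LinearMap.single (Alg K Y)ᵐᵒᵖ (fun i : Fin n => proj K Y i.castSucc) i ∘ₗ
    LinearMap.proj i

/-- A presentation of `Λ'` as a Nakayama algebra of order `n`: an isomorphism of `K`-algebras
`Λ' ≅ K Q_n / I'` under which the projection of `P'` to `P_i` corresponds to `e_i`. -/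
def IsPresentation (Y' : Relations n) (φ : EndAlg K Y ≃ₐ[K] Alg K Y') : Prop :=
  ∀ i : Fin n, φ (endIdem K Y i) = idem K Y' i

end Endomorphisms

end Nakayama

/-! Put c_i = |P_i| (`kupisch`). The paths without relations form a basis of Λ, the P_i are
uniserial, and R(Λ) is the graph of i ↦ i + c_i modulo the order of Λ. Its lift F(a) = a + c_a to ℕ
(`step`) commutes with translation by the order and is monotone, since c_i ≤ c_{i+1} + 1; the
relations start exactly where F jumps. The last vertex is a leaf if and only if the values of F
avoid its residue class. Then F restricts to the other classes, and renumbering these by `skip`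
gives the series of a Nakayama algebra with one vertex less (`exists_isDeletion`,
`IsDeletion.step`). Paths between the remaining vertices correspond to the paths of the smaller
quiver, bad ones to bad ones, so this algebra is Λ' (`deletionHom_bijective`). Every presentation of
Λ' has the same series, because c_i = dim e_iΛ (`kupisch_eq_of_algEquiv`).

Part (1) is the conjugacy of the two lifts. For (2), a cycle with m vertices and weight w is a
minimal solution of F^m(x) = x + wN, where N is the order. For a monotone circle map of degree one,
w/m is the same for all cycles and is in lowest terms, so w is the same (`winding_eq`); and `skip`
carries a cycle of Λ' to a cycle of Λ with the same w.

For (3), a relation of Λ is sent to the relation of Λ' with the same start, the leaf being replaced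
by its predecessor, and there is a map back. One composite is the identity, the other is contiguous
to it; at most one vertex of L(Λ) is missed, and it is dominated, so its faces cancel in the Euler
characteristic.

For (4), consider the modules on which the arrow into the leaf acts bijectively. On them Hom(P', -)
preserves and reflects projective dimension, and every Λ'-module arises from one of them; this gives
the first inequality. The class contains the P_i with i ≠ n and rad P_n. Modules killed by Hom(P',
-) are sums of copies of S_n, resolved by P_n and rad P_n. An arbitrary module is assembled from
both kinds, at the cost of two dimensions (`IsPresentedClass.pdLT_of_end`). -/

namespace Nakayama

/-! ### Bad paths and the Kupisch series -/

section Combinatorics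

variable {n : ℕ}

theorem next_iterate_add (a b : ℕ) (i : Fin n) : next^[a] (next^[b] i) = next^[b + a] i := by
  rw [add_comm, Function.iterate_add_apply]

theorem exists_next_iterate_eq (i j : Fin n) : ∃ a, next^[a] i = j := by
  refine ⟨j.val + (n - i.val), Fin.ext ?_⟩
  rw [val_next_iterate]
  have hi := i.isLt
  have : i.val + (j.val + (n - i.val)) = j.val + n := by omega
  rw [this, Nat.add_mod_right, Nat.mod_eq_of_lt j.isLt]

theorem next_iterate_eq_iff (a b : ℕ) (i j : Fin n) :
    next^[a] i = next^[b] j ↔ (i.val + a) % n = (j.val + b) % n := by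
  rw [Fin.ext_iff, val_next_iterate, val_next_iterate]

theorem next_iterate_right_injective (a : ℕ) : Function.Injective (next^[a] : Fin n → Fin n) := by
  intro i j h
  rw [next_iterate_eq_iff] at h
  have h2 : i.val ≡ j.val [MOD n] := Nat.ModEq.add_right_cancel' a h
  have h3 : i.val % n = j.val % n := h2
  rw [Nat.mod_eq_of_lt i.isLt, Nat.mod_eq_of_lt j.isLt] at h3
  exact Fin.ext h3

theorem next_injective : Function.Injective (next : Fin n → Fin n) :=
  next_iterate_right_injective 1

theorem CPath.covers_iff (p : CPath n) (i : Fin n) :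
    p.Covers i ↔ ∃ t, 1 ≤ t ∧ t < p.len ∧ next^[t] p.start = i := by
  constructor
  · rintro ⟨j, rfl, a, b, ha, hb⟩
    refine ⟨a + 1, by omega, ?_, ?_⟩
    · simp only at hb
      omega
    · rw [Function.iterate_succ_apply', ha]
  · rintro ⟨t, h1, h2, rfl⟩
    obtain ⟨s, rfl⟩ : ∃ s, t = s + 1 := ⟨t - 1, by omega⟩
    refine ⟨next^[s] p.start, (Function.iterate_succ_apply' _ _ _).symm, s, p.len - (s + 2), rfl, ?_⟩
    simp only
    omega

namespace Relations

variable (Y : Relations n)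

/-- A path is bad if it has a relation as a subword; its class in the Nakayama algebra is zero. -/
def Bad (p : CPath n) : Prop := ∃ y ∈ Y.rels, y.IsSubword p

/-- The length of the shortest bad path starting at the given vertex. -/
noncomputable def kupisch (i : Fin n) : ℕ := sInf {l | Y.Bad ⟨i, l⟩}

variable {Y}

theorem Bad.append_right {p : CPath n} (h : Y.Bad p) (q : CPath n) : Y.Bad (p.append q) := by
  obtain ⟨y, hy, a, b, h1, h2⟩ := h
  exact ⟨y, hy, a, b + q.len, h1, by simp only [CPath.append]; omega⟩

theorem Bad.append_left {q : CPath n} (h : Y.Bad q) (p : CPath n) (hp : p.target = q.start) :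
    Y.Bad (p.append q) := by
  obtain ⟨y, hy, a, b, h1, h2⟩ := h
  refine ⟨y, hy, p.len + a, b, ?_, by simp only [CPath.append]; omega⟩
  simp only [CPath.append]
  rw [← h1, ← hp, CPath.target, next_iterate_add]

theorem Bad.mono {i : Fin n} {l m : ℕ} (h : Y.Bad ⟨i, l⟩) (hlm : l ≤ m) : Y.Bad ⟨i, m⟩ := by
  have := h.append_right ⟨i, m - l⟩
  simpa only [CPath.append, Nat.add_sub_cancel' hlm] using this

theorem Bad.of_mem {p : CPath n} (h : p ∈ Y.rels) : Y.Bad p := ⟨p, h, 0, 0, rfl, by omega⟩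

variable (Y)

theorem exists_bad (i : Fin n) : ∃ l, Y.Bad ⟨i, l⟩ := by
  obtain ⟨y, hy⟩ := Y.nonempty
  obtain ⟨a, ha⟩ := exists_next_iterate_eq i y.start
  exact ⟨a + y.len, y, hy, a, 0, ha, rfl⟩

theorem bad_iff (p : CPath n) : Y.Bad p ↔ Y.kupisch p.start ≤ p.len := by
  constructor
  · exact fun h => Nat.sInf_le h
  · intro h
    have h1 : Y.Bad ⟨p.start, Y.kupisch p.start⟩ := Nat.sInf_mem (Y.exists_bad p.start)
    exact h1.mono h

theorem bad_mk_iff (i : Fin n) (l : ℕ) : Y.Bad ⟨i, l⟩ ↔ Y.kupisch i ≤ l := Y.bad_iff _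

theorem kupisch_pos (i : Fin n) : 1 ≤ Y.kupisch i := by
  obtain ⟨y, hy, a, b, h1, h2⟩ := (Y.bad_mk_iff i _).2 le_rfl
  have := Y.len_pos y hy
  simp only at h2
  omega

theorem kupisch_le_next (i : Fin n) : Y.kupisch i ≤ Y.kupisch (next i) + 1 := by
  rw [← bad_mk_iff]
  have h := ((Y.bad_mk_iff (next i) _).2 le_rfl).append_left ⟨i, 1⟩ rfl
  simpa only [CPath.append, add_comm] using h

/-- The relations are the minimal bad paths. A shortest bad path from i is minimal unless its tail
from `next i` is already bad, which means that the series drops at i. -/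
theorem mem_rels_iff (p : CPath n) :
    p ∈ Y.rels ↔ p.len = Y.kupisch p.start ∧ Y.kupisch p.start ≤ Y.kupisch (next p.start) := by
  constructor
  · intro hp
    have h1 := (Y.bad_iff p).1 (Bad.of_mem hp)
    constructor
    · obtain ⟨y, hy, a, b, ha, hb⟩ := (Y.bad_mk_iff p.start _).2 le_rfl
      have : y = p := Y.irredundant y hy p hp
        ⟨a, b + (p.len - Y.kupisch p.start), ha, by simp only at hb; omega⟩
      subst this
      simp only at hb
      omega
    · by_contra hlt
      obtain ⟨y, hy, a, b, ha, hb⟩ := (Y.bad_mk_iff (next p.start) _).2 le_rfl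
      simp only at hb ha
      have : y = p := Y.irredundant y hy p hp
        ⟨a + 1, b + (p.len - (Y.kupisch (next p.start) + 1)), ha, by omega⟩
      subst this
      omega
  · rintro ⟨h1, h2⟩
    obtain ⟨y, hy, a, b, ha, hb⟩ := (Y.bad_iff p).2 h1.ge
    rcases a with _ | a
    · rcases b with _ | b
      · have : y = p := CPath.ext ha.symm (by omega)
        rwa [← this]
      · have h3 : Y.Bad ⟨p.start, p.len - 1⟩ := ⟨y, hy, 0, b, ha, by simp only; omega⟩
        rw [bad_mk_iff] at h3
        have := Y.kupisch_pos p.start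
        omega
    · have h3 : Y.Bad ⟨next p.start, p.len - 1⟩ := ⟨y, hy, a, b, ha, by simp only; omega⟩
      rw [bad_mk_iff] at h3
      have := Y.kupisch_pos p.start
      omega

section OfKupisch

variable (c : Fin n → ℕ)

theorem le_iterate_of_le_next (hc : ∀ i, c i ≤ c (next i) + 1) (i : Fin n) (a : ℕ) :
    c i ≤ c (next^[a] i) + a := by
  induction a with
  | zero => simp
  | succ a ih =>
    rw [Function.iterate_succ_apply']
    have := hc (next^[a] i)
    omega

/-- Walk along the quiver as long as c drops. Every drop is at least one, so t + c does not grow,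
and positivity of c forces a stop. This locates a relation inside the path of length c i from i. -/
theorem exists_le_next_of_le (l : ℕ) (i : Fin n) (h : c i ≤ l)
    (hc : ∀ i, 1 ≤ c i) :
    ∃ t, c (next^[t] i) ≤ c (next (next^[t] i)) ∧ t + c (next^[t] i) ≤ l := by
  induction l generalizing i with
  | zero => exact absurd (hc i) (by omega)
  | succ l ih =>
    by_cases h1 : c i ≤ c (next i)
    · exact ⟨0, h1, by simpa using h⟩
    · obtain ⟨t, h2, h3⟩ := ih (next i) (by omega)
      exact ⟨t + 1, h2, by rw [Function.iterate_succ_apply]; omega⟩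

/-- The relations with a prescribed Kupisch series. -/
def ofKupisch [NeZero n] (hc : ∀ i, 1 ≤ c i) (hc' : ∀ i, c i ≤ c (next i) + 1) : Relations n where
  rels := {p | p.len = c p.start ∧ c p.start ≤ c (next p.start)}
  nonempty := by
    obtain ⟨t, h, -⟩ := exists_le_next_of_le c (c 0) 0 le_rfl hc
    exact ⟨⟨next^[t] 0, c (next^[t] 0)⟩, rfl, h⟩
  len_pos := fun y hy => hy.1 ▸ hc _
  irredundant := by
    rintro ⟨i, l⟩ ⟨h1, h2⟩ ⟨j, m⟩ ⟨h3, h4⟩ ⟨a, b, ha, hb⟩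
    simp only at *
    subst h1 h3
    rcases a with _ | a
    · have : j = i := ha
      rw [this]
    · have := le_iterate_of_le_next c hc' (next j) a
      rw [← Function.iterate_succ_apply, ha] at this
      omega

/-- The walk of `exists_le_next_of_le` makes the path of length c i bad. Conversely, a relation
starting a steps after i has length at least c i - a, because c drops by at most one per step. -/
theorem kupisch_ofKupisch [NeZero n] (hc : ∀ i, 1 ≤ c i) (hc' : ∀ i, c i ≤ c (next i) + 1) :
    (ofKupisch c hc hc').kupisch = c := by
  funext i
  apply le_antisymm
  · rw [← bad_mk_iff]
    obtain ⟨t, h1, h2⟩ := exists_le_next_of_le c (c i) i le_rfl hc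
    exact ⟨⟨next^[t] i, c (next^[t] i)⟩, ⟨rfl, h1⟩, t, c i - (t + c (next^[t] i)), rfl,
      by simp only; omega⟩
  · obtain ⟨y, hy, a, b, h1, h2⟩ := (bad_mk_iff (ofKupisch c hc hc') i _).2 le_rfl
    have h3 := le_iterate_of_le_next c hc' i a
    simp only at h1 h2
    rw [h1, ← hy.1] at h3
    omega

end OfKupisch

end Relations

end Combinatorics

end Nakayama
namespace Nakayama

/-! ### The basis of paths without relations -/

section AlgebraBasis

variable (K : Type u) [Field K] {n : ℕ}

namespace PathAlgebra

theorem span_range_ofPath : Submodule.span K (Set.range (ofPath K : CPath n → _)) = ⊤ := by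
  rw [eq_top_iff]
  rintro a -
  induction a using induction_on with
  | zero => exact zero_mem _
  | add a b ha hb => exact add_mem ha hb
  | smul c p => exact Submodule.smul_mem _ _ (Submodule.subset_span ⟨p, rfl⟩)

variable {K}

/-- An algebra homomorphism out of the path algebra is given by its values on paths. -/
noncomputable def lift {B : Type*} [Ring B] [Algebra K B] (θ : CPath n → B)
    (hmul : ∀ p q, p.target = q.start → θ p * θ q = θ (p.append q))
    (hzero : ∀ p q, p.target ≠ q.start → θ p * θ q = 0)
    (hone : ∑ i : Fin n, θ ⟨i, 0⟩ = 1) : PathAlgebra K n →ₐ[K] B :=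
  have key : ∀ p, (Finsupp.linearCombination K θ : (CPath n →₀ K) →ₗ[K] B) (ofPath K p) = θ p :=
    fun p => (Finsupp.linearCombination_single K (1 : K) p).trans (one_smul K _)
  AlgHom.ofLinearMap (show PathAlgebra K n →ₗ[K] B from
      (Finsupp.linearCombination K θ : (CPath n →₀ K) →ₗ[K] B))
    (by
      rw [one_def, map_sum, ← hone]
      exact Finset.sum_congr rfl fun i _ => key _)
    (by
      intro a b
      induction a using induction_on with
      | zero => rw [zero_mul, map_zero, zero_mul]
      | add a a' h h' => rw [add_mul, map_add, map_add, add_mul, h, h']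
      | smul s p =>
        induction b using induction_on with
        | zero => rw [mul_zero, map_zero, mul_zero]
        | add a a' h h' => rw [mul_add, map_add, map_add, mul_add, h, h']
        | smul t q =>
          rw [smul_mul_assoc, mul_smul_comm, map_smul, map_smul, map_smul, map_smul,
            smul_mul_assoc, mul_smul_comm, ofPath_mul_ofPath, mulPath]
          congr 2
          change _ = (Finsupp.linearCombination K θ) (ofPath K p) *
            (Finsupp.linearCombination K θ) (ofPath K q)
          rw [key p, key q]
          split_ifs with h
          · rw [hmul p q h]
            exact key _
          · rw [hzero p q h]
            exact map_zero _)

theorem lift_ofPath {B : Type*} [Ring B] [Algebra K B] (θ : CPath n → B)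
    (hmul : ∀ p q, p.target = q.start → θ p * θ q = θ (p.append q))
    (hzero : ∀ p q, p.target ≠ q.start → θ p * θ q = 0)
    (hone : ∑ i : Fin n, θ ⟨i, 0⟩ = 1) (p : CPath n) :
    lift (K := K) θ hmul hzero hone (ofPath K p) = θ p :=
  (Finsupp.linearCombination_single K (1 : K) p).trans (one_smul K _)

end PathAlgebra

open PathAlgebra

variable (Y : Relations n)

/-- The span of the bad paths. -/
noncomputable def badSpan : Submodule K (PathAlgebra K n) :=
  Submodule.span K (ofPath K '' {p | Y.Bad p})

theorem mul_mem_badSpan_right {a : PathAlgebra K n} (b : PathAlgebra K n)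
    (ha : a ∈ badSpan K Y) : a * b ∈ badSpan K Y := by
  induction ha using Submodule.span_induction with
  | zero => rw [zero_mul]; exact zero_mem _
  | add a a' _ _ h h' => rw [add_mul]; exact add_mem h h'
  | smul c a _ h => rw [smul_mul_assoc]; exact Submodule.smul_mem _ _ h
  | mem a ha =>
    obtain ⟨p, hp, rfl⟩ := ha
    induction b using PathAlgebra.induction_on with
    | zero => rw [mul_zero]; exact zero_mem _
    | add a a' h h' => rw [mul_add]; exact add_mem h h'
    | smul c q =>
      rw [mul_smul_comm, ofPath_mul_ofPath, mulPath]
      apply Submodule.smul_mem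
      split_ifs
      · exact Submodule.subset_span ⟨_, hp.append_right q, rfl⟩
      · exact zero_mem _

theorem mul_mem_badSpan_left {a : PathAlgebra K n} (b : PathAlgebra K n)
    (ha : a ∈ badSpan K Y) : b * a ∈ badSpan K Y := by
  induction ha using Submodule.span_induction with
  | zero => rw [mul_zero]; exact zero_mem _
  | add a a' _ _ h h' => rw [mul_add]; exact add_mem h h'
  | smul c a _ h => rw [mul_smul_comm]; exact Submodule.smul_mem _ _ h
  | mem a ha =>
    obtain ⟨p, hp, rfl⟩ := ha
    induction b using PathAlgebra.induction_on with
    | zero => rw [zero_mul]; exact zero_mem _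
    | add a a' h h' => rw [add_mul]; exact add_mem h h'
    | smul c q =>
      rw [smul_mul_assoc, ofPath_mul_ofPath, mulPath]
      apply Submodule.smul_mem
      split_ifs with h
      · exact Submodule.subset_span ⟨_, hp.append_left q h, rfl⟩
      · exact zero_mem _

/-- The span of the bad paths is a two-sided ideal containing the relations. -/
theorem relIdeal_le_badSpan {a : PathAlgebra K n} (ha : a ∈ relIdeal K Y) : a ∈ badSpan K Y := by
  have h : relIdeal K Y ≤ TwoSidedIdeal.mk' (badSpan K Y : Set (PathAlgebra K n)) (zero_mem _)
      (fun h h' => add_mem h h') (fun h => neg_mem h)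
      (fun h => mul_mem_badSpan_left K Y _ h) (fun h => mul_mem_badSpan_right K Y _ h) := by
    refine TwoSidedIdeal.span_le.2 ?_
    rintro _ ⟨p, hp, rfl⟩
    rw [SetLike.mem_coe, TwoSidedIdeal.mem_mk']
    exact Submodule.subset_span ⟨p, Relations.Bad.of_mem hp, rfl⟩
  have := h ha
  rwa [TwoSidedIdeal.mem_mk'] at this

/-- The projection of the path algebra onto the Nakayama algebra. -/
noncomputable def algMk : PathAlgebra K n →ₐ[K] Alg K Y := RingCon.mkₐ K (relIdeal K Y).ringCon

theorem algMk_ofPath (p : CPath n) : algMk K Y (ofPath K p) = pathClass K Y p := rfl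

theorem algMk_surjective : Function.Surjective (algMk K Y) :=
  RingCon.mk'_surjective _

theorem algMk_eq_zero_iff (a : PathAlgebra K n) : algMk K Y a = 0 ↔ a ∈ relIdeal K Y := by
  rw [TwoSidedIdeal.mem_iff, ← map_zero (algMk K Y)]
  exact (relIdeal K Y).ringCon.eq

variable {K Y} in
theorem pathClass_eq_zero {p : CPath n} (hp : Y.Bad p) : pathClass K Y p = 0 := by
  obtain ⟨y, hy, a, b, h1, h2⟩ := hp
  rw [← algMk_ofPath, algMk_eq_zero_iff]
  have h1 : (⟨p.start, a⟩ : CPath n).target = y.start := h1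
  have h : ofPath K p = ofPath K ⟨p.start, a⟩ * ofPath K y * ofPath K ⟨y.target, b⟩ := by
    rw [ofPath_mul_ofPath, mulPath, if_pos h1, ofPath_mul_ofPath, mulPath, if_pos]
    · congr 1
      exact CPath.ext rfl h2
    · rw [CPath.target_append _ _ h1]
  rw [h]
  exact TwoSidedIdeal.mul_mem_right _ _ _ (TwoSidedIdeal.mul_mem_left _ _ _
    (TwoSidedIdeal.subset_span ⟨y, hy, rfl⟩))

theorem pathClass_mul (p q : CPath n) (h : p.target = q.start) :
    pathClass K Y p * pathClass K Y q = pathClass K Y (p.append q) := by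
  rw [← algMk_ofPath, ← algMk_ofPath, ← map_mul, ofPath_mul_ofPath, mulPath, if_pos h,
    algMk_ofPath]

theorem pathClass_mul_of_ne (p q : CPath n) (h : p.target ≠ q.start) :
    pathClass K Y p * pathClass K Y q = 0 := by
  rw [← algMk_ofPath, ← algMk_ofPath, ← map_mul, ofPath_mul_ofPath, mulPath, if_neg h, map_zero]

theorem sum_idem : ∑ i, idem K Y i = 1 := by
  rw [← map_one (algMk K Y), one_def, map_sum]
  rfl

/-- A combination of good paths that vanishes in Λ lies in the span of the bad paths, and the two
sets of basis vectors of the path algebra are disjoint. -/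
theorem linearIndependent_pathClass :
    LinearIndependent K (fun p : {p : CPath n // ¬ Y.Bad p} => pathClass K Y p) := by
  rw [linearIndependent_iff]
  intro l hl
  have h1 : algMk K Y (show PathAlgebra K n from Finsupp.mapDomain Subtype.val l) = 0 := by
    rw [← hl]
    change (algMk K Y).toLinearMap.comp (LinearMap.id : (CPath n →₀ K) →ₗ[K] PathAlgebra K n)
      (Finsupp.lmapDomain K K Subtype.val l) = _
    rw [← LinearMap.comp_apply]
    congr 1
    ext p
    simp only [LinearMap.comp_apply, Finsupp.lsingle_apply, Finsupp.lmapDomain_apply,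
      Finsupp.mapDomain_single, Finsupp.linearCombination_single, one_smul]
    rfl
  rw [algMk_eq_zero_iff] at h1
  have h2 := relIdeal_le_badSpan K Y h1
  have h3 : (Finsupp.mapDomain Subtype.val l : CPath n →₀ K) ∈
      Finsupp.supported K K {p : CPath n | Y.Bad p} := by
    rw [Finsupp.supported_eq_span_single]
    exact h2
  ext p
  rw [← Finsupp.mapDomain_apply Subtype.val_injective l p]
  by_contra h4
  exact p.2 ((Finsupp.mem_supported _ _).1 h3 (Finsupp.mem_support_iff.2 h4))

theorem span_pathClass :
    Submodule.span K (Set.range (pathClass K Y)) = ⊤ := by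
  have h : Set.range (pathClass K Y) = (algMk K Y).toLinearMap '' Set.range (ofPath K) := by
    rw [← Set.range_comp]; rfl
  rw [h, Submodule.span_image, span_range_ofPath, Submodule.map_top, LinearMap.range_eq_top]
  exact algMk_surjective K Y

theorem Alg.induction_on {motive : Alg K Y → Prop} (a : Alg K Y)
    (zero : motive 0) (add : ∀ a b, motive a → motive b → motive (a + b))
    (smul : ∀ (c : K) (p : CPath n), motive (c • pathClass K Y p)) : motive a := by
  obtain ⟨a, rfl⟩ := algMk_surjective K Y a
  induction a using PathAlgebra.induction_on with
  | zero => rwa [map_zero]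
  | add a b ha hb => rw [map_add]; exact add _ _ ha hb
  | smul c p => rw [map_smul]; exact smul c p

/-- The paths without relations as subwords form a basis of the Nakayama algebra. -/
noncomputable def pathBasis : Module.Basis {p : CPath n // ¬ Y.Bad p} K (Alg K Y) :=
  Module.Basis.mk (linearIndependent_pathClass K Y) (by
    rw [← span_pathClass, Submodule.span_le]
    rintro _ ⟨p, rfl⟩
    by_cases h : Y.Bad p
    · rw [pathClass_eq_zero h]; exact zero_mem _
    · exact Submodule.subset_span ⟨⟨p, h⟩, rfl⟩)

theorem pathBasis_apply (p) : pathBasis K Y p = pathClass K Y p.1 := Module.Basis.mk_apply _ _ _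

theorem pathClass_eq_zero_iff (p : CPath n) : pathClass K Y p = 0 ↔ Y.Bad p := by
  refine ⟨fun h => ?_, pathClass_eq_zero⟩
  by_contra hp
  exact (linearIndependent_pathClass K Y).ne_zero ⟨p, hp⟩ h

end AlgebraBasis

end Nakayama
namespace Nakayama

/-! ### Uniserial projectives, their socles and the resolution quiver -/

section Projectives

variable (K : Type u) [Field K] {n : ℕ} (Y : Relations n)

theorem idem_mul_self (i : Fin n) : idem K Y i * idem K Y i = idem K Y i :=
  pathClass_mul K Y ⟨i, 0⟩ ⟨i, 0⟩ rfl

theorem idem_mul_pathClass (p : CPath n) :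
    idem K Y p.start * pathClass K Y p = pathClass K Y p := by
  rw [idem, pathClass_mul K Y _ _ rfl]
  congr 1
  exact CPath.ext rfl (zero_add _)

theorem pathClass_mul_idem (p : CPath n) :
    pathClass K Y p * idem K Y p.target = pathClass K Y p :=
  pathClass_mul K Y _ _ rfl

theorem mem_proj_iff (i : Fin n) (x : Alg K Y) : x ∈ proj K Y i ↔ idem K Y i * x = x := by
  rw [proj, Submodule.mem_span_singleton]
  constructor
  · rintro ⟨a, rfl⟩
    rw [← MulOpposite.op_unop a, op_smul_eq_mul, ← mul_assoc, idem_mul_self]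
  · intro h
    exact ⟨MulOpposite.op x, by rw [op_smul_eq_mul, h]⟩

variable {K Y} in
theorem proj_idem_mul {i : Fin n} (x : proj K Y i) : idem K Y i * (x : Alg K Y) = x :=
  (mem_proj_iff K Y i x).1 x.2

/-- The path with start `i` and length `l`, as an element of `P_i`. -/
noncomputable def projPath (i : Fin n) (l : ℕ) : proj K Y i :=
  ⟨pathClass K Y ⟨i, l⟩, (mem_proj_iff K Y i _).2 (idem_mul_pathClass K Y ⟨i, l⟩)⟩

theorem coe_projPath (i : Fin n) (l : ℕ) :
    (projPath K Y i l : Alg K Y) = pathClass K Y ⟨i, l⟩ := rfl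

theorem projPath_eq_zero_iff (i : Fin n) (l : ℕ) :
    projPath K Y i l = 0 ↔ Y.kupisch i ≤ l := by
  rw [← Y.bad_mk_iff, ← pathClass_eq_zero_iff K, ← coe_projPath, ZeroMemClass.coe_eq_zero]

/-- The submodule of `P_i` generated by the path of length `l`. -/
noncomputable def projFil (i : Fin n) (l : ℕ) : Submodule (Alg K Y)ᵐᵒᵖ (proj K Y i) :=
  Submodule.span _ {projPath K Y i l}

theorem mem_projFil_iff (i : Fin n) (l : ℕ) (x : proj K Y i) :
    x ∈ projFil K Y i l ↔ ∃ y, (x : Alg K Y) = pathClass K Y ⟨i, l⟩ * y := by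
  rw [projFil, Submodule.mem_span_singleton]
  constructor
  · rintro ⟨a, rfl⟩
    exact ⟨a.unop, rfl⟩
  · rintro ⟨y, hy⟩
    exact ⟨MulOpposite.op y, Subtype.ext hy.symm⟩

/-- Leading term expansion: only the trivial path at the end of the given path contributes to the
first summand, all other paths lengthen the product. -/
theorem pathClass_mul_eq_add (i : Fin n) (l : ℕ) (y : Alg K Y) :
    ∃ (a : K) (z : Alg K Y), pathClass K Y ⟨i, l⟩ * y =
      a • pathClass K Y ⟨i, l⟩ + pathClass K Y ⟨i, l + 1⟩ * z := by
  induction y using Alg.induction_on with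
  | zero => exact ⟨0, 0, by simp⟩
  | add y y' h h' =>
    obtain ⟨a, z, h⟩ := h
    obtain ⟨a', z', h'⟩ := h'
    exact ⟨a + a', z + z', by rw [mul_add, h, h', add_smul, mul_add]; abel⟩
  | smul c p =>
    by_cases hp : (⟨i, l⟩ : CPath n).target = p.start
    · rcases hl : p.len with _ | s
      · refine ⟨c, 0, ?_⟩
        rw [mul_smul_comm, pathClass_mul K Y _ _ hp, mul_zero, add_zero]
        congr 2
        exact CPath.ext rfl (by simp [CPath.append, hl])
      · refine ⟨0, c • pathClass K Y ⟨next p.start, s⟩, ?_⟩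
        rw [mul_smul_comm, mul_smul_comm, pathClass_mul K Y _ _ hp, zero_smul, zero_add,
          pathClass_mul K Y]
        · congr 2
          exact CPath.ext rfl (by simp [CPath.append, hl]; omega)
        · rw [CPath.target, Function.iterate_succ_apply', ← hp, CPath.target]
    · exact ⟨0, 0, by rw [mul_smul_comm, pathClass_mul_of_ne K Y _ _ hp]; simp⟩

theorem pathClass_mul_mul_pathClass (i j : Fin n) (l t : ℕ) (y : Alg K Y) :
    ∃ z, pathClass K Y ⟨i, l⟩ * y * pathClass K Y ⟨j, t⟩ = pathClass K Y ⟨i, l + t⟩ * z := by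
  induction y using Alg.induction_on with
  | zero => exact ⟨0, by simp⟩
  | add y y' h h' =>
    obtain ⟨z, h⟩ := h
    obtain ⟨z', h'⟩ := h'
    exact ⟨z + z', by rw [mul_add, add_mul, h, h', mul_add]⟩
  | smul c p =>
    by_cases hp : (⟨i, l⟩ : CPath n).target = p.start
    · by_cases hq : p.target = j
      · refine ⟨c • pathClass K Y ⟨next^[l + t] i, p.len⟩, ?_⟩
        rw [mul_smul_comm, smul_mul_assoc, mul_smul_comm, pathClass_mul K Y _ _ hp,
          pathClass_mul K Y _ _ ((CPath.target_append _ _ hp).trans hq),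
          pathClass_mul K Y _ _ rfl]
        congr 2
        exact CPath.ext rfl (by simp [CPath.append]; omega)
      · refine ⟨0, ?_⟩
        rw [mul_assoc, smul_mul_assoc, pathClass_mul_of_ne K Y _ _ hq]
        simp
    · refine ⟨0, ?_⟩
      rw [mul_smul_comm, pathClass_mul_of_ne K Y _ _ hp]
      simp

theorem projPath_mem_projFil {i : Fin n} {l m : ℕ} (h : l ≤ m) :
    projPath K Y i m ∈ projFil K Y i l := by
  rw [mem_projFil_iff]
  refine ⟨pathClass K Y ⟨next^[l] i, m - l⟩, ?_⟩
  rw [pathClass_mul K Y _ _ rfl, coe_projPath]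
  congr 1
  exact CPath.ext rfl (by simp [CPath.append]; omega)

theorem projFil_antitone (i : Fin n) : Antitone (projFil K Y i) := fun _ _ h =>
  (Submodule.span_singleton_le_iff_mem _ _).2 (projPath_mem_projFil K Y h)

theorem projFil_zero (i : Fin n) : projFil K Y i 0 = ⊤ := by
  rw [eq_top_iff]
  rintro x -
  rw [mem_projFil_iff]
  exact ⟨x, (proj_idem_mul x).symm⟩

theorem projFil_eq_bot {i : Fin n} {l : ℕ} (h : Y.kupisch i ≤ l) : projFil K Y i l = ⊥ := by
  rw [projFil, (projPath_eq_zero_iff K Y i l).2 h, Submodule.span_singleton_eq_bot]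

theorem projFil_le_projFil_iff {i : Fin n} {l m : ℕ} (hl : l < Y.kupisch i) :
    projFil K Y i l ≤ projFil K Y i m ↔ m ≤ l := by
  refine ⟨fun h => ?_, fun h => projFil_antitone K Y i h⟩
  by_contra hlt
  obtain ⟨y, hy⟩ := (mem_projFil_iff K Y i m _).1 (h (projPath_mem_projFil K Y le_rfl))
  -- Multiplying by the path of this length turns the path of length l into the longest nonzero path
  -- from i, but kills all multiples of the longer path of length m.
  obtain ⟨z, hz⟩ := pathClass_mul_mul_pathClass K Y i (next^[l] i) m (Y.kupisch i - 1 - l) y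
  rw [← hy, coe_projPath, pathClass_mul K Y _ _ rfl,
    pathClass_eq_zero (p := ⟨i, m + _⟩) ((Y.bad_mk_iff _ _).2 (by omega)), zero_mul,
    pathClass_eq_zero_iff, Relations.bad_iff] at hz
  simp only [CPath.append] at hz
  omega

/-- If l is the exact level of x in the filtration, then x has a nonzero leading coefficient at the
path of length l. Multiples of x thus have every path of length m ≥ l as leading term, and the
higher terms can be removed. -/
theorem exists_span_singleton_eq_projFil (i : Fin n) (x : proj K Y i) (hx : x ≠ 0) :
    ∃ l < Y.kupisch i, Submodule.span (Alg K Y)ᵐᵒᵖ {x} = projFil K Y i l := by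
  classical
  have hex : ∃ l, x ∉ projFil K Y i l := ⟨Y.kupisch i, by
    rwa [projFil_eq_bot K Y le_rfl, Submodule.mem_bot]⟩
  obtain ⟨l, hl⟩ : ∃ l, Nat.find hex = l + 1 := by
    refine Nat.exists_eq_add_one_of_ne_zero fun h0 => ?_
    have := Nat.find_spec hex
    rw [h0, projFil_zero] at this
    exact this trivial
  have h1 : x ∈ projFil K Y i l := not_not.1 (Nat.find_min hex (m := l) (by omega))
  have h2 : x ∉ projFil K Y i (l + 1) := hl ▸ Nat.find_spec hex
  have h3 : l < Y.kupisch i := by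
    by_contra h
    rw [projFil_eq_bot K Y (not_lt.1 h), Submodule.mem_bot] at h1
    exact hx h1
  refine ⟨l, h3, le_antisymm ((Submodule.span_singleton_le_iff_mem _ _).2 h1) ?_⟩
  obtain ⟨y, hy⟩ := (mem_projFil_iff K Y i l x).1 h1
  obtain ⟨a, z, hz⟩ := pathClass_mul_eq_add K Y i l y
  have ha : a ≠ 0 := by
    rintro rfl
    exact h2 ((mem_projFil_iff K Y i _ x).2 ⟨z, by rw [hy, hz, zero_smul, zero_add]⟩)
  -- Descending induction on m from the length of P_i, where the path vanishes; d bounds the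
  -- distance still to go.
  have key : ∀ d m, l ≤ m → Y.kupisch i ≤ m + d →
      projPath K Y i m ∈ Submodule.span (Alg K Y)ᵐᵒᵖ {x} := by
    intro d
    induction d with
    | zero =>
      intro m _ hm
      rw [(projPath_eq_zero_iff K Y i m).2 hm]
      exact zero_mem _
    | succ d ih =>
      intro m hlm hm
      obtain ⟨w, hw⟩ := pathClass_mul_mul_pathClass K Y i (next^[l] i) (l + 1) (m - l) z
      have h5 : (x : Alg K Y) * pathClass K Y ⟨next^[l] i, m - l⟩ =
          a • pathClass K Y ⟨i, m⟩ + pathClass K Y ⟨i, m + 1⟩ * w := by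
        rw [hy, hz, add_mul, hw, smul_mul_assoc, pathClass_mul K Y _ _ rfl]
        congr 3
        · exact CPath.ext rfl (by simp [CPath.append]; omega)
        · congr 1
          omega
      have h6 : projPath K Y i m = MulOpposite.op (a⁻¹ • pathClass K Y ⟨next^[l] i, m - l⟩) • x -
          MulOpposite.op (a⁻¹ • w) • projPath K Y i (m + 1) := by
        refine Subtype.ext ?_
        change pathClass K Y ⟨i, m⟩ = (x : Alg K Y) * (a⁻¹ • pathClass K Y ⟨next^[l] i, m - l⟩) -
          pathClass K Y ⟨i, m + 1⟩ * (a⁻¹ • w)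
        rw [mul_smul_comm, mul_smul_comm, h5, smul_add, smul_smul, inv_mul_cancel₀ ha, one_smul,
          add_sub_cancel_right]
      rw [h6]
      exact sub_mem (Submodule.smul_mem _ _ (Submodule.mem_span_singleton_self x))
        (Submodule.smul_mem _ _ (ih (m + 1) (by omega) (by omega)))
  exact (Submodule.span_singleton_le_iff_mem _ _).2 (key (Y.kupisch i) l le_rfl (by omega))

/-- The indecomposable projectives are uniserial. -/
theorem exists_eq_projFil (i : Fin n) (S : Submodule (Alg K Y)ᵐᵒᵖ (proj K Y i)) :
    ∃ l ≤ Y.kupisch i, S = projFil K Y i l := by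
  classical
  have hex : ∃ l, projPath K Y i l ∈ S := ⟨Y.kupisch i, by
    rw [(projPath_eq_zero_iff K Y i _).2 le_rfl]; exact zero_mem _⟩
  refine ⟨Nat.find hex, Nat.find_min' hex ?_, le_antisymm (fun x hx => ?_) ?_⟩
  · rw [(projPath_eq_zero_iff K Y i _).2 le_rfl]; exact zero_mem _
  · by_cases h0 : x = 0
    · rw [h0]; exact zero_mem _
    · obtain ⟨l, -, hl⟩ := exists_span_singleton_eq_projFil K Y i x h0
      have h1 : projFil K Y i l ≤ S := hl ▸ (Submodule.span_singleton_le_iff_mem _ _).2 hx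
      have h2 : Nat.find hex ≤ l := Nat.find_min' hex (h1 (projPath_mem_projFil K Y le_rfl))
      exact projFil_antitone K Y i h2 (hl ▸ Submodule.mem_span_singleton_self x)
  · exact (Submodule.span_singleton_le_iff_mem _ _).2 (Nat.find_spec hex)

theorem projFil_covBy {i : Fin n} {l : ℕ} (hl : l < Y.kupisch i) :
    projFil K Y i (l + 1) ⋖ projFil K Y i l := by
  refine ⟨lt_of_le_not_ge (projFil_antitone K Y i l.le_succ) fun h => ?_, fun S h1 h2 => ?_⟩
  · have := (projFil_le_projFil_iff K Y hl).1 h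
    omega
  · obtain ⟨m, hm, rfl⟩ := exists_eq_projFil K Y i S
    have h3 : ¬ m ≤ l := fun h => h2.not_ge (projFil_antitone K Y i h)
    have h4 : ¬ l + 1 ≤ m := fun h => h1.not_ge (projFil_antitone K Y i h)
    omega

/-- The filtration by path length is a composition series. It decreases with the length, so its
terms are listed in reverse. -/
theorem projLength_eq (i : Fin n) : projLength K Y i = Y.kupisch i := by
  have h := Module.length_compositionSeries (R := (Alg K Y)ᵐᵒᵖ) (M := proj K Y i)
    { length := Y.kupisch i
      toFun := fun k => projFil K Y i (Y.kupisch i - k)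
      step := fun k => by
        have hk := k.isLt
        have := projFil_covBy K Y (i := i) (l := Y.kupisch i - (k + 1)) (by omega)
        have h2 : Y.kupisch i - (k.val + 1) + 1 = Y.kupisch i - k := by omega
        rw [h2] at this
        exact this }
    (by
      change projFil K Y i (Y.kupisch i - 0) = ⊥
      exact projFil_eq_bot K Y le_rfl)
    (by
      change projFil K Y i (Y.kupisch i - Y.kupisch i) = ⊤
      rw [Nat.sub_self, projFil_zero])
  rw [projLength, ← h]
  rfl

theorem isAtom_projFil (i : Fin n) : IsAtom (projFil K Y i (Y.kupisch i - 1)) := by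
  have h := Y.kupisch_pos i
  rw [← bot_covBy_iff, ← projFil_eq_bot K Y (le_refl (Y.kupisch i))]
  have := projFil_covBy K Y (i := i) (l := Y.kupisch i - 1) (by omega)
  rwa [Nat.sub_add_cancel h] at this

theorem socle_proj (i : Fin n) :
    socle (Alg K Y)ᵐᵒᵖ (proj K Y i) = projFil K Y i (Y.kupisch i - 1) := by
  apply le_antisymm
  · refine sSup_le fun S hS => ?_
    have hS : IsAtom S := isSimpleModule_iff_isAtom.1 hS
    obtain ⟨m, hm, rfl⟩ := exists_eq_projFil K Y i S
    have hmlt : m < Y.kupisch i := by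
      refine lt_of_le_of_ne hm ?_
      rintro rfl
      exact hS.1 (projFil_eq_bot K Y le_rfl)
    have := (hS.le_iff.1 (projFil_antitone K Y i (show m ≤ Y.kupisch i - 1 by omega))).resolve_left
      (isAtom_projFil K Y i).1
    exact this.ge
  · exact le_sSup (isSimpleModule_iff_isAtom.2 (isAtom_projFil K Y i))

theorem jacobson_proj (i : Fin n) :
    Module.jacobson (Alg K Y)ᵐᵒᵖ (proj K Y i) = projFil K Y i 1 := by
  have hc : projFil K Y i 1 ⋖ ⊤ := by
    rw [← projFil_zero]
    exact projFil_covBy K Y (Y.kupisch_pos i)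
  apply le_antisymm
  · exact sInf_le (covBy_top_iff.1 hc)
  · refine le_sInf fun S hS => ?_
    have hS : IsCoatom S := hS
    obtain ⟨m, hm, rfl⟩ := exists_eq_projFil K Y i S
    rcases m with _ | m
    · exact absurd (projFil_zero K Y i) hS.1
    · have := (hS.le_iff.1 (projFil_antitone K Y i (show 1 ≤ m + 1 by omega))).resolve_left hc.lt.ne
      exact this.le

/-- Left multiplication by an element of `Λ`, as a map `P_j → P_i`. -/
noncomputable def leftMul (i j : Fin n) :
    Alg K Y →ₗ[K] (proj K Y j →ₗ[(Alg K Y)ᵐᵒᵖ] proj K Y i) where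
  toFun a :=
    { toFun := fun p => ⟨idem K Y i * a * p, by
        rw [mem_proj_iff, ← mul_assoc, ← mul_assoc, idem_mul_self]⟩
      map_add' := fun p q => Subtype.ext (mul_add _ _ _)
      map_smul' := fun r p => Subtype.ext (by
        change _ * ((p : Alg K Y) * r.unop) = _ * _ * r.unop
        rw [mul_assoc, mul_assoc, mul_assoc]) }
  map_add' a b := LinearMap.ext fun p => Subtype.ext (by
    change _ * (a + b) * _ = _ * a * _ + _ * b * _
    rw [mul_add, add_mul])
  map_smul' c a := LinearMap.ext fun p => Subtype.ext (by
    change _ * (c • a) * _ = c • (_ * a * _)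
    rw [mul_smul_comm, smul_mul_assoc])

theorem coe_leftMul (i j : Fin n) (a : Alg K Y) (p : proj K Y j) :
    (leftMul K Y i j a p : Alg K Y) = idem K Y i * a * p := rfl

theorem coe_leftMul_pathClass (q : CPath n) (j : Fin n) (p : proj K Y j) :
    (leftMul K Y q.start j (pathClass K Y q) p : Alg K Y) = pathClass K Y q * p := by
  rw [coe_leftMul, idem_mul_pathClass]

/-- The socle of P_i is generated by the path of length c_i - 1, hence is the simple module at the
end of that path; one more step gives the target of the arrow. -/
theorem resolutionQuiver_adj_iff (i j : Fin n) :
    (resolutionQuiver K Y).Adj i j ↔ next^[Y.kupisch i] i = j := by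
  have hpos := Y.kupisch_pos i
  have hsucc : ∀ k : Fin n, next^[Y.kupisch i] i = next k ↔ next^[Y.kupisch i - 1] i = k := by
    intro k
    conv_lhs => rw [← Nat.sub_add_cancel hpos, Function.iterate_succ_apply']
    exact next_injective.eq_iff
  have main : ∀ k : Fin n, Nonempty (socle (Alg K Y)ᵐᵒᵖ (proj K Y i) ≃ₗ[(Alg K Y)ᵐᵒᵖ] SimpleAt K Y k)
      ↔ next^[Y.kupisch i - 1] i = k := by
    intro k
    constructor
    · rintro ⟨g⟩
      -- The generator of the top of P_k is fixed by e_k, hence so is its image u in the socle of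
      -- P_i. As u is a scalar multiple of the longest path from i, this path must end at k.
      set e : SimpleAt K Y k := Submodule.Quotient.mk (projPath K Y k 0) with he
      have he0 : e ≠ 0 := by
        rw [he, Ne, Submodule.Quotient.mk_eq_zero, jacobson_proj]
        intro h
        have := (projFil_le_projFil_iff K Y (Y.kupisch_pos k)).1
          ((Submodule.span_singleton_le_iff_mem _ _).2 h)
        omega
      have hee : MulOpposite.op (idem K Y k) • e = e := by
        rw [he, ← Submodule.Quotient.mk_smul]
        congr 1
        exact Subtype.ext (idem_mul_self K Y k)
      set u := g.symm e with hu
      have hu0 : u ≠ 0 := by rwa [hu, Ne, LinearEquiv.map_eq_zero_iff]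
      have hue : MulOpposite.op (idem K Y k) • u = u := by rw [hu, ← map_smul, hee]
      have hmem : (u : proj K Y i) ∈ projFil K Y i (Y.kupisch i - 1) := socle_proj K Y i ▸ u.2
      obtain ⟨y, hy⟩ := (mem_projFil_iff K Y i _ _).1 hmem
      obtain ⟨a, z, hz⟩ := pathClass_mul_eq_add K Y i (Y.kupisch i - 1) y
      rw [hz, Nat.sub_add_cancel hpos, pathClass_eq_zero ((Y.bad_mk_iff _ _).2 le_rfl), zero_mul,
        add_zero] at hy
      by_contra hne
      have h1 : ((u : proj K Y i) : Alg K Y) * idem K Y k = ((u : proj K Y i) : Alg K Y) :=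
        congrArg Subtype.val (congrArg Subtype.val hue)
      rw [hy, smul_mul_assoc, idem, pathClass_mul_of_ne K Y ⟨i, _⟩ ⟨k, _⟩ hne, smul_zero, ← hy] at h1
      exact hu0 (Subtype.ext (Subtype.ext h1.symm))
    · intro hk
      -- Left multiplication by the longest path maps P_k to P_i with kernel rad P_k and image soc
      -- P_i.
      set f := leftMul K Y i k (pathClass K Y ⟨i, Y.kupisch i - 1⟩) with hf
      have hfp : ∀ p, (f p : Alg K Y) = pathClass K Y ⟨i, Y.kupisch i - 1⟩ * p :=
        coe_leftMul_pathClass K Y ⟨i, Y.kupisch i - 1⟩ k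
      have hker : LinearMap.ker f = Module.jacobson (Alg K Y)ᵐᵒᵖ (proj K Y k) := by
        rw [jacobson_proj]
        obtain ⟨m, hm, hS⟩ := exists_eq_projFil K Y k (LinearMap.ker f)
        have h1 : projPath K Y k 1 ∈ LinearMap.ker f := by
          rw [LinearMap.mem_ker]
          refine Subtype.ext ?_
          rw [hfp, coe_projPath, pathClass_mul K Y ⟨i, _⟩ ⟨k, _⟩ hk]
          exact pathClass_eq_zero ((Y.bad_mk_iff _ _).2 (by simp only; omega))
        have h2 : projPath K Y k 0 ∉ LinearMap.ker f := by
          rw [LinearMap.mem_ker]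
          intro h
          have h := congrArg Subtype.val h
          simp only [hfp] at h
          rw [coe_projPath, pathClass_mul K Y ⟨i, _⟩ ⟨k, _⟩ hk, ZeroMemClass.coe_zero, pathClass_eq_zero_iff,
            Relations.bad_iff] at h
          simp only [CPath.append] at h
          omega
        rcases m with _ | m
        · rw [hS, projFil_zero] at h2
          exact absurd trivial h2
        · refine le_antisymm ?_ ((Submodule.span_singleton_le_iff_mem _ _).2 h1)
          rw [hS]
          exact projFil_antitone K Y k (by omega)
      have hrange : LinearMap.range f = socle (Alg K Y)ᵐᵒᵖ (proj K Y i) := by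
        rw [socle_proj]
        ext x
        rw [mem_projFil_iff, LinearMap.mem_range]
        constructor
        · rintro ⟨p, rfl⟩
          exact ⟨p, hfp p⟩
        · rintro ⟨y, hy⟩
          refine ⟨⟨idem K Y k * y, by rw [mem_proj_iff, ← mul_assoc, idem_mul_self]⟩,
            Subtype.ext ?_⟩
          rw [hfp, hy, ← mul_assoc, idem, pathClass_mul K Y ⟨i, _⟩ ⟨k, _⟩ hk]
          rfl
      exact ⟨((Submodule.quotEquivOfEq _ _ hker.symm).trans
        ((LinearMap.quotKerEquivRange f).trans (LinearEquiv.ofEq _ _ hrange))).symm⟩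
  constructor
  · rintro ⟨k, rfl, h⟩
    exact (hsucc k).2 ((main k).1 h)
  · intro h
    refine ⟨next^[Y.kupisch i - 1] i, ?_, (main _).2 rfl⟩
    rw [← h, (hsucc _).2 rfl]

end Projectives

end Nakayama
namespace Nakayama

/-! ### The lift of the resolution quiver to a monotone map of ℕ -/

section Step

variable {n : ℕ}

theorem next_ofNat [NeZero n] (a : ℕ) : next (Fin.ofNat n a) = Fin.ofNat n (a + 1) := by
  refine Fin.ext ?_
  simp [next, Nat.add_mod]

theorem next_iterate_ofNat [NeZero n] (a b : ℕ) :
    next^[b] (Fin.ofNat n a) = Fin.ofNat n (a + b) := by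
  induction b with
  | zero => rfl
  | succ b ih => rw [Function.iterate_succ_apply', ih, next_ofNat]; rfl

theorem ofNat_val [NeZero n] (i : Fin n) : Fin.ofNat n i.val = i :=
  Fin.ext (Nat.mod_eq_of_lt i.isLt)

theorem ofNat_eq_iff [NeZero n] (a b : ℕ) : Fin.ofNat n a = Fin.ofNat n b ↔ a % n = b % n :=
  Fin.ext_iff

namespace Relations

variable [NeZero n] (Y : Relations n)

/-- The lift to `ℕ` of the map sending the vertex `i` to the target of the arrow of the resolution
quiver starting at `i`. -/
noncomputable def step (a : ℕ) : ℕ := a + Y.kupisch (Fin.ofNat n a)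

theorem step_val (i : Fin n) : Y.step i.val = i.val + Y.kupisch i := by
  rw [step, ofNat_val]

theorem lt_step (a : ℕ) : a < Y.step a := by
  have := Y.kupisch_pos (Fin.ofNat n a)
  rw [step]; omega

/-- This is the inequality c_i ≤ c_{i+1} + 1. With `step_add` it makes `step` a lift of a monotone
circle map of degree one. -/
theorem step_monotone : Monotone Y.step := by
  refine monotone_nat_of_le_succ fun a => ?_
  have := Y.kupisch_le_next (Fin.ofNat n a)
  rw [next_ofNat] at this
  rw [step, step]
  omega

theorem step_add (a : ℕ) : Y.step (a + n) = Y.step a + n := by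
  have : Fin.ofNat n (a + n) = Fin.ofNat n a := (ofNat_eq_iff _ _).2 (Nat.add_mod_right a n)
  rw [step, step, this]
  omega

theorem step_add_mul (a k : ℕ) : Y.step (a + k * n) = Y.step a + k * n := by
  induction k with
  | zero => simp
  | succ k ih => rw [add_mul, one_mul, ← add_assoc, step_add, ih]; omega

theorem next_iterate_kupisch (a : ℕ) :
    next^[Y.kupisch (Fin.ofNat n a)] (Fin.ofNat n a) = Fin.ofNat n (Y.step a) :=
  next_iterate_ofNat _ _

end Relations

end Step

/-! ### Renumbering the vertices other than the last -/

section Skip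

/-- The increasing enumeration of the natural numbers not congruent to `n` modulo `n + 1`. -/
def skip (n a : ℕ) : ℕ := a + a / n

variable {n : ℕ}

theorem skip_strictMono : StrictMono (skip n) := fun a b h => by
  have := Nat.div_le_div_right (c := n) h.le
  simp only [skip]
  omega

theorem skip_of_lt {a : ℕ} (h : a < n) : skip n a = a := by
  rw [skip, Nat.div_eq_of_lt h, add_zero]

theorem skip_add_mul [NeZero n] (a k : ℕ) : skip n (a + k * n) = skip n a + k * (n + 1) := by
  rw [skip, skip, Nat.add_mul_div_right _ _ (NeZero.pos n)]
  ring

theorem skip_add [NeZero n] (a : ℕ) : skip n (a + n) = skip n a + (n + 1) := by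
  simpa using skip_add_mul (n := n) a 1

theorem skip_mod [NeZero n] (a : ℕ) : skip n a % (n + 1) = a % n := by
  have h := Nat.mod_lt a (NeZero.pos n)
  conv_lhs => rw [← Nat.mod_add_div a n, mul_comm, skip_add_mul, skip_of_lt h,
    Nat.add_mul_mod_self_right]
  exact Nat.mod_eq_of_lt (by omega)

theorem exists_skip_eq [NeZero n] {b : ℕ} (h : b % (n + 1) ≠ n) : ∃ a, skip n a = b := by
  have h1 : b % (n + 1) < n + 1 := Nat.mod_lt b (Nat.succ_pos n)
  refine ⟨b % (n + 1) + b / (n + 1) * n, ?_⟩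
  rw [skip_add_mul, skip_of_lt (by omega), mul_comm]
  exact Nat.mod_add_div b (n + 1)

theorem skip_eq_div_mod [NeZero n] (a : ℕ) : skip n a = a % n + a / n * (n + 1) := by
  have h := Nat.mod_lt a (NeZero.pos n)
  conv_lhs => rw [← Nat.mod_add_div a n, mul_comm, skip_add_mul, skip_of_lt h]

theorem ofNat_skip [NeZero n] (a : ℕ) :
    Fin.ofNat (n + 1) (skip n a) = (Fin.ofNat n a).castSucc :=
  Fin.ext (skip_mod a)

/-- The increment of `skip` over m steps depends only on the residue of a, on which `skip` is the
identity. The form as a sum avoids truncated subtraction. -/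
theorem skip_add_eq [NeZero n] (a m : ℕ) : skip n (a + m) + a % n = skip n (a % n + m) + skip n a := by
  have h : a + m = a % n + m + a / n * n := by
    have := Nat.mod_add_div a n
    rw [mul_comm] at this
    omega
  rw [h, skip_add_mul, skip_eq_div_mod a]
  omega

end Skip

/-! ### Deleting the leaf from the Kupisch series -/

section Deletion

variable {n : ℕ}

/-- The Kupisch series of `Y'` is obtained from the one of `Y` by deleting the last vertex. -/
def IsDeletion (Y : Relations (n + 1)) (c : Fin n → ℕ) : Prop :=
  ∀ i : Fin n, skip n (i.val + c i) = i.val + Y.kupisch i.castSucc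

variable {Y : Relations (n + 1)}

theorem isLeaf_last_iff (K : Type u) [Field K] :
    IsLeaf (resolutionQuiver K Y) (Fin.last n) ↔ ∀ a, Y.step a % (n + 1) ≠ n := by
  constructor
  · intro h a ha
    refine h (Fin.ofNat (n + 1) a) ?_
    rw [resolutionQuiver_adj_iff, Y.next_iterate_kupisch]
    exact Fin.ext ha
  · intro h i hi
    rw [resolutionQuiver_adj_iff] at hi
    refine h i.val ?_
    have := congrArg Fin.val hi
    rw [val_next_iterate, ← Y.step_val] at this
    exact this

/-- `skip` conjugates the map of the deletion to a restriction of `step`; by periodicity it suffices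
that this holds on representatives. The function c need not yet be known to be a Kupisch series, as
`exists_isDeletion` requires. -/
theorem IsDeletion.skip_step [NeZero n] {c : Fin n → ℕ} (h : IsDeletion Y c) (a : ℕ) :
    skip n (a + c (Fin.ofNat n a)) = Y.step (skip n a) := by
  have h1 := h (Fin.ofNat n a)
  rw [Relations.step, ofNat_skip]
  have h2 := skip_add_eq (n := n) a (c (Fin.ofNat n a))
  have h3 : (Fin.ofNat n a).val = a % n := rfl
  rw [h3] at h1
  omega

/-- Since `step` avoids the class of the leaf, its value at i is `skip n b` for some b, and the new
series is b - i. Its Kupisch inequality is the monotonicity of `step`, pulled back along the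
increasing map `skip`. -/
theorem exists_isDeletion [NeZero n] (hY : ∀ a, Y.step a % (n + 1) ≠ n) :
    ∃ Y' : Relations n, IsDeletion Y Y'.kupisch := by
  have h : ∀ i : Fin n, ∃ c, 1 ≤ c ∧ skip n (i.val + c) = i.val + Y.kupisch i.castSucc := by
    intro i
    obtain ⟨b, hb⟩ := exists_skip_eq (hY i.castSucc.val)
    rw [Y.step_val, Fin.val_castSucc] at hb
    have h1 : i.val < b := by
      rw [← skip_strictMono.lt_iff_lt (a := i.val) (b := b), hb, skip_of_lt i.isLt]
      have := Y.kupisch_pos i.castSucc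
      omega
    exact ⟨b - i.val, by omega, by rw [Nat.add_sub_cancel' h1.le, hb]⟩
  choose c hc1 hc2 using h
  have hd : IsDeletion Y c := hc2
  refine ⟨Relations.ofKupisch c hc1 fun i => ?_, ?_⟩
  · have h1 := hd.skip_step i.val
    have h2 := hd.skip_step (i.val + 1)
    rw [← next_ofNat] at h2
    rw [ofNat_val] at h1 h2
    have h3 : skip n (i.val + c i) ≤ skip n (i.val + 1 + c (next i)) := by
      rw [h1, h2]
      exact Y.step_monotone (skip_strictMono.monotone (Nat.le_succ _))
    rw [skip_strictMono.le_iff_le] at h3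
    omega
  · rwa [Relations.kupisch_ofKupisch]

theorem IsDeletion.step [NeZero n] {Y' : Relations n} (h : IsDeletion Y Y'.kupisch) (a : ℕ) :
    skip n (Y'.step a) = Y.step (skip n a) := h.skip_step a

/-- The path of `Q_{n+1}` corresponding to a path of `Q_n`. -/
def liftPath (p : CPath n) : CPath (n + 1) :=
  ⟨p.start.castSucc, skip n (p.start.val + p.len) - p.start.val⟩

theorem liftPath_len (p : CPath n) :
    p.start.val + (liftPath p).len = skip n (p.start.val + p.len) := by
  have : p.start.val + p.len ≤ skip n (p.start.val + p.len) := skip_strictMono.le_apply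
  simp only [liftPath]
  omega

theorem target_liftPath [NeZero n] (p : CPath n) : (liftPath p).target = p.target.castSucc := by
  refine Fin.ext ?_
  rw [CPath.target, val_next_iterate, Fin.val_castSucc, CPath.target, val_next_iterate,
    ← skip_mod (n := n), ← liftPath_len p]
  rfl

theorem liftPath_append [NeZero n] (p q : CPath n) (h : p.target = q.start) :
    liftPath (p.append q) = (liftPath p).append (liftPath q) := by
  refine CPath.ext rfl ?_
  have h1 := liftPath_len (p.append q)
  have h2 := liftPath_len p
  have h3 := liftPath_len q
  have h4 := skip_add_eq (n := n) (p.start.val + p.len) q.len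
  have h5 : q.start.val = (p.start.val + p.len) % n := by
    rw [← h, CPath.target, val_next_iterate]
  rw [h5] at h3
  simp only [CPath.append, ← add_assoc] at *
  omega

theorem liftPath_injective : Function.Injective (liftPath (n := n)) := by
  intro p q h
  have h1 : p.start = q.start := Fin.castSucc_injective _ (congrArg CPath.start h)
  have h2 := liftPath_len p
  have h3 := liftPath_len q
  rw [h, h1, h3] at h2
  exact CPath.ext h1 (by have := skip_strictMono.injective h2; omega)

theorem exists_liftPath_eq [NeZero n] (q : CPath (n + 1)) (i j : Fin n) (hi : q.start = i.castSucc)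
    (hj : q.target = j.castSucc) : ∃ p, liftPath p = q := by
  have h1 : (i.val + q.len) % (n + 1) ≠ n := by
    have := congrArg Fin.val hj
    rw [CPath.target, val_next_iterate, hi, Fin.val_castSucc, Fin.val_castSucc] at this
    have := j.isLt
    omega
  obtain ⟨a, ha⟩ := exists_skip_eq h1
  have h2 : i.val ≤ a := by
    rw [← skip_strictMono.le_iff_le (a := i.val) (b := a), ha, skip_of_lt i.isLt]
    omega
  refine ⟨⟨i, a - i.val⟩, CPath.ext hi.symm ?_⟩
  simp only [liftPath]
  rw [Nat.add_sub_cancel' h2, ha]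
  omega

/-- Lifting is increasing in the length, and `IsDeletion` says that it takes the critical length to
the critical length. -/
theorem IsDeletion.bad_liftPath_iff {Y' : Relations n} (h : IsDeletion Y Y'.kupisch)
    (p : CPath n) : Y.Bad (liftPath p) ↔ Y'.Bad p := by
  have h1 := h p.start
  have h2 := liftPath_len p
  rw [Relations.bad_iff, Relations.bad_iff, ← add_le_add_iff_left p.start.val, h2]
  have h3 : (liftPath p).start = p.start.castSucc := rfl
  rw [h3, ← h1, skip_strictMono.le_iff_le, add_le_add_iff_left]

end Deletion

/-! ### The endomorphism algebra of P' is the deletion -/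

section EndAlgebra

variable (K : Type u) [Field K] {n : ℕ} (Y : Relations (n + 1))

/-- The endomorphism of `P'` given by left multiplication with the lift of a path. -/
noncomputable def endPath (p : CPath n) : EndAlg K Y :=
  LinearMap.pi fun k => leftMul K Y k.castSucc p.target.castSucc
    (if k = p.start then pathClass K Y (liftPath p) else 0) ∘ₗ LinearMap.proj p.target

theorem coe_endPath (p : CPath n) (v : PPrime K Y) (k : Fin n) :
    (endPath K Y p v k : Alg K Y) =
      if k = p.start then pathClass K Y (liftPath p) * v p.target else 0 := by
  change idem K Y k.castSucc * (if k = p.start then pathClass K Y (liftPath p) else 0) *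
    (v p.target : Alg K Y) = _
  split_ifs with h
  · subst h
    exact congrArg (· * _) (idem_mul_pathClass K Y (liftPath p))
  · rw [mul_zero, zero_mul]

/-- The homomorphism from the path algebra to `End(P')`. -/
noncomputable def endHom [NeZero n] : PathAlgebra K n →ₐ[K] EndAlg K Y :=
  PathAlgebra.lift (endPath K Y)
    (fun p q h => LinearMap.ext fun v => funext fun k => Subtype.ext (by
      rw [Module.End.mul_apply, coe_endPath, coe_endPath, coe_endPath, if_pos h,
        liftPath_append p q h, CPath.target_append p q h, ← mul_assoc, pathClass_mul]
      · rfl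
      · rw [target_liftPath, h]; rfl))
    (fun p q h => LinearMap.ext fun v => funext fun k => Subtype.ext (by
      rw [Module.End.mul_apply, coe_endPath, coe_endPath, if_neg h, mul_zero, ite_self]
      rfl))
    (LinearMap.ext fun v => funext fun k => Subtype.ext (by
      rw [LinearMap.sum_apply, Finset.sum_apply, AddSubmonoidClass.coe_finsetSum,
        Finset.sum_eq_single k]
      · rw [coe_endPath, if_pos rfl]
        change pathClass K Y ⟨k.castSucc, skip n (k.val + 0) - k.val⟩ * _ = _
        rw [add_zero, skip_of_lt k.isLt, Nat.sub_self]
        exact proj_idem_mul (v k)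
      · intro i _ hi
        rw [coe_endPath, if_neg (Ne.symm hi)]
      · simp))

theorem endPath_trivial (i : Fin n) : endPath K Y ⟨i, 0⟩ = endIdem K Y i := by
  refine LinearMap.ext fun v => funext fun k => Subtype.ext ?_
  rw [coe_endPath]
  change _ = ((Pi.single i (v i) : PPrime K Y) k : Alg K Y)
  split_ifs with h
  · simp only at h
    subst h
    rw [Pi.single_eq_same]
    change pathClass K Y ⟨k.castSucc, skip n (k.val + 0) - k.val⟩ * _ = _
    rw [add_zero, skip_of_lt k.isLt, Nat.sub_self]
    exact proj_idem_mul (v k)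
  · rw [Pi.single_eq_of_ne h, ZeroMemClass.coe_zero]

/-- The generator of the summand `P_j` of `P'`. -/
noncomputable def genPPrime (j : Fin n) : PPrime K Y := Pi.single j (projPath K Y j.castSucc 0)

theorem eq_sum_smul_gen (v : PPrime K Y) :
    v = ∑ j, MulOpposite.op (v j : Alg K Y) • genPPrime K Y j := by
  refine funext fun k => Subtype.ext ?_
  rw [Finset.sum_apply, Finset.sum_eq_single k]
  · rw [Pi.smul_apply, genPPrime, Pi.single_eq_same]
    exact (proj_idem_mul (v k)).symm
  · intro j _ hj
    rw [Pi.smul_apply, genPPrime, Pi.single_eq_of_ne (Ne.symm hj), smul_zero]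
  · simp

/-- The element of `Λ` whose component in `e_k Λ e_j` represents the component `P_j → P_k` of an
endomorphism of `P'`. -/
noncomputable def endEval : EndAlg K Y →ₗ[K] Alg K Y where
  toFun g := ∑ k, ∑ j, (g (genPPrime K Y j) k : Alg K Y)
  map_add' g h := by
    simp only [LinearMap.add_apply, Pi.add_apply, Submodule.coe_add, Finset.sum_add_distrib]
  map_smul' c g := by
    simp only [Finset.smul_sum, RingHom.id_apply]
    rfl

theorem endEval_endPath [NeZero n] (p : CPath n) :
    endEval K Y (endPath K Y p) = pathClass K Y (liftPath p) := by
  change ∑ k, ∑ j, (endPath K Y p (genPPrime K Y j) k : Alg K Y) = _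
  simp only [coe_endPath]
  rw [Finset.sum_eq_single p.start, Finset.sum_eq_single p.target]
  · rw [if_pos rfl, genPPrime, Pi.single_eq_same, coe_projPath]
    have := pathClass_mul_idem K Y (liftPath p)
    rwa [target_liftPath] at this
  · intro j _ hj
    rw [if_pos rfl, genPPrime, Pi.single_eq_of_ne (Ne.symm hj), ZeroMemClass.coe_zero, mul_zero]
  · simp
  · intro k _ hk
    simp [hk]
  · simp

theorem apply_gen_mul_idem (g : EndAlg K Y) (j k : Fin n) :
    (g (genPPrime K Y j) k : Alg K Y) * idem K Y j.castSucc = g (genPPrime K Y j) k := by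
  have h : MulOpposite.op (idem K Y j.castSucc) • genPPrime K Y j = genPPrime K Y j := by
    rw [genPPrime, ← Pi.single_smul]
    congr 1
    exact Subtype.ext (idem_mul_self K Y _)
  conv_rhs => rw [← h, map_smul]
  rfl

/-- The matrix entries of g lie in different components e_kΛe_j, so summing them in `endEval` loses
nothing. This yields injectivity of `endEval` and the control of its image. -/
theorem idem_mul_endEval_mul_idem (g : EndAlg K Y) (j k : Fin n) :
    idem K Y k.castSucc * endEval K Y g * idem K Y j.castSucc = g (genPPrime K Y j) k := by
  have hne : ∀ a b : Fin n, a ≠ b → idem K Y a.castSucc * idem K Y b.castSucc = 0 := fun a b hab =>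
    pathClass_mul_of_ne K Y _ _ fun h => hab (Fin.castSucc_injective _ h)
  change idem K Y k.castSucc * (∑ k, ∑ j, (g (genPPrime K Y j) k : Alg K Y)) * _ = _
  rw [Finset.mul_sum, Finset.sum_mul, Finset.sum_eq_single k]
  · rw [Finset.mul_sum, Finset.sum_mul, Finset.sum_eq_single j]
    · rw [proj_idem_mul, apply_gen_mul_idem]
    · intro j' _ hj
      rw [← apply_gen_mul_idem, mul_assoc, mul_assoc, hne _ _ hj, mul_zero, mul_zero]
    · simp
  · intro k' _ hk
    rw [Finset.mul_sum, Finset.sum_mul]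
    refine Finset.sum_eq_zero fun j' _ => ?_
    rw [← proj_idem_mul, ← mul_assoc, hne _ _ (Ne.symm hk), zero_mul, zero_mul]
  · simp

theorem endEval_injective : Function.Injective (endEval K Y) := by
  refine (injective_iff_map_eq_zero _).2 fun g hg => ?_
  have h : ∀ j, g (genPPrime K Y j) = 0 := fun j => funext fun k => Subtype.ext (by
    rw [← idem_mul_endEval_mul_idem, hg, mul_zero, zero_mul]; rfl)
  refine LinearMap.ext fun v => ?_
  rw [eq_sum_smul_gen K Y v, map_sum, map_sum]
  exact Finset.sum_congr rfl fun j _ => by rw [map_smul, h, smul_zero, LinearMap.zero_apply]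

/-- Sandwiching keeps only the paths from k to j, and a path between remaining vertices is a lift.
-/
theorem idem_mul_mul_idem_mem [NeZero n] (j k : Fin n) (x : Alg K Y) :
    idem K Y k.castSucc * x * idem K Y j.castSucc ∈
      Submodule.span K (Set.range fun p : CPath n => pathClass K Y (liftPath p)) := by
  induction x using Alg.induction_on with
  | zero => rw [mul_zero, zero_mul]; exact zero_mem _
  | add a b ha hb => rw [mul_add, add_mul]; exact add_mem ha hb
  | smul c q =>
    rw [mul_smul_comm, smul_mul_assoc]
    refine Submodule.smul_mem _ _ ?_
    by_cases h1 : k.castSucc = q.start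
    · by_cases h2 : q.target = j.castSucc
      · rw [h1, idem_mul_pathClass, ← h2, pathClass_mul_idem]
        obtain ⟨p, rfl⟩ := exists_liftPath_eq q k j h1.symm h2
        exact Submodule.subset_span ⟨p, rfl⟩
      · rw [mul_assoc, idem, idem, pathClass_mul_of_ne K Y q ⟨j.castSucc, 0⟩ h2, mul_zero]
        exact zero_mem _
    · rw [idem, idem, pathClass_mul_of_ne K Y ⟨k.castSucc, 0⟩ q h1, zero_mul]
      exact zero_mem _

theorem endEval_mem [NeZero n] (g : EndAlg K Y) : endEval K Y g ∈
    Submodule.span K (Set.range fun p : CPath n => pathClass K Y (liftPath p)) := by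
  change ∑ k, ∑ j, (g (genPPrime K Y j) k : Alg K Y) ∈ _
  refine Submodule.sum_mem _ fun k _ => Submodule.sum_mem _ fun j _ => ?_
  rw [← idem_mul_endEval_mul_idem]
  exact idem_mul_mul_idem_mem K Y j k _

theorem endHom_ofPath [NeZero n] (p : CPath n) :
    endHom K Y (PathAlgebra.ofPath K p) = endPath K Y p :=
  PathAlgebra.lift_ofPath _ _ _ _ _

theorem endPath_eq_zero [NeZero n] {p : CPath n} (h : Y.Bad (liftPath p)) : endPath K Y p = 0 :=
  endEval_injective K Y (by rw [endEval_endPath, pathClass_eq_zero h, map_zero])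

/-- The homomorphism `Λ' → End(P')`, for a deletion `Λ'` of the last vertex. -/
noncomputable def deletionHom [NeZero n] {Y' : Relations n} (h : IsDeletion Y Y'.kupisch) :
    Alg K Y' →ₐ[K] EndAlg K Y :=
  RingCon.liftₐ _ (endHom K Y) (by
    have h1 : relIdeal K Y' ≤ TwoSidedIdeal.ker (endHom K Y) := by
      refine TwoSidedIdeal.span_le.2 ?_
      rintro _ ⟨p, hp, rfl⟩
      rw [SetLike.mem_coe, TwoSidedIdeal.mem_ker, endHom_ofPath]
      exact endPath_eq_zero K Y ((h.bad_liftPath_iff p).2 (Relations.Bad.of_mem hp))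
    intro x y hxy
    have h2 := h1 ((TwoSidedIdeal.rel_iff _ _ _).1 hxy)
    rw [TwoSidedIdeal.mem_ker, map_sub, sub_eq_zero] at h2
    exact h2)

theorem deletionHom_pathClass [NeZero n] {Y' : Relations n} (h : IsDeletion Y Y'.kupisch)
    (p : CPath n) : deletionHom K Y h (pathClass K Y' p) = endPath K Y p :=
  endHom_ofPath K Y p

/-- After composition with the injective map `endEval`, the basis of good paths goes to the classes
of their lifts. These are distinct good paths, hence independent, and the lifts span a space
containing the image of `endEval`. -/
theorem deletionHom_bijective [NeZero n] {Y' : Relations n} (h : IsDeletion Y Y'.kupisch) :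
    Function.Bijective (deletionHom K Y h) := by
  constructor
  · have hli : LinearIndependent K ((endEval K Y ∘ₗ (deletionHom K Y h).toLinearMap) ∘
        pathBasis K Y') := by
      have h1 := (linearIndependent_pathClass K Y).comp
        (fun p : {p : CPath n // ¬ Y'.Bad p} =>
          (⟨liftPath p.1, fun hb => p.2 ((h.bad_liftPath_iff p.1).1 hb)⟩ :
            {p : CPath (n + 1) // ¬ Y.Bad p}))
        (fun p q hpq => Subtype.ext (liftPath_injective (congrArg Subtype.val hpq)))
      convert h1 using 1
      funext p
      simp only [Function.comp_apply, LinearMap.comp_apply, pathBasis_apply]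
      exact (congrArg _ (deletionHom_pathClass K Y h p.1)).trans (endEval_endPath K Y p.1)
    have hinj : Function.Injective (endEval K Y ∘ₗ (deletionHom K Y h).toLinearMap) := by
      have := (pathBasis K Y').injective_constr_of_linearIndependent (R₂ := K) hli
      exact (pathBasis K Y').constr_self K (endEval K Y ∘ₗ (deletionHom K Y h).toLinearMap) ▸ this
    exact Function.Injective.of_comp (f := endEval K Y) hinj
  · intro g
    have h1 : endEval K Y g ∈ LinearMap.range
        (endEval K Y ∘ₗ (deletionHom K Y h).toLinearMap) := by
      refine Submodule.span_le.2 ?_ (endEval_mem K Y g)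
      rintro _ ⟨p, rfl⟩
      exact ⟨pathClass K Y' p,
        (congrArg _ (deletionHom_pathClass K Y h p)).trans (endEval_endPath K Y p)⟩
    obtain ⟨x, hx⟩ := h1
    exact ⟨x, endEval_injective K Y hx⟩

/-- The deletion of a leaf presents the endomorphism algebra of the remaining projectives. -/
theorem exists_presentation_of_isDeletion [NeZero n] {Y' : Relations n}
    (h : IsDeletion Y Y'.kupisch) :
    ∃ φ : EndAlg K Y ≃ₐ[K] Alg K Y', IsPresentation K Y Y' φ := by
  refine ⟨(AlgEquiv.ofBijective _ (deletionHom_bijective K Y h)).symm, fun i => ?_⟩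
  rw [AlgEquiv.symm_apply_eq]
  exact ((deletionHom_pathClass K Y h ⟨i, 0⟩).trans (endPath_trivial K Y i)).symm

end EndAlgebra

/-! ### All presentations have the same Kupisch series -/

section Uniqueness

variable (K : Type u) [Field K] {n : ℕ}

/-- The dimension of e_iΛ depends only on the algebra with its idempotents, so the series can be
read off from any presentation. -/
theorem finrank_range_mulLeft_idem (Y : Relations n) (i : Fin n) :
    Module.finrank K (LinearMap.range (LinearMap.mulLeft K (idem K Y i))) = Y.kupisch i := by
  have hli : LinearIndependent K fun l : Fin (Y.kupisch i) => pathClass K Y ⟨i, l⟩ :=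
    (linearIndependent_pathClass K Y).comp
      (fun l : Fin (Y.kupisch i) => (⟨⟨i, l⟩, fun hb => by
          rw [Y.bad_mk_iff] at hb; have := l.isLt; omega⟩ : {p : CPath n // ¬ Y.Bad p}))
      (fun l m h => Fin.ext (congrArg (fun p : {p : CPath n // ¬ Y.Bad p} => p.1.len) h))
  have : LinearMap.range (LinearMap.mulLeft K (idem K Y i)) =
      Submodule.span K (Set.range fun l : Fin (Y.kupisch i) => pathClass K Y ⟨i, l⟩) := by
    apply le_antisymm
    · rintro _ ⟨x, rfl⟩
      rw [LinearMap.mulLeft_apply]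
      induction x using Alg.induction_on with
      | zero => rw [mul_zero]; exact zero_mem _
      | add a b ha hb => rw [mul_add]; exact add_mem ha hb
      | smul c p =>
        rw [mul_smul_comm]
        refine Submodule.smul_mem _ _ ?_
        by_cases hp : i = p.start
        · rw [hp, idem_mul_pathClass]
          by_cases hb : Y.Bad p
          · rw [pathClass_eq_zero hb]; exact zero_mem _
          · subst hp
            rw [Y.bad_iff, not_le] at hb
            exact Submodule.subset_span ⟨⟨p.len, hb⟩, rfl⟩
        · rw [idem, pathClass_mul_of_ne K Y ⟨i, 0⟩ p hp]
          exact zero_mem _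
    · rw [Submodule.span_le]
      rintro _ ⟨l, rfl⟩
      exact ⟨pathClass K Y ⟨i, l⟩, idem_mul_pathClass K Y ⟨i, l⟩⟩
  rw [this, finrank_span_eq_card hli, Fintype.card_fin]

theorem kupisch_eq_of_algEquiv {Y₁ Y₂ : Relations n} (e : Alg K Y₁ ≃ₐ[K] Alg K Y₂)
    (he : ∀ i, e (idem K Y₁ i) = idem K Y₂ i) : Y₁.kupisch = Y₂.kupisch := by
  funext i
  rw [← finrank_range_mulLeft_idem K Y₁ i, ← finrank_range_mulLeft_idem K Y₂ i]
  have h : LinearMap.range (LinearMap.mulLeft K (idem K Y₂ i)) =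
      (LinearMap.range (LinearMap.mulLeft K (idem K Y₁ i))).map e.toLinearEquiv.toLinearMap := by
    ext x
    constructor
    · rintro ⟨y, rfl⟩
      refine ⟨_, ⟨e.symm y, rfl⟩, ?_⟩
      change e (idem K Y₁ i * e.symm y) = idem K Y₂ i * y
      rw [map_mul, he, AlgEquiv.apply_symm_apply]
    · rintro ⟨_, ⟨y, rfl⟩, rfl⟩
      refine ⟨e y, ?_⟩
      change idem K Y₂ i * e y = e (idem K Y₁ i * y)
      rw [map_mul, he]
  rw [h]
  exact (LinearEquiv.finrank_map_eq e.toLinearEquiv _).symm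

/-- Every presentation of `End(P')` is given by a deletion of the leaf. -/
theorem IsPresentation.isDeletion [NeZero n] {Y : Relations (n + 1)}
    (hY : ∀ a, Y.step a % (n + 1) ≠ n) {Y' : Relations n} {φ : EndAlg K Y ≃ₐ[K] Alg K Y'}
    (hφ : IsPresentation K Y Y' φ) : IsDeletion Y Y'.kupisch := by
  obtain ⟨Y₁, h₁⟩ := exists_isDeletion hY
  obtain ⟨φ₁, hφ₁⟩ := exists_presentation_of_isDeletion K Y h₁
  rwa [← kupisch_eq_of_algEquiv K (φ₁.symm.trans φ) fun i => by
    rw [AlgEquiv.trans_apply, ← hφ₁ i, AlgEquiv.symm_apply_apply, hφ i]]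

end Uniqueness

end Nakayama
namespace Nakayama

/-! ### Cycles and components of the graph of a map -/

section FunctionalDigraph

variable {V : Type*} {G : Digraph V} {f : V → V}

theorem eq_iterate_of_isChain (a : V) (l : List V)
    (h : List.IsChain (fun x y => f x = y) (a :: l)) : a :: l = List.iterate f a (l.length + 1) := by
  induction l generalizing a with
  | nil => rfl
  | cons b l ih =>
    rw [List.isChain_cons_cons] at h
    rw [ih b h.2, List.length_iterate, ← h.1]
    rfl

/-- Every vertex has a single outgoing arrow, so a cycle is an orbit listed from its first vertex;
the absence of repetitions makes its length the minimal period. -/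
theorem IsOrientedCycle.eq_iterate (hG : ∀ i j, G.Adj i j ↔ f i = j) {c : List V}
    (hc : IsOrientedCycle G c) :
    ∃ a, 0 < c.length ∧ c = List.iterate f a c.length ∧ f^[c.length] a = a ∧
      ∀ p, 0 < p → p < c.length → f^[p] a ≠ a := by
  obtain ⟨h0, hnd, hch⟩ := hc
  rcases c with _ | ⟨a, l⟩
  · exact absurd rfl h0
  have h1 : List.IsChain (fun x y => f x = y) (a :: (l ++ [a])) :=
    List.IsChain.imp (fun x y h => (hG x y).1 h) ((Cycle.chain_coe_cons _ _ _).1 hch)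
  have h2 := eq_iterate_of_isChain a (l ++ [a]) h1
  rw [List.length_append, List.length_singleton, List.iterate_add, ← List.cons_append] at h2
  obtain ⟨h3, h4⟩ := List.append_inj h2 (by rw [List.length_iterate]; rfl)
  have h5 : f^[l.length + 1] a = a := by
    have : [a] = [f^[l.length + 1] a] := h4
    exact (List.cons.inj this).1.symm
  refine ⟨a, Nat.succ_pos _, h3, h5, fun p hp hpl hpa => ?_⟩
  rw [h3] at hnd
  have := (List.Nodup.getElem_inj_iff hnd (i := p) (j := 0)
    (hi := by rw [List.length_iterate]; exact hpl)
    (hj := by rw [List.length_iterate]; exact Nat.succ_pos _)).1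
    (by rw [List.getElem_iterate, List.getElem_iterate]; exact hpa)
  omega

theorem isOrientedCycle_of_mem_periodicPts (hG : ∀ i j, G.Adj i j ↔ f i = j) {x : V}
    (hx : x ∈ Function.periodicPts f) :
    IsOrientedCycle G ((List.range (Function.minimalPeriod f x)).map fun k => f^[k] x) := by
  refine ⟨?_, ?_, ?_⟩
  · have := Function.minimalPeriod_pos_of_mem_periodicPts hx
    simp only [ne_eq, List.map_eq_nil_iff, List.range_eq_nil]
    omega
  · have := Function.nodup_periodicOrbit (f := f) (x := x)
    rwa [Function.periodicOrbit, Cycle.nodup_coe_iff] at this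
  · exact (Function.periodicOrbit_chain' G.Adj hx).2 fun n =>
      (hG _ _).2 (Function.iterate_succ_apply' f n x).symm

theorem onCycle_iff (hG : ∀ i j, G.Adj i j ↔ f i = j) (x : V) :
    OnCycle G x ↔ x ∈ Function.periodicPts f := by
  constructor
  · rintro ⟨c, hc, hx⟩
    obtain ⟨a, hpos, hca, hper, -⟩ := hc.eq_iterate hG
    rw [hca, List.mem_iterate] at hx
    obtain ⟨k, -, rfl⟩ := hx
    exact ⟨c.length, hpos, Function.IsPeriodicPt.apply_iterate hper k⟩
  · intro hx
    refine ⟨_, isOrientedCycle_of_mem_periodicPts hG hx, ?_⟩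
    simp only [List.mem_map, List.mem_range]
    exact ⟨0, Function.minimalPeriod_pos_of_mem_periodicPts hx, rfl⟩

theorem reachable_of_adj {i j : V} (h : G.Adj i j) : G.toSimpleGraphInclusive.Reachable i j := by
  by_cases hij : i = j
  · rw [hij]
  · exact SimpleGraph.Adj.reachable ⟨hij, Or.inl h⟩

theorem reachable_iterate (hG : ∀ i j, G.Adj i j ↔ f i = j) (i : V) (k : ℕ) :
    G.toSimpleGraphInclusive.Reachable i (f^[k] i) := by
  induction k with
  | zero => exact SimpleGraph.Reachable.refl _
  | succ k ih =>
    refine ih.trans (reachable_of_adj ((hG _ _).2 ?_))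
    rw [Function.iterate_succ_apply']

theorem exists_iterate_mem_periodicPts [Finite V] (i : V) :
    ∃ k, f^[k] i ∈ Function.periodicPts f := by
  obtain ⟨k, l, hne, h⟩ := Finite.exists_ne_map_eq_of_infinite (fun k => f^[k] i)
  wlog hkl : k < l generalizing k l
  · exact this l k hne.symm h.symm (by omega)
  refine ⟨k, l - k, by omega, ?_⟩
  change f^[l - k] (f^[k] i) = f^[k] i
  rw [← Function.iterate_add_apply, Nat.sub_add_cancel hkl.le]
  exact h.symm

theorem exists_isOrientedCycle_of_component [Finite V] (hG : ∀ i j, G.Adj i j ↔ f i = j)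
    (C : Component G) : ∃ c : List V, IsOrientedCycle G c ∧
      ∀ i ∈ c, G.toSimpleGraphInclusive.connectedComponentMk i = C := by
  obtain ⟨i, rfl⟩ := C.exists_rep
  obtain ⟨k, hk⟩ := exists_iterate_mem_periodicPts (f := f) i
  refine ⟨_, isOrientedCycle_of_mem_periodicPts hG hk, fun j hj => ?_⟩
  simp only [List.mem_map, List.mem_range] at hj
  obtain ⟨m, -, rfl⟩ := hj
  rw [← Function.iterate_add_apply]
  exact SimpleGraph.ConnectedComponent.sound (reachable_iterate hG i _).symm

theorem reachable_map {W : Type*} {H : Digraph W} (r : V → W)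
    (hr : ∀ i j, G.Adj i j → H.toSimpleGraphInclusive.Reachable (r i) (r j)) {i j : V}
    (h : G.toSimpleGraphInclusive.Reachable i j) :
    H.toSimpleGraphInclusive.Reachable (r i) (r j) := by
  obtain ⟨p⟩ := h
  induction p with
  | nil => exact SimpleGraph.Reachable.refl _
  | cons h _ ih =>
    refine SimpleGraph.Reachable.trans ?_ ih
    rcases h.2 with h | h
    · exact hr _ _ h
    · exact (hr _ _ h).symm

end FunctionalDigraph

/-! ### Removing a leaf from the graph of a map -/

section DeleteLeaf

variable {n : ℕ} {G : Digraph (Fin (n + 1))} {G' : Digraph (Fin n)} {f : Fin (n + 1) → Fin (n + 1)}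
  {f' : Fin n → Fin n}

/-- The inclusion of the remaining vertices and the retraction r, which sends the leaf to its image
under f, both preserve reachability. -/
theorem card_component_eq (hG : ∀ i j, G.Adj i j ↔ f i = j) (hG' : ∀ i j, G'.Adj i j ↔ f' i = j)
    (hf : ∀ i, (f' i).castSucc = f i.castSucc) (hlast : ∀ i, f i ≠ Fin.last n) :
    Nat.card (Component G') = Nat.card (Component G) := by
  obtain ⟨j₀, hj₀⟩ : ∃ j, j.castSucc = f (Fin.last n) :=
    ⟨(f (Fin.last n)).castPred (hlast _), Fin.castSucc_castPred _ _⟩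
  set r : Fin (n + 1) → Fin n := Fin.lastCases j₀ id with hr
  have hr1 : ∀ i : Fin n, r i.castSucc = i := fun i => by simp [hr]
  have hr2 : r (Fin.last n) = j₀ := by simp [hr]
  have hι : ∀ i j, G'.Adj i j → G.toSimpleGraphInclusive.Reachable i.castSucc j.castSucc := by
    intro i j h
    refine reachable_of_adj ((hG _ _).2 ?_)
    rw [← hf, (hG' _ _).1 h]
  have hr3 : ∀ i j, G.Adj i j → G'.toSimpleGraphInclusive.Reachable (r i) (r j) := by
    intro i j h
    obtain rfl := (hG _ _).1 h
    induction i using Fin.lastCases with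
    | last => rw [hr2, ← hj₀, hr1]
    | cast i => rw [hr1, ← hf, hr1]; exact reachable_of_adj ((hG' _ _).2 rfl)
  refine Nat.card_eq_of_bijective (Quot.map Fin.castSucc fun i j h => reachable_map _ hι h)
    ⟨?_, ?_⟩
  · rintro ⟨i⟩ ⟨j⟩ h
    have h1 : G.toSimpleGraphInclusive.Reachable i.castSucc j.castSucc :=
      SimpleGraph.ConnectedComponent.exact h
    have h2 := reachable_map r hr3 h1
    rw [hr1, hr1] at h2
    exact SimpleGraph.ConnectedComponent.sound h2
  · rintro ⟨i⟩
    induction i using Fin.lastCases with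
    | last =>
      exact ⟨G'.toSimpleGraphInclusive.connectedComponentMk j₀,
        SimpleGraph.ConnectedComponent.sound (reachable_of_adj ((hG _ _).2 hj₀.symm)).symm⟩
    | cast i => exact ⟨G'.toSimpleGraphInclusive.connectedComponentMk i, rfl⟩

theorem iterate_castSucc (hf : ∀ i, (f' i).castSucc = f i.castSucc) (i : Fin n) (k : ℕ) :
    (f'^[k] i).castSucc = f^[k] i.castSucc := by
  induction k with
  | zero => rfl
  | succ k ih => rw [Function.iterate_succ_apply', Function.iterate_succ_apply', hf, ih]

theorem onCycle_castSucc_iff (hG : ∀ i j, G.Adj i j ↔ f i = j)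
    (hG' : ∀ i j, G'.Adj i j ↔ f' i = j) (hf : ∀ i, (f' i).castSucc = f i.castSucc) (i : Fin n) :
    OnCycle G i.castSucc ↔ OnCycle G' i := by
  rw [onCycle_iff hG, onCycle_iff hG']
  have h : ∀ k, Function.IsPeriodicPt f k i.castSucc ↔ Function.IsPeriodicPt f' k i := fun k => by
    rw [Function.IsPeriodicPt, Function.IsFixedPt, ← iterate_castSucc hf]
    exact (Fin.castSucc_injective n).eq_iff
  exact exists_congr fun k => and_congr_right fun _ => h k

theorem card_not_onCycle_eq (hG : ∀ i j, G.Adj i j ↔ f i = j)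
    (hG' : ∀ i j, G'.Adj i j ↔ f' i = j) (hf : ∀ i, (f' i).castSucc = f i.castSucc)
    (hlast : ∀ i, f i ≠ Fin.last n) :
    Nat.card {i // ¬ OnCycle G' i} + 1 = Nat.card {i // ¬ OnCycle G i} := by
  have h0 : ¬ OnCycle G (Fin.last n) := by
    rw [onCycle_iff hG]
    rintro ⟨k, hk, h⟩
    -- A periodic leaf would be the image of the preceding point of its orbit.
    obtain ⟨m, rfl⟩ : ∃ m, k = m + 1 := ⟨k - 1, by omega⟩
    refine hlast (f^[m] (Fin.last n)) ?_
    rw [← Function.iterate_succ_apply' f]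
    exact h
  have h1 : {i | ¬ OnCycle G i} = insert (Fin.last n) (Fin.castSucc '' {i | ¬ OnCycle G' i}) := by
    ext i
    induction i using Fin.lastCases with
    | last => simpa using h0
    | cast i =>
      simp only [Set.mem_ofPred_eq, Set.mem_insert_iff, Set.mem_image,
        (Fin.castSucc_lt_last i).ne, false_or, onCycle_castSucc_iff hG hG' hf]
      constructor
      · exact fun h => ⟨i, h, rfl⟩
      · rintro ⟨j, hj, h⟩
        rwa [← Fin.castSucc_injective n h]
  have h2 : Nat.card {i // ¬ OnCycle G i} = {i | ¬ OnCycle G i}.ncard := rfl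
  have h3 : Nat.card {i // ¬ OnCycle G' i} = {i | ¬ OnCycle G' i}.ncard := rfl
  rw [h2, h3, h1, Set.ncard_insert_of_notMem, Set.ncard_image_of_injective _
    (Fin.castSucc_injective n)]
  rintro ⟨i, -, h⟩
  exact (Fin.castSucc_lt_last i).ne h

end DeleteLeaf

/-! ### Rotation numbers of monotone circle maps -/

section RotationNumber

variable {N : ℕ} {F : ℕ → ℕ}

theorem iterate_add_mul (hN : ∀ a k, F (a + k * N) = F a + k * N) (m a k : ℕ) :
    F^[m] (a + k * N) = F^[m] a + k * N := by
  induction m with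
  | zero => rfl
  | succ m ih => rw [Function.iterate_succ_apply', ih, hN, ← Function.iterate_succ_apply' F]

theorem iterate_mul_eq (hN : ∀ a k, F (a + k * N) = F a + k * N) {m w x : ℕ}
    (h : F^[m] x = x + w * N) (j : ℕ) : F^[m * j] x = x + j * w * N := by
  induction j with
  | zero => simp
  | succ j ih =>
    rw [Nat.mul_succ, add_comm, Function.iterate_add_apply, ih, iterate_add_mul hN, h]
    ring

/-- After m m' k iterations x has advanced by m'wkN and y by mw'kN. Monotonicity keeps the orbit of
x below a translate of the orbit of y, so the first rate of growth cannot exceed the second. -/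
theorem mul_le_mul_of_periodic (hF : Monotone F) (hN : ∀ a k, F (a + k * N) = F a + k * N)
    (hNpos : 0 < N) {m w x m' w' y : ℕ} (h : F^[m] x = x + w * N) (h' : F^[m'] y = y + w' * N) :
    m' * w ≤ m * w' := by
  by_contra hlt
  have key : ∀ k, x + (m' * k) * w * N ≤ y + (m * k) * w' * N + x * N := by
    intro k
    have h1 : F^[m * (m' * k)] x ≤ F^[m * (m' * k)] (y + x * N) :=
      hF.iterate _ (by nlinarith)
    rw [iterate_add_mul hN, iterate_mul_eq hN h] at h1
    have h2 : m * (m' * k) = m' * (m * k) := by ring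
    rwa [h2, iterate_mul_eq hN h'] at h1
  -- For k larger than the fixed offset y + xN, a surplus of at least kN contradicts the comparison.
  have h1 := key (y + x * N + 1)
  have h2 : m * w' + 1 ≤ m' * w := by omega
  have h3 : (m * w' + 1) * ((y + x * N + 1) * N) ≤ m' * w * ((y + x * N + 1) * N) :=
    Nat.mul_le_mul_right _ h2
  nlinarith [Nat.zero_le (y + x * N)]

/-- Up to translation by vN the map F^p is monotone, and x is periodic for it. A periodic point of a
monotone map is fixed: a strict inequality at the first return would persist in all later ones. -/
theorem iterate_eq_of_iterate_mul_eq (hF : Monotone F)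
    (hN : ∀ a k, F (a + k * N) = F a + k * N) {p v x d : ℕ} (hd : 0 < d)
    (h : F^[p * d] x = x + d * v * N) : F^[p] x = x + v * N := by
  obtain ⟨d, rfl⟩ : ∃ e, d = e + 1 := ⟨d - 1, by omega⟩
  have hstep : ∀ j, F^[p * (j + 1 + 1)] x = F^[p] (F^[p * (j + 1)] x) := fun j => by
    rw [← Function.iterate_add_apply]
    congr 1
    ring
  rcases lt_trichotomy (F^[p] x) (x + v * N) with hlt | heq | hgt
  · have key : ∀ j, F^[p * (j + 1)] x < x + (j + 1) * v * N := by
      intro j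
      induction j with
      | zero => simpa using hlt
      | succ j ih =>
        rw [hstep]
        have h1 := hF.iterate p ih.le
        rw [iterate_add_mul hN] at h1
        nlinarith
    exact absurd h (key d).ne
  · exact heq
  · have key : ∀ j, x + (j + 1) * v * N < F^[p * (j + 1)] x := by
      intro j
      induction j with
      | zero => simpa using hgt
      | succ j ih =>
        rw [hstep]
        have h1 := hF.iterate p ih.le
        rw [iterate_add_mul hN] at h1
        nlinarith
    exact absurd h (key d).ne'

/-- With d = gcd(m, w) > 1 the orbit would already close up after m/d steps. -/
theorem coprime_of_minimal (hF : Monotone F) (hN : ∀ a k, F (a + k * N) = F a + k * N)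
    {m w x : ℕ} (hm : 0 < m) (h : F^[m] x = x + w * N)
    (hmin : ∀ p, 0 < p → p < m → ∀ v, F^[p] x ≠ x + v * N) : Nat.Coprime m w := by
  by_contra hc
  have hd0 : 0 < Nat.gcd m w := Nat.gcd_pos_of_pos_left _ hm
  have hd1 : 1 < Nat.gcd m w := by
    have : Nat.gcd m w ≠ 1 := hc
    omega
  obtain ⟨p, hp⟩ := Nat.gcd_dvd_left m w
  obtain ⟨v, hv⟩ := Nat.gcd_dvd_right m w
  have hp0 : 0 < p := Nat.pos_of_ne_zero (by rintro rfl; omega)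
  refine hmin p hp0 (by nlinarith) v (iterate_eq_of_iterate_mul_eq hF hN hd0 ?_)
  rw [mul_comm p, ← hp, ← hv, h]

/-- All minimal cycles of a monotone circle map have the same winding number. -/
theorem winding_eq (hF : Monotone F) (hN : ∀ a k, F (a + k * N) = F a + k * N)
    (hNpos : 0 < N) {m w x m' w' y : ℕ} (hm : 0 < m) (hm' : 0 < m')
    (h : F^[m] x = x + w * N) (h' : F^[m'] y = y + w' * N)
    (hmin : ∀ p, 0 < p → p < m → ∀ v, F^[p] x ≠ x + v * N)
    (hmin' : ∀ p, 0 < p → p < m' → ∀ v, F^[p] y ≠ y + v * N) : w = w' := by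
  have hc := coprime_of_minimal hF hN hm h hmin
  have hc' := coprime_of_minimal hF hN hm' h' hmin'
  -- The fractions w/m and w'/m' are equal and in lowest terms, so numerators and denominators
  -- agree.
  have he : m' * w = m * w' := le_antisymm (mul_le_mul_of_periodic hF hN hNpos h h')
    (mul_le_mul_of_periodic hF hN hNpos h' h)
  have h1 : m ∣ m' := hc.dvd_of_dvd_mul_right ⟨w', he⟩
  have h2 : m' ∣ m := hc'.dvd_of_dvd_mul_right ⟨w, he.symm⟩
  have h3 := Nat.dvd_antisymm h1 h2
  subst h3
  exact Nat.eq_of_mul_eq_mul_left hm he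

end RotationNumber

/-! ### The weight of the resolution quiver -/

section Weight

variable (K : Type u) [Field K] {n : ℕ}

/-- The map of vertices underlying the resolution quiver. -/
noncomputable def Relations.succ (Y : Relations n) (i : Fin n) : Fin n := next^[Y.kupisch i] i

theorem resolutionQuiver_adj_iff_succ (Y : Relations n) (i j : Fin n) :
    (resolutionQuiver K Y).Adj i j ↔ Y.succ i = j :=
  resolutionQuiver_adj_iff K Y i j

/-- The vertex `x` starts a minimal cycle with `m` elements and weight `w` of the resolution
quiver. -/
def Relations.IsCycleData [NeZero n] (Y : Relations n) (m w x : ℕ) : Prop :=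
  0 < m ∧ Y.step^[m] x = x + w * n ∧ ∀ p, 0 < p → p < m → ∀ v, Y.step^[p] x ≠ x + v * n

variable [NeZero n]

theorem Relations.succ_iterate_ofNat (Y : Relations n) (a k : ℕ) :
    Y.succ^[k] (Fin.ofNat n a) = Fin.ofNat n (Y.step^[k] a) := by
  induction k with
  | zero => rfl
  | succ k ih =>
    rw [Function.iterate_succ_apply', ih, Function.iterate_succ_apply']
    exact Y.next_iterate_kupisch _

theorem Relations.le_step_iterate (Y : Relations n) (a k : ℕ) : a ≤ Y.step^[k] a := by
  induction k with
  | zero => exact le_rfl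
  | succ k ih =>
    rw [Function.iterate_succ_apply']
    exact ih.trans (Y.lt_step _).le

/-- Each application of `step` adds the length of the current projective, so the lengths along an
orbit telescope to its displacement. -/
theorem sum_projLength_iterate (Y : Relations n) (a k : ℕ) :
    a + ((List.iterate Y.succ (Fin.ofNat n a) k).map (projLength K Y)).sum = Y.step^[k] a := by
  induction k generalizing a with
  | zero => rfl
  | succ k ih =>
    rw [List.iterate, List.map_cons, List.sum_cons, Function.iterate_succ_apply, ← ih,
      ← Relations.next_iterate_kupisch, projLength_eq, Relations.step]
    simp only [Relations.succ]
    omega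

/-- A cycle closes up modulo n, so its displacement is vn, and v is its weight. By `winding_eq`, v
agrees with the w of the given orbit. -/
theorem hasWeight_of_isCycleData (Y : Relations n) {m w x : ℕ} (h : Y.IsCycleData m w x) :
    HasWeight K Y w := by
  have hG := resolutionQuiver_adj_iff_succ K Y
  refine ⟨exists_isOrientedCycle_of_component hG, fun c hc => ?_⟩
  obtain ⟨a, hpos, hca, hper, hmin⟩ := hc.eq_iterate hG
  rw [← ofNat_val a, Relations.succ_iterate_ofNat, ofNat_eq_iff] at hper
  have hle := Y.le_step_iterate a.val c.length
  obtain ⟨v, hv⟩ := (Nat.modEq_iff_dvd' hle).1 hper.symm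
  have hv' : Y.step^[c.length] a.val = a.val + v * n := by
    rw [mul_comm, ← hv]; omega
  have hw : v = w := winding_eq Y.step_monotone Y.step_add_mul (NeZero.pos n) hpos h.1 hv' h.2.1
    (fun p hp hpm u hu => hmin p hp hpm (by
      rw [← ofNat_val a, Relations.succ_iterate_ofNat, ofNat_eq_iff, hu,
        Nat.add_mul_mod_self_right])) h.2.2
  have hs := sum_projLength_iterate K Y a.val c.length
  rw [ofNat_val, ← hca, hv'] at hs
  have hs' : (c.map (projLength K Y)).sum = w * n := by rw [← hw]; omega
  have hn : (n : ℚ) ≠ 0 := Nat.cast_ne_zero.2 (NeZero.ne n)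
  rw [cycleWeight, hs', Nat.cast_mul, mul_div_cancel_right₀ _ hn]

theorem exists_isCycleData (Y : Relations n) : ∃ m w x, Y.IsCycleData m w x := by
  obtain ⟨k, hk⟩ := exists_iterate_mem_periodicPts (f := Y.succ) (0 : Fin n)
  set a := Y.succ^[k] 0
  have hpos := Function.minimalPeriod_pos_of_mem_periodicPts hk
  have hper : Y.succ^[Function.minimalPeriod Y.succ a] a = a :=
    Function.isPeriodicPt_minimalPeriod Y.succ a
  set m := Function.minimalPeriod Y.succ a with hm
  rw [← ofNat_val a, Relations.succ_iterate_ofNat, ofNat_eq_iff] at hper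
  have hle := Y.le_step_iterate a.val m
  obtain ⟨v, hv⟩ := (Nat.modEq_iff_dvd' hle).1 hper.symm
  refine ⟨m, v, a.val, hpos, by rw [mul_comm, ← hv]; omega, fun p hp hpm u hu => ?_⟩
  refine Function.not_isPeriodicPt_of_pos_of_lt_minimalPeriod (f := Y.succ) (x := a) hp.ne' hpm ?_
  change Y.succ^[p] a = a
  rw [← ofNat_val a, Relations.succ_iterate_ofNat, ofNat_eq_iff, hu, Nat.add_mul_mod_self_right]

end Weight

/-! ### The resolution quiver of the deletion -/

section DeletionQuiver

theorem succ_ne_last {n : ℕ} {Y : Relations (n + 1)} (hY : ∀ a, Y.step a % (n + 1) ≠ n) (i : Fin (n + 1)) :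
    Y.succ i ≠ Fin.last n := by
  intro h
  refine hY i.val ?_
  have := congrArg Fin.val h
  rwa [Relations.succ, val_next_iterate, ← Y.step_val] at this

variable (K : Type u) [Field K] {n : ℕ} [NeZero n] {Y : Relations (n + 1)} {Y' : Relations n}

theorem IsDeletion.succ_castSucc (h : IsDeletion Y Y'.kupisch) (i : Fin n) :
    (Y'.succ i).castSucc = Y.succ i.castSucc := by
  refine Fin.ext ?_
  rw [Relations.succ, Relations.succ, Fin.val_castSucc, val_next_iterate, val_next_iterate,
    ← skip_mod, h i, Fin.val_castSucc]

theorem IsDeletion.resolutionQuiver_adj_iff (h : IsDeletion Y Y'.kupisch) (i j : Fin n) :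
    (resolutionQuiver K Y').Adj i j ↔ (resolutionQuiver K Y).Adj i.castSucc j.castSucc := by
  rw [resolutionQuiver_adj_iff_succ, resolutionQuiver_adj_iff_succ, ← h.succ_castSucc]
  exact (Fin.castSucc_injective n).eq_iff.symm

theorem IsDeletion.skip_step_iterate (h : IsDeletion Y Y'.kupisch) (a k : ℕ) :
    skip n (Y'.step^[k] a) = Y.step^[k] (skip n a) := by
  induction k with
  | zero => rfl
  | succ k ih => rw [Function.iterate_succ_apply', Function.iterate_succ_apply', h.step, ih]

/-- `skip` turns a shift by wn into a shift by w(n + 1), so the number of turns is kept; injectivity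
of `skip` keeps minimality. -/
theorem IsDeletion.isCycleData (h : IsDeletion Y Y'.kupisch) {m w x : ℕ}
    (hx : Y'.IsCycleData m w x) : Y.IsCycleData m w (skip n x) := by
  refine ⟨hx.1, ?_, fun p hp hpm v hv => hx.2.2 p hp hpm v ?_⟩
  · rw [← h.skip_step_iterate, hx.2.1, skip_add_mul]
  · rw [← h.skip_step_iterate, ← skip_add_mul] at hv
    exact skip_strictMono.injective hv

theorem IsDeletion.exists_hasWeight (h : IsDeletion Y Y'.kupisch) :
    ∃ w : ℚ, HasWeight K Y w ∧ HasWeight K Y' w := by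
  obtain ⟨m, w, x, hx⟩ := exists_isCycleData Y'
  exact ⟨w, hasWeight_of_isCycleData K Y (h.isCycleData hx), hasWeight_of_isCycleData K Y' hx⟩

end DeletionQuiver

end Nakayama
namespace Nakayama

/-! ### Contiguous maps and homotopy equivalences -/

section Realization

variable {ι κ : Type*} [Fintype ι] {L : AbstractSimplicialComplex ι}
  {L' : AbstractSimplicialComplex κ}

theorem support_nonempty_of_mem_stdSimplex {t : ι → ℝ} (ht : t ∈ stdSimplex ℝ ι) :
    ∃ i, t i ≠ 0 := by
  by_contra h
  push Not at h
  have := ht.2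
  simp [h] at this

/-- Points of `Realization` have a face as exact support; as faces are closed under nonempty
subsets, an upper bound for the support suffices. -/
theorem exists_face_of_subset {t : ι → ℝ} (ht : t ∈ stdSimplex ℝ ι) {s : Finset ι}
    (hs : s ∈ L.faces) (h : ∀ i, t i ≠ 0 → i ∈ s) :
    ∃ s ∈ L.faces, ∀ v, v ∈ s ↔ t v ≠ 0 := by
  classical
  refine ⟨s.filter fun i => t i ≠ 0, ?_, fun v => ?_⟩
  · refine (L.isRelLowerSet_faces hs).2 (Finset.filter_subset _ _) ?_
    obtain ⟨i, hi⟩ := support_nonempty_of_mem_stdSimplex ht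
    exact ⟨i, Finset.mem_filter.2 ⟨h i hi, hi⟩⟩
  · rw [Finset.mem_filter]
    exact ⟨fun h => h.2, fun hv => ⟨h v hv, hv⟩⟩

open Classical in
/-- The push-forward of barycentric coordinates along a map of vertices. -/
noncomputable def pushCoord (g : ι → κ) (t : ι → ℝ) (k : κ) : ℝ :=
  ∑ i, if g i = k then t i else 0

theorem exists_of_pushCoord_ne_zero {g : ι → κ} {t : ι → ℝ} {k : κ} (h : pushCoord g t k ≠ 0) :
    ∃ i, g i = k ∧ t i ≠ 0 := by
  classical
  obtain ⟨i, -, hi⟩ := Finset.exists_ne_zero_of_sum_ne_zero h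
  exact ⟨i, by by_contra hne; simp [hne] at hi, fun h0 => by simp [h0] at hi⟩

theorem continuous_pushCoord (g : ι → κ) : Continuous (pushCoord g) := by
  classical
  refine continuous_pi fun k => continuous_finsetSum _ fun i _ => ?_
  split_ifs
  · exact continuous_apply i
  · exact continuous_const

variable [Fintype κ]

theorem pushCoord_mem_stdSimplex (g : ι → κ) {t : ι → ℝ} (ht : t ∈ stdSimplex ℝ ι) :
    pushCoord g t ∈ stdSimplex ℝ κ := by
  classical
  refine ⟨fun k => Finset.sum_nonneg fun i _ => ?_, ?_⟩
  · split_ifs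
    · exact ht.1 i
    · exact le_rfl
  · simp only [pushCoord]
    rw [Finset.sum_comm, ← ht.2]
    exact Finset.sum_congr rfl fun i _ => by simp

/-- The map of realizations induced by a simplicial map. -/
noncomputable def realizationMap [DecidableEq κ] (g : ι → κ) (hg : ∀ s ∈ L.faces, s.image g ∈ L'.faces) :
    C(Realization L, Realization L') where
  toFun x := ⟨pushCoord g x.1, pushCoord_mem_stdSimplex g x.2.1, by
    obtain ⟨s, hs, hx⟩ := x.2.2
    refine exists_face_of_subset (pushCoord_mem_stdSimplex g x.2.1) (hg s hs) fun k hk => ?_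
    obtain ⟨i, rfl, hi⟩ := exists_of_pushCoord_ne_zero hk
    exact Finset.mem_image_of_mem _ ((hx i).2 hi)⟩
  continuous_toFun := ((continuous_pushCoord g).comp continuous_subtype_val).subtype_mk _

/-- Maps into a realization which are contiguous are homotopic. -/
theorem homotopic_of_contiguous {X : Type*} [TopologicalSpace X] (φ ψ : C(X, Realization L))
    (h : ∀ x, ∃ s ∈ L.faces, (∀ i, (φ x).1 i ≠ 0 → i ∈ s) ∧ ∀ i, (ψ x).1 i ≠ 0 → i ∈ s) :
    φ.Homotopic ψ := by
  have hmem : ∀ p : unitInterval × X,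
      (fun i => (1 - (p.1 : ℝ)) * (φ p.2).1 i + (p.1 : ℝ) * (ψ p.2).1 i) ∈ stdSimplex ℝ ι :=
    fun p => convex_stdSimplex ℝ ι (φ p.2).2.1 (ψ p.2).2.1 (sub_nonneg.2 p.1.2.2) p.1.2.1
      (sub_add_cancel _ _)
  have hφ : ∀ i, Continuous fun p : unitInterval × X => (φ p.2).1 i := fun i =>
    (continuous_apply i).comp (continuous_subtype_val.comp (φ.continuous.comp continuous_snd))
  have hψ : ∀ i, Continuous fun p : unitInterval × X => (ψ p.2).1 i := fun i =>
    (continuous_apply i).comp (continuous_subtype_val.comp (ψ.continuous.comp continuous_snd))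
  -- The straight-line homotopy stays inside the common face.
  refine ⟨⟨⟨fun p => ⟨fun i => (1 - (p.1 : ℝ)) * (φ p.2).1 i + (p.1 : ℝ) * (ψ p.2).1 i,
    hmem p, ?_⟩, ?_⟩, fun x => Subtype.ext (funext fun i => ?_),
    fun x => Subtype.ext (funext fun i => ?_)⟩⟩
  · obtain ⟨s, hs, h1, h2⟩ := h p.2
    refine exists_face_of_subset (hmem p) hs fun i hi => ?_
    by_contra hne
    have h3 : (φ p.2).1 i = 0 := not_not.1 fun h0 => hne (h1 i h0)
    have h4 : (ψ p.2).1 i = 0 := not_not.1 fun h0 => hne (h2 i h0)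
    exact hi (by rw [h3, h4, mul_zero, mul_zero, add_zero])
  · refine Continuous.subtype_mk (continuous_pi fun i => ?_) _
    have h1 : Continuous fun p : unitInterval × X => (p.1 : ℝ) :=
      continuous_subtype_val.comp continuous_fst
    exact ((continuous_const.sub h1).mul (hφ i)).add (h1.mul (hψ i))
  · simp
  · simp

theorem homotopic_id_of_contiguous [DecidableEq ι] [DecidableEq κ] (g : ι → κ) (h : κ → ι)
    (hg : ∀ s ∈ L.faces, s.image g ∈ L'.faces) (hh : ∀ s ∈ L'.faces, s.image h ∈ L.faces)
    (hgh : ∀ s ∈ L.faces, s ∪ (s.image g).image h ∈ L.faces) :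
    ((realizationMap h hh).comp (realizationMap g hg)).Homotopic (ContinuousMap.id _) := by
  refine homotopic_of_contiguous _ _ fun x => ?_
  obtain ⟨s, hs, hx⟩ := x.2.2
  refine ⟨_, hgh s hs, fun i hi => ?_, fun i hi => Finset.mem_union_left _ ((hx i).2 hi)⟩
  obtain ⟨k, rfl, hk⟩ := exists_of_pushCoord_ne_zero hi
  obtain ⟨j, rfl, hj⟩ := exists_of_pushCoord_ne_zero hk
  exact Finset.mem_union_right _ (Finset.mem_image_of_mem _ (Finset.mem_image_of_mem _
    ((hx j).2 hj)))

theorem homotopyEquiv_of_contiguous [DecidableEq ι] [DecidableEq κ] (g : ι → κ) (h : κ → ι)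
    (hg : ∀ s ∈ L.faces, s.image g ∈ L'.faces) (hh : ∀ s ∈ L'.faces, s.image h ∈ L.faces)
    (hgh : ∀ s ∈ L.faces, s ∪ (s.image g).image h ∈ L.faces)
    (hhg : ∀ s ∈ L'.faces, s ∪ (s.image h).image g ∈ L'.faces) :
    Nonempty (ContinuousMap.HomotopyEquiv (Realization L) (Realization L')) :=
  ⟨⟨realizationMap g hg, realizationMap h hh, homotopic_id_of_contiguous g h hg hh hgh,
    homotopic_id_of_contiguous h g hh hg hhg⟩⟩

end Realization

/-! ### Euler characteristic and dominated vertices -/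

section EulerCharacteristic

variable {ι κ : Type*} [Fintype ι] [Fintype κ] {L : AbstractSimplicialComplex ι}
  {L' : AbstractSimplicialComplex κ}

open Classical in
/-- The faces containing a dominated vertex do not contribute to the Euler characteristic. -/
theorem sum_faces_of_dominated {r s : ι} (hrs : s ≠ r)
    (hdom : ∀ σ ∈ L.faces, r ∈ σ → insert s σ ∈ L.faces) :
    ∑ σ : Finset ι with σ ∈ L.faces ∧ r ∈ σ, (-1 : ℤ) ^ (σ.card - 1) = 0 := by
  -- Toggling s pairs faces of opposite sign. Since r stays in the face, no set becomes empty and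
  -- the subtraction in the exponent is never truncated.
  refine Finset.sum_involution (fun σ _ => if s ∈ σ then σ.erase s else insert s σ)
    ?_ ?_ ?_ ?_
  · intro σ hσ
    rw [Finset.mem_filter] at hσ
    have hpos : 0 < σ.card := Finset.card_pos.2 ⟨r, hσ.2.2⟩
    obtain ⟨m, hm⟩ : ∃ m, σ.card = m + 1 := ⟨σ.card - 1, by omega⟩
    split_ifs with h
    · have hpos' : 0 < (σ.erase s).card :=
        Finset.card_pos.2 ⟨r, Finset.mem_erase.2 ⟨hrs.symm, hσ.2.2⟩⟩
      rw [Finset.card_erase_of_mem h, hm] at hpos' ⊢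
      obtain ⟨k, rfl⟩ : ∃ k, m = k + 1 := ⟨m - 1, by omega⟩
      simp [pow_succ]
    · rw [Finset.card_insert_of_notMem h, hm]
      simp [pow_succ]
  · intro σ hσ _
    split_ifs with h
    · exact fun he => (Finset.erase_eq_self.1 he) h
    · exact fun he => h (Finset.insert_eq_self.1 he)
  · intro σ hσ
    rw [Finset.mem_filter] at hσ ⊢
    refine ⟨Finset.mem_univ _, ?_⟩
    split_ifs with h
    · have hr : r ∈ σ.erase s := Finset.mem_erase.2 ⟨hrs.symm, hσ.2.2⟩
      exact ⟨(L.isRelLowerSet_faces hσ.2.1).2 (Finset.erase_subset _ _) ⟨r, hr⟩, hr⟩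
    · exact ⟨hdom σ hσ.2.1 hσ.2.2, Finset.mem_insert_of_mem hσ.2.2⟩
  · intro σ hσ
    split_ifs with h h1 h2
    · exact absurd h1 (Finset.notMem_erase _ _)
    · exact Finset.insert_erase h
    · exact Finset.erase_insert h
    · exact absurd (Finset.mem_insert_self _ _) h2

open Classical in
theorem sum_faces_range (h : κ ↪ ι) (hface : ∀ s, s ∈ L'.faces ↔ s.map h ∈ L.faces) :
    ∑ σ : Finset ι with σ ∈ L.faces ∧ ∀ v ∈ σ, v ∈ Set.range h, (-1 : ℤ) ^ (σ.card - 1) =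
      eulerChar L' := by
  rw [eulerChar]
  symm
  refine Finset.sum_bij (fun s _ => s.map h) ?_ ?_ ?_ ?_
  · intro s hs
    rw [Finset.mem_filter] at hs ⊢
    refine ⟨Finset.mem_univ _, (hface s).1 hs.2, fun v hv => ?_⟩
    obtain ⟨k, -, rfl⟩ := Finset.mem_map.1 hv
    exact ⟨k, rfl⟩
  · intro s _ t _ hst
    exact Finset.map_injective h hst
  · intro σ hσ
    rw [Finset.mem_filter] at hσ
    have he : (Finset.univ.filter fun k => h k ∈ σ).map h = σ := by
      ext v
      simp only [Finset.mem_map, Finset.mem_filter, Finset.mem_univ, true_and]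
      constructor
      · rintro ⟨k, hk, rfl⟩
        exact hk
      · intro hv
        obtain ⟨k, rfl⟩ := hσ.2.2 v hv
        exact ⟨k, hv, rfl⟩
    refine ⟨Finset.univ.filter fun k => h k ∈ σ, ?_, he⟩
    rw [Finset.mem_filter, hface, he]
    exact ⟨Finset.mem_univ _, hσ.2.1⟩
  · intro s _
    rw [Finset.card_map]

/-- At most one vertex lies outside the image of h. The faces avoiding it are those of L', and the
faces containing it cancel because it is dominated. -/
theorem eulerChar_eq_of_dominated (h : κ ↪ ι) (hface : ∀ s, s ∈ L'.faces ↔ s.map h ∈ L.faces)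
    (huniq : ∀ v ∉ Set.range h, ∀ v' ∉ Set.range h, v = v')
    (hdom : ∀ v ∉ Set.range h, ∃ s, s ≠ v ∧ ∀ σ ∈ L.faces, v ∈ σ → ∃ τ ∈ L.faces, σ ⊆ τ ∧ s ∈ τ) :
    eulerChar L' = eulerChar L := by
  classical
  rw [← sum_faces_range h hface, eulerChar]
  by_cases hs : ∃ r, r ∉ Set.range h
  · obtain ⟨r, hr⟩ := hs
    obtain ⟨s, hsr, hd⟩ := hdom r hr
    have h0 := sum_faces_of_dominated (L := L) hsr (fun σ hσ hrσ => by
      obtain ⟨τ, hτ, h1, h2⟩ := hd σ hσ hrσ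
      exact (L.isRelLowerSet_faces hτ).2 (Finset.insert_subset h2 h1) (Finset.insert_nonempty _ _))
    rw [← add_zero (∑ σ : Finset ι with _, _), ← h0, ← Finset.sum_union]
    · refine Finset.sum_congr ?_ fun _ _ => rfl
      ext σ
      simp only [Finset.mem_union, Finset.mem_filter, Finset.mem_univ, true_and]
      constructor
      · rintro (h1 | h1)
        · exact h1.1
        · exact h1.1
      · intro h1
        by_cases h2 : r ∈ σ
        · exact Or.inr ⟨h1, h2⟩
        · refine Or.inl ⟨h1, fun v hv => ?_⟩
          by_contra h3
          exact h2 (huniq v h3 r hr ▸ hv)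
    · rw [Finset.disjoint_filter]
      rintro σ - h1 h2
      exact hr (h1.2 r h2.2)
  · push Not at hs
    refine Finset.sum_congr ?_ fun _ _ => rfl
    ext σ
    simp [hs]

end EulerCharacteristic

/-! ### The relation complex of the deletion -/

section DeletionComplex

variable {n : ℕ}

theorem Relations.mem_rels_iff_step [NeZero n] (Y : Relations n) (p : CPath n) :
    p ∈ Y.rels ↔ p.start.val + p.len = Y.step p.start.val ∧
      Y.step p.start.val < Y.step (p.start.val + 1) := by
  have h1 := Y.step_val p.start
  have h2 : Y.step (p.start.val + 1) = p.start.val + 1 + Y.kupisch (next p.start) := by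
    rw [step, ← next_ofNat, ofNat_val]
  rw [Y.mem_rels_iff, h1, h2]
  omega

theorem covers_iff_exists_nat [NeZero n] (p : CPath n) (j : Fin n) :
    p.Covers j ↔ ∃ a, p.start.val < a ∧ a < p.start.val + p.len ∧ Fin.ofNat n a = j := by
  rw [CPath.covers_iff]
  constructor
  · rintro ⟨t, h1, h2, rfl⟩
    refine ⟨p.start.val + t, by omega, by omega, ?_⟩
    rw [← next_iterate_ofNat, ofNat_val]
  · rintro ⟨a, h1, h2, rfl⟩
    refine ⟨a - p.start.val, by omega, by omega, ?_⟩
    rw [← Nat.add_sub_cancel' h1.le, ← next_iterate_ofNat, ofNat_val, Nat.add_sub_cancel_left]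

theorem covers_castSucc_iff [NeZero n] (p : CPath (n + 1)) (j : Fin n) :
    p.Covers j.castSucc ↔ ∃ a, p.start.val < skip n a ∧ skip n a < p.start.val + p.len ∧
      Fin.ofNat n a = j := by
  rw [covers_iff_exists_nat]
  constructor
  · rintro ⟨b, h1, h2, h3⟩
    have h4 : b % (n + 1) ≠ n := by
      have h5 : b % (n + 1) = j.val := congrArg Fin.val h3
      have := j.isLt
      omega
    obtain ⟨a, rfl⟩ := exists_skip_eq h4
    rw [ofNat_skip] at h3
    exact ⟨a, h1, h2, Fin.castSucc_injective _ h3⟩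
  · rintro ⟨a, h1, h2, rfl⟩
    exact ⟨skip n a, h1, h2, ofNat_skip a⟩

variable [NeZero n] {Y : Relations (n + 1)} {Y' : Relations n}

/-- A relation never ends at the leaf, because its end is a value of `step`. So a relation covering
the predecessor of the leaf also covers the leaf, and a set that misses the leaf misses its
predecessor. -/
theorem mem_faces_iff_castSucc (hY : ∀ a, Y.step a % (n + 1) ≠ n)
    (s : Finset (ComplexVertex Y)) :
    s ∈ (relationComplex Y).faces ↔
      s.Nonempty ∧ ∃ j : Fin n, ∀ y ∈ s, ¬ y.val.Covers j.castSucc := by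
  refine and_congr_right fun _ => ⟨?_, fun ⟨j, hj⟩ => ⟨j.castSucc, hj⟩⟩
  rintro ⟨i, hi⟩
  induction i using Fin.lastCases with
  | cast j => exact ⟨j, hi⟩
  | last =>
    have hn := NeZero.pos n
    refine ⟨⟨n - 1, by omega⟩, fun y hy hc => hi y hy ?_⟩
    rw [covers_iff_exists_nat] at hc ⊢
    obtain ⟨a, h1, h2, h3⟩ := hc
    have h4 : (a + 1) % (n + 1) = n := by
      have h5 : a % (n + 1) = n - 1 := congrArg Fin.val h3
      rw [Nat.add_mod, h5]
      rcases Nat.lt_or_ge 1 (n + 1) with h6 | h6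
      · rw [Nat.mod_eq_of_lt h6, Nat.sub_add_cancel hn, Nat.mod_eq_of_lt (Nat.lt_succ_self n)]
      · omega
    refine ⟨a + 1, by omega, ?_, Fin.ext h4⟩
    have h5 := ((Y.mem_rels_iff_step y.1).1 y.2.1).1
    have h6 : a + 1 ≠ Y.step y.1.start.val := fun h => hY y.1.start.val (h ▸ h4)
    omega

theorem skip_pred_n : skip n (n - 1) = n - 1 := skip_of_lt (by have := NeZero.pos n; omega)

theorem skip_self : skip n n = n + 1 := by
  rw [skip, Nat.div_self (NeZero.pos n)]

/-- A jump of `step` at i < n gives a jump of the deletion at i, and a jump at the leaf gives one at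
n - 1, since `skip` passes from n - 1 directly to n + 1. The new relation covers no further
vertices, as required for a simplicial map. -/
theorem IsDeletion.exists_vertex_of_vertex (hY : ∀ a, Y.step a % (n + 1) ≠ n)
    (h : IsDeletion Y Y'.kupisch) (v : ComplexVertex Y) :
    ∃ v' : ComplexVertex Y', (v.1.start = v'.1.start.castSucc ∨
      (v.1.start = Fin.last n ∧ v'.1.start.val + 1 = n)) ∧
      ∀ j, v'.1.Covers j → v.1.Covers j.castSucc := by
  obtain ⟨⟨i, l⟩, hv, hl⟩ := v
  have hn := NeZero.pos n
  obtain ⟨hv1, hv2⟩ := (Y.mem_rels_iff_step _).1 hv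
  simp only at hv1 hv2 hl
  induction i using Fin.lastCases with
  | cast i =>
    rw [Fin.val_castSucc] at hv1 hv2
    have h1 := h.step i.val
    have h2 := h.step (i.val + 1)
    have h3 : i.val + 1 ≤ skip n (i.val + 1) := skip_strictMono.le_apply
    rw [skip_of_lt i.isLt] at h1
    have h4 := Y'.lt_step i.val
    refine ⟨⟨⟨i, Y'.step i.val - i.val⟩, (Y'.mem_rels_iff_step _).2 ⟨by simp only; omega, ?_⟩, ?_⟩,
      Or.inl rfl, fun j hj => ?_⟩
    · rw [← skip_strictMono.lt_iff_lt (a := Y'.step _) (b := Y'.step _), h1, h2]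
      exact hv2.trans_le (Y.step_monotone h3)
    · have h5 : Y'.step i.val ≤ i.val + n := by
        rw [← skip_strictMono.le_iff_le (a := Y'.step _), h1, skip_add, skip_of_lt i.isLt]
        omega
      simp only
      omega
    · rw [covers_iff_exists_nat] at hj
      obtain ⟨a, h5, h6, h7⟩ := hj
      simp only at h5 h6
      rw [covers_castSucc_iff]
      have h8 : skip n i.val < skip n a := skip_strictMono h5
      have h9 : skip n a < skip n (Y'.step i.val) := skip_strictMono (by omega)
      rw [skip_of_lt i.isLt] at h8
      refine ⟨a, h8, ?_, h7⟩
      simp only [Fin.val_castSucc]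
      omega
  | last =>
    simp only [Fin.val_last] at hv1 hv2
    have h1 := h.step (n - 1)
    have h2 := h.step n
    rw [skip_pred_n] at h1
    rw [skip_self] at h2
    have h3 : Y.step (n - 1) ≤ Y.step n := Y.step_monotone (by omega)
    have h4 := Y'.lt_step (n - 1)
    refine ⟨⟨⟨⟨n - 1, by omega⟩, Y'.step (n - 1) - (n - 1)⟩,
      (Y'.mem_rels_iff_step _).2 ⟨by simp only; omega, ?_⟩, ?_⟩,
      Or.inr ⟨rfl, by simp only; omega⟩, fun j hj => ?_⟩
    · simp only
      rw [Nat.sub_add_cancel hn, ← skip_strictMono.lt_iff_lt (a := Y'.step _) (b := Y'.step _),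
        h1, h2]
      omega
    -- A relation of length n + 1 at the leaf would end at the leaf. Hence F(n - 1) ≤ F(n) ≤ 2n,
    -- which is the `skip` of n - 1 + n, and the new relation has length at most n.
    · have h5 : Y.step n ≠ n + (n + 1) := fun h => hY n (by
        rw [h, Nat.add_mod_right, Nat.mod_eq_of_lt (Nat.lt_succ_self n)])
      have h6 : Y'.step (n - 1) ≤ n - 1 + n := by
        rw [← skip_strictMono.le_iff_le (a := Y'.step _), h1, skip_add, skip_pred_n]
        omega
      simp only
      omega
    · rw [covers_iff_exists_nat] at hj
      obtain ⟨a, h5, h6, h7⟩ := hj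
      simp only at h5 h6
      rw [covers_castSucc_iff]
      have h8 : skip n n ≤ skip n a := skip_strictMono.monotone (by omega)
      have h9 : skip n a < skip n (Y'.step (n - 1)) := skip_strictMono (by omega)
      rw [skip_self] at h8
      refine ⟨a, ?_, ?_, h7⟩
      · simp only [Fin.val_last]
        omega
      · simp only [Fin.val_last]
        omega

/-- A jump of the deletion at i is a jump of `step` between i and `skip n (i + 1)`. It occurs at i,
or else i = n - 1 and it occurs at the leaf. The leaf is chosen only if no relation starts at i, so
any vertex missed by this choice starts at the leaf. -/
theorem IsDeletion.exists_vertex_of_vertex' (h : IsDeletion Y Y'.kupisch) (v' : ComplexVertex Y') :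
    ∃ v : ComplexVertex Y, (v.1.start = v'.1.start.castSucc ∨
      (v.1.start = Fin.last n ∧ v'.1.start.val + 1 = n ∧
        ∀ u : ComplexVertex Y, u.1.start ≠ v'.1.start.castSucc)) ∧
      ∀ j, v.1.Covers j.castSucc ↔ v'.1.Covers j := by
  obtain ⟨⟨i, l⟩, hv, hl⟩ := v'
  have hn := NeZero.pos n
  obtain ⟨hv1, hv2⟩ := (Y'.mem_rels_iff_step _).1 hv
  simp only at hv1 hv2 hl ⊢
  have h1 := h.step i.val
  have h2 := h.step (i.val + 1)
  rw [skip_of_lt i.isLt] at h1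
  rw [← skip_strictMono.lt_iff_lt (a := Y'.step _) (b := Y'.step _), h1, h2] at hv2
  have h3 : skip n (Y'.step i.val) ≤ skip n (i.val + n) := skip_strictMono.monotone (by omega)
  rw [h1, skip_add, skip_of_lt i.isLt] at h3
  have h4 := Y.lt_step i.val
  have hcov : ∀ j : Fin n, (⟨i, l⟩ : CPath n).Covers j ↔
      ∃ a, i.val < a ∧ skip n a < Y.step i.val ∧ Fin.ofNat n a = j := by
    intro j
    rw [covers_iff_exists_nat]
    refine exists_congr fun a => and_congr_right fun _ => and_congr_left fun _ => ?_
    rw [hv1, ← h1, skip_strictMono.lt_iff_lt]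
  by_cases hlt : Y.step i.val < Y.step (i.val + 1)
  · refine ⟨⟨⟨i.castSucc, Y.step i.val - i.val⟩,
      (Y.mem_rels_iff_step _).2 ⟨by simp only [Fin.val_castSucc]; omega, hlt⟩,
      by simp only; omega⟩, Or.inl rfl, fun j => ?_⟩
    rw [hcov, covers_castSucc_iff]
    refine exists_congr fun a => ?_
    have h5 : i.val < skip n a ↔ i.val < a := by
      conv_lhs => rw [← skip_of_lt i.isLt, skip_strictMono.lt_iff_lt]
    simp only [Fin.val_castSucc]
    rw [h5, Nat.add_sub_cancel' h4.le]
  · have hin : i.val + 1 = n := by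
      by_contra hne
      have := i.isLt
      rw [skip_of_lt (by omega)] at hv2
      exact hlt hv2
    have heq : Y.step i.val = Y.step n := by
      rw [hin] at hlt
      exact le_antisymm (Y.step_monotone i.isLt.le) (not_lt.1 hlt)
    rw [hin, skip_self, heq] at hv2
    refine ⟨⟨⟨Fin.last n, Y.step n - n⟩,
      (Y.mem_rels_iff_step _).2 ⟨?_, by simpa using hv2⟩, ?_⟩,
      Or.inr ⟨rfl, hin, fun u hu => ?_⟩, fun j => ?_⟩
    · have := Y.lt_step n
      simp only [Fin.val_last]
      omega
    · simp only
      omega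
    · have := ((Y.mem_rels_iff_step _).1 u.2.1).2
      rw [hu] at this
      exact hlt this
    · rw [hcov, covers_castSucc_iff]
      refine exists_congr fun a => ?_
      have h5 : n < skip n a ↔ i.val < a := by
        rw [← Nat.succ_le_iff, Nat.succ_eq_add_one, ← skip_self, skip_strictMono.le_iff_le]
        omega
      simp only [Fin.val_last]
      rw [h5, Nat.add_sub_cancel' (Y.lt_step n).le, heq]

/-- Starting vertices show that g ∘ h is the identity. The relation h (g v) covers no remaining
vertex that v does not cover, so adding it to a face containing v gives a face. Thus h ∘ g is
contiguous to the identity, and a vertex v outside the image of h is dominated by h (g v). -/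
theorem IsDeletion.relationComplex_equiv (hY : ∀ a, Y.step a % (n + 1) ≠ n)
    (hd : IsDeletion Y Y'.kupisch) :
    Nonempty (ContinuousMap.HomotopyEquiv (Realization (relationComplex Y'))
      (Realization (relationComplex Y))) ∧
    eulerChar (relationComplex Y') = eulerChar (relationComplex Y) := by
  classical
  choose g hg1 hg2 using hd.exists_vertex_of_vertex hY
  choose h hh1 hh2 using hd.exists_vertex_of_vertex'
  have hgh : ∀ v', g (h v') = v' := by
    intro v'
    refine Subtype.ext (start_injOn Y' (g (h v')).2.1 v'.2.1 ?_)
    rcases hh1 v' with h1 | ⟨h1, h2, -⟩ <;> rcases hg1 (h v') with h3 | ⟨h3, h4⟩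
    · exact Fin.castSucc_injective _ (h3.symm.trans h1)
    · exact absurd (h1.symm.trans h3) (Fin.castSucc_lt_last _).ne
    · exact absurd (h3.symm.trans h1) (Fin.castSucc_lt_last _).ne
    · exact Fin.ext (by omega)
  have hinj : Function.Injective h := Function.LeftInverse.injective hgh
  have hstart : ∀ v, v ∉ Set.range h → v.1.start = Fin.last n := by
    intro v hv
    rcases hg1 v with h1 | ⟨h1, -⟩
    · rcases hh1 (g v) with h2 | ⟨-, -, h2⟩
      · exact absurd ⟨g v, Subtype.ext (start_injOn Y (h (g v)).2.1 v.2.1 (h2.trans h1.symm))⟩ hv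
      · exact absurd h1 (h2 v)
    · exact h1
  have hg : ∀ s ∈ (relationComplex Y).faces, s.image g ∈ (relationComplex Y').faces := by
    intro s hs
    obtain ⟨hne, j, hj⟩ := (mem_faces_iff_castSucc hY s).1 hs
    refine ⟨hne.image g, j, fun y hy hc => ?_⟩
    obtain ⟨v, hv, rfl⟩ := Finset.mem_image.1 hy
    exact hj v hv (hg2 v j hc)
  have hh : ∀ s ∈ (relationComplex Y').faces, s.image h ∈ (relationComplex Y).faces := by
    rintro s ⟨hne, j, hj⟩
    refine ⟨hne.image h, j.castSucc, fun y hy hc => ?_⟩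
    obtain ⟨v, hv, rfl⟩ := Finset.mem_image.1 hy
    exact hj v hv ((hh2 v j).1 hc)
  have hcon : ∀ s ∈ (relationComplex Y).faces,
      s ∪ (s.image g).image h ∈ (relationComplex Y).faces := by
    intro s hs
    obtain ⟨hne, j, hj⟩ := (mem_faces_iff_castSucc hY s).1 hs
    refine ⟨hne.mono Finset.subset_union_left, j.castSucc, fun y hy hc => ?_⟩
    rcases Finset.mem_union.1 hy with hy | hy
    · exact hj y hy hc
    · obtain ⟨_, hw, rfl⟩ := Finset.mem_image.1 hy
      obtain ⟨v, hv, rfl⟩ := Finset.mem_image.1 hw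
      exact hj v hv (hg2 v j ((hh2 _ j).1 hc))
  refine ⟨homotopyEquiv_of_contiguous h g hh hg ?_ hcon, ?_⟩
  · intro s hs
    rw [Finset.image_image]
    have : g ∘ h = id := funext hgh
    rwa [this, Finset.image_id, Finset.union_self]
  · refine eulerChar_eq_of_dominated ⟨h, hinj⟩ (fun s => ?_) (fun v hv v' hv' => ?_)
      (fun v hv => ⟨h (g v), fun he => hv ⟨_, he⟩, fun σ hσ hvσ => ⟨_, hcon σ hσ,
        Finset.subset_union_left, Finset.mem_union_right _
          (Finset.mem_image_of_mem _ (Finset.mem_image_of_mem _ hvσ))⟩⟩)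
    · rw [Finset.map_eq_image]
      refine ⟨hh s, fun hs => ?_⟩
      have := hg _ hs
      rw [Finset.image_image] at this
      have he : g ∘ h = id := funext hgh
      rwa [Function.Embedding.coeFn_mk, he, Finset.image_id] at this
    · exact Subtype.ext (start_injOn Y v.2.1 v'.2.1 ((hstart v hv).trans (hstart v' hv').symm))

end DeletionComplex

end Nakayama
namespace Nakayama

/-! ### Projective and global dimension -/

section ProjectiveDimension

variable {R : Type u} [Ring R] {A B C : Type u} [AddCommGroup A] [Module R A] [AddCommGroup B]
  [Module R B] [AddCommGroup C] [Module R C]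

variable (R A) in
/-- The projective dimension of a module is less than `d`. -/
def PdLT (d : ℕ) : Prop := HasProjectiveDimensionLT (ModuleCat.of R A) d

theorem shortExact_of_exact (f : A →ₗ[R] B) (g : B →ₗ[R] C) (hf : Function.Injective f)
    (hg : Function.Surjective g) (hfg : Function.Exact f g) :
    (ShortComplex.mk (ModuleCat.ofHom f) (ModuleCat.ofHom g) (by
      rw [← ModuleCat.ofHom_comp, hfg.linearMap_comp_eq_zero]; rfl)).ShortExact where
  exact := (ShortComplex.ShortExact.moduleCat_exact_iff_function_exact _).2 hfg
  mono_f := (ModuleCat.mono_iff_injective _).2 hf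
  epi_g := (ModuleCat.epi_iff_surjective _).2 hg

theorem PdLT.of_equiv (e : A ≃ₗ[R] B) {d : ℕ} (h : PdLT R A d) : PdLT R B d :=
  haveI : HasProjectiveDimensionLT (ModuleCat.of R A) d := h
  hasProjectiveDimensionLT_of_iso e.toModuleIso d

theorem PdLT.mono {d d' : ℕ} (h : PdLT R A d) (hd : d ≤ d') : PdLT R A d' :=
  haveI : HasProjectiveDimensionLT (ModuleCat.of R A) d := h
  hasProjectiveDimensionLT_of_ge _ d d' hd

theorem pdLT_one_iff : PdLT R A 1 ↔ Module.Projective R A :=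
  projective_iff_hasProjectiveDimensionLT_one.symm.trans (IsProjective.iff_projective A).symm

theorem PdLT.mid {f : A →ₗ[R] B} {g : B →ₗ[R] C} (hf : Function.Injective f)
    (hg : Function.Surjective g) (hfg : Function.Exact f g) {d : ℕ} (hA : PdLT R A d)
    (hC : PdLT R C d) : PdLT R B d :=
  (shortExact_of_exact f g hf hg hfg).hasProjectiveDimensionLT_X₂ d hA hC

theorem PdLT.right {f : A →ₗ[R] B} {g : B →ₗ[R] C} (hf : Function.Injective f)
    (hg : Function.Surjective g) (hfg : Function.Exact f g) {d : ℕ} (hA : PdLT R A d)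
    (hB : PdLT R B (d + 1)) : PdLT R C (d + 1) :=
  (shortExact_of_exact f g hf hg hfg).hasProjectiveDimensionLT_X₃ d hA hB

theorem pdLT_right_iff {f : A →ₗ[R] B} {g : B →ₗ[R] C} (hf : Function.Injective f)
    (hg : Function.Surjective g) (hfg : Function.Exact f g) [Module.Projective R B] (d : ℕ) :
    PdLT R C (d + 2) ↔ PdLT R A (d + 1) :=
  (shortExact_of_exact f g hf hg hfg).hasProjectiveDimensionLT_X₃_iff d
    ((IsProjective.iff_projective B).1 inferInstance)

instance projective_finsupp (κ : Type u) [Module.Projective R A] :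
    Module.Projective R (κ →₀ A) := by
  classical
  exact Module.Projective.of_equiv (finsuppLequivDFinsupp R).symm

theorem globalDim_le_iff {A : Type u} [Ring A] (d : ℕ) :
    globalDim A ≤ d ↔
      ∀ (M : Type u) [AddCommGroup M] [Module Aᵐᵒᵖ M], PdLT Aᵐᵒᵖ M (d + 1) := by
  rw [globalDim, iSup_le_iff]
  constructor
  · intro h M _ _
    exact (projectiveDimension_le_iff _ d).1 (h (ModuleCat.of Aᵐᵒᵖ M))
  · intro h M
    exact (projectiveDimension_le_iff _ d).2 (h M)

/-- Only zero modules have projective dimension ⊥, and the regular module is not zero. -/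
theorem globalDim_ne_bot {A : Type u} [Ring A] [Nontrivial A] : globalDim A ≠ ⊥ := by
  intro h
  have h1 : projectiveDimension (ModuleCat.of Aᵐᵒᵖ A) ≤ ⊥ := h ▸ le_iSup (f := fun M :
    ModuleCat.{u} Aᵐᵒᵖ => projectiveDimension M) (ModuleCat.of Aᵐᵒᵖ A)
  rw [le_bot_iff, projectiveDimension_eq_bot_iff, ModuleCat.isZero_iff_subsingleton] at h1
  have h2 : Subsingleton A := h1
  exact not_subsingleton A h2

end ProjectiveDimension

/-! ### The functor Hom(P, -) and the trace of P -/

section HomModule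

variable (R : Type u) [Ring R] (P : Type u) [AddCommGroup P] [Module R P]

/-- The homomorphisms from `P` to `M`, as a right module over the endomorphism ring of `P`. -/
def HomMod (M : Type u) [AddCommGroup M] [Module R M] : Type u := P →ₗ[R] M

variable {R P} {M : Type u} [AddCommGroup M] [Module R M] {M' : Type u} [AddCommGroup M']
  [Module R M']

instance : AddCommGroup (HomMod R P M) := inferInstanceAs (AddCommGroup (P →ₗ[R] M))

instance : Module (Module.End R P)ᵐᵒᵖ (HomMod R P M) where
  smul a f := LinearMap.comp (show P →ₗ[R] M from f) a.unop
  one_smul f := LinearMap.comp_id (show P →ₗ[R] M from f)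
  mul_smul _ _ _ := rfl
  smul_zero _ := LinearMap.zero_comp _
  smul_add _ _ _ := LinearMap.add_comp _ _ _
  add_smul a b f := LinearMap.comp_add a.unop b.unop (show P →ₗ[R] M from f)
  zero_smul f := LinearMap.comp_zero (show P →ₗ[R] M from f)

/-- Composition with a homomorphism. -/
def HomMod.map (g : M →ₗ[R] M') : HomMod R P M →ₗ[(Module.End R P)ᵐᵒᵖ] HomMod R P M' where
  toFun f := g.comp (show P →ₗ[R] M from f)
  map_add' _ _ := LinearMap.comp_add _ _ _
  map_smul' _ _ := rfl

theorem HomMod.map_injective {g : M →ₗ[R] M'} (hg : Function.Injective g) :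
    Function.Injective (HomMod.map (P := P) g) := fun _ _ h =>
  LinearMap.ext fun p => hg (LinearMap.congr_fun h p)

theorem HomMod.map_surjective [Module.Projective R P] {g : M →ₗ[R] M'}
    (hg : Function.Surjective g) : Function.Surjective (HomMod.map (P := P) g) := fun f =>
  Module.projective_lifting_property g f hg

theorem HomMod.map_exact {M'' : Type u} [AddCommGroup M''] [Module R M''] {f : M →ₗ[R] M'}
    {g : M' →ₗ[R] M''} (hf : Function.Injective f) (hfg : Function.Exact f g) :
    Function.Exact (HomMod.map (P := P) f) (HomMod.map (P := P) g) := by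
  intro φ
  constructor
  · intro h
    have h1 : ∀ p, ∃ m, f m = (show P →ₗ[R] M' from φ) p := fun p =>
      (hfg _).1 (LinearMap.congr_fun h p)
    let e := LinearEquiv.ofInjective f hf
    refine ⟨e.symm.toLinearMap ∘ₗ LinearMap.codRestrict (LinearMap.range f) φ h1,
      LinearMap.ext fun p => ?_⟩
    exact congrArg Subtype.val (e.apply_symm_apply _)
  · rintro ⟨ψ, rfl⟩
    exact LinearMap.ext fun p => hfg.apply_apply_eq_zero _

/-- As P is finitely generated, φ meets only finitely many coordinates, and it is the finite sum of
its components composed with the inclusions. -/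
theorem HomMod.mem_span_range_lsingle [Module.Finite R P] {κ : Type u}
    (φ : HomMod R P (κ →₀ P)) :
    φ ∈ Submodule.span (Module.End R P)ᵐᵒᵖ
      (Set.range fun k : κ => (show HomMod R P (κ →₀ P) from Finsupp.lsingle k)) := by
  classical
  let ψ : P →ₗ[R] (κ →₀ P) := φ
  obtain ⟨t, ht⟩ := Module.Finite.fg_top (R := R) (M := P)
  let s : Finset κ := t.biUnion fun p => (ψ p).support
  have hs : ∀ p, ψ p ∈ Finsupp.supported P R (s : Set κ) := by
    intro p
    have hle : Submodule.span R (t : Set P) ≤ (Finsupp.supported P R (s : Set κ)).comap ψ := by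
      rw [Submodule.span_le]
      intro p hp
      change ψ p ∈ Finsupp.supported P R (s : Set κ)
      rw [Finsupp.mem_supported]
      intro k hk
      exact Finset.mem_biUnion.2 ⟨p, hp, hk⟩
    exact hle (ht ▸ trivial)
  have h : φ = ∑ k ∈ s, MulOpposite.op (Finsupp.lapply k ∘ₗ ψ : Module.End R P) •
      (show HomMod R P (κ →₀ P) from Finsupp.lsingle k) := by
    change ψ = ∑ k ∈ s, Finsupp.lsingle k ∘ₗ Finsupp.lapply k ∘ₗ ψ
    refine LinearMap.ext fun p => ?_
    rw [LinearMap.sum_apply]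
    ext k
    rw [Finsupp.finsetSum_apply]
    simp only [LinearMap.comp_apply, Finsupp.lsingle_apply, Finsupp.lapply_apply,
      Finsupp.single_apply, Finset.sum_ite_eq']
    split_ifs with hk
    · rfl
    · by_contra h0
      exact hk ((Finsupp.mem_supported _ _).1 (hs p) (Finsupp.mem_support_iff.2 h0))
  rw [h]
  exact Submodule.sum_mem _ fun k _ => Submodule.smul_mem _ _ (Submodule.subset_span ⟨k, rfl⟩)

/-- The homomorphisms from `P` to a direct sum of copies of `P` form a free module. -/
noncomputable def HomMod.basis [Module.Finite R P] (κ : Type u) :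
    Module.Basis κ (Module.End R P)ᵐᵒᵖ (HomMod R P (κ →₀ P)) :=
  Module.Basis.mk (v := fun k : κ => (show HomMod R P (κ →₀ P) from Finsupp.lsingle k))
    (by
      rw [linearIndependent_iff']
      intro s c hc k hk
      have h1 := congrArg (HomMod.map (P := P) (Finsupp.lapply k : (κ →₀ P) →ₗ[R] P)) hc
      rw [map_sum, map_zero, Finset.sum_eq_single k] at h1
      · rw [map_smul] at h1
        refine MulOpposite.unop_injective (LinearMap.ext fun p => ?_)
        have h2 := LinearMap.congr_fun h1 p
        change (Finsupp.single k ((c k).unop p) : κ →₀ P) k = _ at h2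
        rw [Finsupp.single_eq_same] at h2
        exact h2
      · intro j _ hj
        rw [map_smul]
        refine LinearMap.ext fun p => ?_
        change (Finsupp.single j ((c j).unop p) : κ →₀ P) k = 0
        exact Finsupp.single_eq_of_ne hj.symm
      · exact fun h => absurd hk h)
    (fun φ _ => HomMod.mem_span_range_lsingle φ)

theorem HomMod.basis_apply [Module.Finite R P] (κ : Type u) (k : κ) :
    HomMod.basis (R := R) (P := P) κ k = (show HomMod R P (κ →₀ P) from Finsupp.lsingle k) :=
  Module.Basis.mk_apply _ _ k

/-- The homomorphism from a direct sum of copies of `P` given by a family of homomorphisms. -/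
noncomputable def sumMap {κ : Type u} (f : κ → (P →ₗ[R] M)) : (κ →₀ P) →ₗ[R] M :=
  Finsupp.lsum ℕ f

theorem sumMap_single {κ : Type u} (f : κ → (P →ₗ[R] M)) (k : κ) (p : P) :
    sumMap f (Finsupp.single k p) = f k p := by
  rw [sumMap, Finsupp.lsum_single]

theorem sumMap_comp_lsingle {κ : Type u} (f : κ → (P →ₗ[R] M)) (k : κ) :
    sumMap f ∘ₗ Finsupp.lsingle k = f k :=
  LinearMap.ext fun p => sumMap_single f k p

variable (R P M) in
/-- The canonical homomorphism from a direct sum of copies of `P` whose image is the trace of `P`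
in `M`. -/
noncomputable def traceMap : ((P →ₗ[R] M) →₀ P) →ₗ[R] M := sumMap id

theorem traceMap_single (f : P →ₗ[R] M) (p : P) :
    traceMap R P M (Finsupp.single f p) = f p :=
  sumMap_single id f p

theorem range_le_range_traceMap (f : P →ₗ[R] M) :
    LinearMap.range f ≤ LinearMap.range (traceMap R P M) := by
  rintro _ ⟨p, rfl⟩
  exact ⟨Finsupp.single f p, traceMap_single f p⟩

theorem traceMap_surjective_of_sumMap {κ : Type u} (f : κ → (P →ₗ[R] M))
    (hf : Function.Surjective (sumMap f)) : Function.Surjective (traceMap R P M) := by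
  rw [← LinearMap.range_eq_top] at hf ⊢
  rw [eq_top_iff, ← hf]
  rintro _ ⟨z, rfl⟩
  induction z using Finsupp.induction_linear with
  | zero => rw [map_zero]; exact zero_mem _
  | add x y hx hy => rw [map_add]; exact add_mem hx hy
  | single k p =>
    rw [sumMap_single]
    exact range_le_range_traceMap (f k) ⟨p, rfl⟩

/-- Projectivity lifts f to M, and the image of every map from P to M lies in the trace. -/
theorem hom_quotient_range_traceMap_eq_zero [Module.Projective R P]
    (f : P →ₗ[R] (M ⧸ LinearMap.range (traceMap R P M))) : f = 0 := by
  obtain ⟨g, rfl⟩ := Module.projective_lifting_property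
    (LinearMap.range (traceMap R P M)).mkQ f (Submodule.mkQ_surjective _)
  refine LinearMap.ext fun p => ?_
  rw [LinearMap.comp_apply, Submodule.mkQ_apply, LinearMap.zero_apply,
    Submodule.Quotient.mk_eq_zero]
  exact range_le_range_traceMap g ⟨p, rfl⟩

theorem surjective_traceMap_range :
    Function.Surjective (traceMap R P (LinearMap.range (traceMap R P M))) := by
  refine traceMap_surjective_of_sumMap (κ := P →ₗ[R] M) (fun f => f.codRestrict _ fun p =>
    range_le_range_traceMap f ⟨p, rfl⟩) ?_
  rintro ⟨_, ⟨z, rfl⟩⟩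
  refine ⟨z, Subtype.ext ?_⟩
  induction z using Finsupp.induction_linear with
  | zero => simp
  | add x y hx hy => rw [map_add, Submodule.coe_add, hx, hy, ← map_add]
  | single k p =>
    rw [sumMap_single]
    exact (traceMap_single k p).symm

end HomModule

/-! ### Comparing modules over R with modules over End(P) -/

section PresentedClass

variable (R : Type u) [Ring R] (P : Type u) [AddCommGroup P] [Module R P]

/-- A class of modules generated by `P`, closed under kernels of epimorphisms, cokernels of
monomorphisms and submodules generated by `P`. -/
structure IsPresentedClass (T : ∀ (M : Type u) [AddCommGroup M] [Module R M], Prop) : Prop where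
  finsupp : ∀ κ : Type u, T (κ →₀ P)
  traceMap_surjective : ∀ (M : Type u) [AddCommGroup M] [Module R M], T M →
    Function.Surjective (traceMap R P M)
  of_injective : ∀ (N M : Type u) [AddCommGroup N] [Module R N] [AddCommGroup M] [Module R M]
    (i : N →ₗ[R] M), Function.Injective i → T M → Function.Surjective (traceMap R P N) → T N
  ker : ∀ (M N : Type u) [AddCommGroup M] [Module R M] [AddCommGroup N] [Module R N]
    (g : M →ₗ[R] N), T M → T N → T (LinearMap.ker g)
  quotient : ∀ (M : Type u) [AddCommGroup M] [Module R M] (N : Submodule R M), T N → T M →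
    T (M ⧸ N)

variable {R P} {T : ∀ (M : Type u) [AddCommGroup M] [Module R M], Prop}
  [Module.Finite R P]

/-- Both sides agree on the basis of a free module. This realizes an abstract End(P)-linear map,
precomposed with a presentation, by an R-linear map. -/
theorem sumMap_comp_eq {M N : Type u} [AddCommGroup M] [Module R M] [AddCommGroup N] [Module R N]
    {κ : Type u} (f : κ → (P →ₗ[R] M)) (f' : κ → (P →ₗ[R] N))
    (σ : HomMod R P M →ₗ[(Module.End R P)ᵐᵒᵖ] HomMod R P N) (hσ : ∀ k, σ (f k) = f' k) :
    HomMod.map (sumMap f') = σ ∘ₗ HomMod.map (sumMap f) := by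
  refine (HomMod.basis κ).ext fun k => ?_
  rw [HomMod.basis_apply, LinearMap.comp_apply]
  change sumMap f' ∘ₗ Finsupp.lsingle k = σ (sumMap f ∘ₗ Finsupp.lsingle k)
  rw [sumMap_comp_lsingle, sumMap_comp_lsingle]
  exact (hσ k).symm

variable [Module.Projective R P]

/-- A splitting of the trace map gives a splitting of its image under Hom(P, -). Conversely, a
section σ on the Hom modules defines an endomorphism s' of the sum of copies of P, which has to be
factored through M. -/
theorem IsPresentedClass.projective_iff (hT : IsPresentedClass R P T) {M : Type u}
    [AddCommGroup M] [Module R M] (hM : T M) :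
    Module.Projective R M ↔ Module.Projective (Module.End R P)ᵐᵒᵖ (HomMod R P M) := by
  have hsurj := hT.traceMap_surjective M hM
  constructor
  · intro h
    obtain ⟨s, hs⟩ := Module.projective_lifting_property (traceMap R P M) LinearMap.id hsurj
    have : Module.Free (Module.End R P)ᵐᵒᵖ (HomMod R P ((P →ₗ[R] M) →₀ P)) :=
      Module.Free.of_basis (HomMod.basis _)
    refine Module.Projective.of_split (HomMod.map s) (HomMod.map (traceMap R P M)) ?_
    refine LinearMap.ext fun f => ?_
    change (traceMap R P M ∘ₗ s) ∘ₗ (show P →ₗ[R] M from f) = f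
    rw [hs]
    rfl
  · intro h
    obtain ⟨σ, hσ⟩ := Module.projective_lifting_property (HomMod.map (P := P) (traceMap R P M))
      LinearMap.id (HomMod.map_surjective hsurj)
    let fam : (P →ₗ[R] M) → (P →ₗ[R] ((P →ₗ[R] M) →₀ P)) := fun f => σ f
    let s' : ((P →ₗ[R] M) →₀ P) →ₗ[R] ((P →ₗ[R] M) →₀ P) := sumMap fam
    have hs' : HomMod.map (P := P) s' = σ ∘ₗ HomMod.map (traceMap R P M) :=
      sumMap_comp_eq id fam σ fun f => rfl
    -- The kernel of the trace map belongs to T, so it is generated by images of P; on each of these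
    -- s' is σ applied to zero.
    have hker : LinearMap.ker (traceMap R P M) ≤ LinearMap.ker s' := by
      intro z hz
      obtain ⟨y, hy⟩ := hT.traceMap_surjective _ (hT.ker _ _ (traceMap R P M) (hT.finsupp _) hM)
        ⟨z, hz⟩
      have key : s' ∘ₗ (LinearMap.ker (traceMap R P M)).subtype ∘ₗ
          traceMap R P (LinearMap.ker (traceMap R P M)) = 0 := by
        refine Finsupp.lhom_ext fun f p => ?_
        have h1 := LinearMap.congr_fun hs' ((LinearMap.ker (traceMap R P M)).subtype ∘ₗ f)
        have h2 : HomMod.map (P := P) (traceMap R P M)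
            ((LinearMap.ker (traceMap R P M)).subtype ∘ₗ f) = 0 :=
          LinearMap.ext fun q => (f q).2
        rw [LinearMap.comp_apply, LinearMap.comp_apply, traceMap_single]
        exact LinearMap.congr_fun (h1.trans ((congrArg σ h2).trans (map_zero σ))) p
      have h3 := LinearMap.congr_fun key y
      rw [LinearMap.comp_apply, LinearMap.comp_apply, hy] at h3
      exact h3
    let e := (traceMap R P M).quotKerEquivOfSurjective hsurj
    let s : M →ₗ[R] ((P →ₗ[R] M) →₀ P) :=
      (LinearMap.ker (traceMap R P M)).liftQ s' hker ∘ₗ e.symm.toLinearMap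
    have hs : ∀ z, s (traceMap R P M z) = s' z := by
      intro z
      have : e.symm (traceMap R P M z) = Submodule.Quotient.mk z := by
        rw [LinearEquiv.symm_apply_eq]
        rfl
      change (LinearMap.ker (traceMap R P M)).liftQ s' hker (e.symm (traceMap R P M z)) = _
      rw [this]
      rfl
    have hgs : traceMap R P M ∘ₗ s' = traceMap R P M := by
      refine Finsupp.lhom_ext fun f p => ?_
      rw [LinearMap.comp_apply, sumMap_single, traceMap_single]
      exact LinearMap.congr_fun (LinearMap.congr_fun hσ f) p
    refine Module.Projective.of_split s (traceMap R P M) (LinearMap.ext fun m => ?_)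
    obtain ⟨z, rfl⟩ := hsurj m
    rw [LinearMap.comp_apply, hs]
    exact LinearMap.congr_fun hgs z

/-- Dimension shift along the trace map: its kernel stays in T, and Hom(P, -) takes its source to a
free module. -/
theorem IsPresentedClass.pdLT_iff (hT : IsPresentedClass R P T) (d : ℕ) {M : Type u}
    [AddCommGroup M] [Module R M] (hM : T M) :
    PdLT R M (d + 1) ↔ PdLT (Module.End R P)ᵐᵒᵖ (HomMod R P M) (d + 1) := by
  induction d generalizing M with
  | zero => rw [zero_add, pdLT_one_iff, pdLT_one_iff, hT.projective_iff hM]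
  | succ d ih =>
    have hsurj := hT.traceMap_surjective M hM
    have : Module.Free (Module.End R P)ᵐᵒᵖ (HomMod R P ((P →ₗ[R] M) →₀ P)) :=
      Module.Free.of_basis (HomMod.basis _)
    have hex := LinearMap.exact_subtype_ker_map (traceMap R P M)
    have hinj := (LinearMap.ker (traceMap R P M)).injective_subtype
    rw [pdLT_right_iff hinj hsurj hex, ih (hT.ker _ _ _ (hT.finsupp _) hM),
      pdLT_right_iff (HomMod.map_injective hinj) (HomMod.map_surjective hsurj)
        (HomMod.map_exact hinj hex)]

/-- Write X as the quotient by `ker π` of a free module, realized as the maps from P to a sum of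
copies of P. Dividing this sum by the images N of all maps in `ker π` gives the required module M.
-/
theorem IsPresentedClass.exists_homMod_equiv (hT : IsPresentedClass R P T) (X : Type u)
    [AddCommGroup X] [Module (Module.End R P)ᵐᵒᵖ X] :
    ∃ (M : Type u) (_ : AddCommGroup M) (_ : Module R M), T M ∧
      Nonempty (HomMod R P M ≃ₗ[(Module.End R P)ᵐᵒᵖ] X) := by
  let π : HomMod R P (X →₀ P) →ₗ[(Module.End R P)ᵐᵒᵖ] X :=
    (HomMod.basis X).constr ℕ id
  have hπ : Function.Surjective π := fun x => ⟨HomMod.basis X x, (HomMod.basis X).constr_basis _ _ _⟩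
  let fam : LinearMap.ker π → (P →ₗ[R] (X →₀ P)) := Subtype.val
  let N : Submodule R (X →₀ P) := LinearMap.range (sumMap fam)
  have hN : Function.Surjective (traceMap R P N) := by
    refine traceMap_surjective_of_sumMap (κ := LinearMap.ker π) (fun x => (fam x).codRestrict N
      fun p => ⟨Finsupp.single x p, sumMap_single _ _ _⟩) ?_
    rintro ⟨_, ⟨z, rfl⟩⟩
    refine ⟨z, Subtype.ext ?_⟩
    induction z using Finsupp.induction_linear with
    | zero => simp
    | add x y hx hy => rw [map_add, Submodule.coe_add, hx, hy, ← map_add]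
    | single k p =>
      exact (congrArg Subtype.val (sumMap_single _ k p)).trans (sumMap_single fam k p).symm
  have hTN : T N := hT.of_injective N _ N.subtype N.injective_subtype (hT.finsupp X) hN
  refine ⟨(X →₀ P) ⧸ N, inferInstance, inferInstance, hT.quotient _ N hTN (hT.finsupp X), ?_⟩
  -- A map φ from P into N lifts, by projectivity, to the sum of copies of P indexed by `ker π`.
  -- Since π vanishes on the basis of Hom(P, -) of that sum, it vanishes on φ.
  have hker : LinearMap.ker (HomMod.map (P := P) N.mkQ) = LinearMap.ker π := by
    ext φ
    constructor
    · intro hφ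
      have h1 : ∀ p, (show P →ₗ[R] (X →₀ P) from φ) p ∈ N := fun p => by
        have h2 := LinearMap.congr_fun hφ p
        exact (Submodule.Quotient.mk_eq_zero N).1 h2
      obtain ⟨θ, hθ⟩ := Module.projective_lifting_property (sumMap fam).rangeRestrict
        (LinearMap.codRestrict N φ h1) (LinearMap.surjective_rangeRestrict _)
      have h3 : φ = HomMod.map (sumMap fam) θ := LinearMap.ext fun p =>
        (congrArg Subtype.val (LinearMap.congr_fun hθ p)).symm
      have h4 : π ∘ₗ HomMod.map (sumMap fam) = 0 := by
        refine (HomMod.basis _).ext fun k => ?_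
        rw [HomMod.basis_apply, LinearMap.comp_apply]
        change π (sumMap fam ∘ₗ Finsupp.lsingle k) = 0
        rw [sumMap_comp_lsingle]
        exact k.2
      rw [LinearMap.mem_ker, h3]
      exact LinearMap.congr_fun h4 θ
    · intro hφ
      refine LinearMap.ext fun p => ?_
      exact (Submodule.Quotient.mk_eq_zero N).2
        ⟨Finsupp.single ⟨φ, hφ⟩ p, sumMap_single fam ⟨φ, hφ⟩ p⟩
  exact ⟨((HomMod.map (P := P) N.mkQ).quotKerEquivOfSurjective
    (HomMod.map_surjective (Submodule.mkQ_surjective N))).symm.trans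
    ((Submodule.quotEquivOfEq _ _ hker).trans (π.quotKerEquivOfSurjective hπ))⟩

theorem IsPresentedClass.pdLT_end (hT : IsPresentedClass R P T) {d : ℕ}
    (h : ∀ (M : Type u) [AddCommGroup M] [Module R M], PdLT R M (d + 1)) (X : Type u)
    [AddCommGroup X] [Module (Module.End R P)ᵐᵒᵖ X] : PdLT (Module.End R P)ᵐᵒᵖ X (d + 1) := by
  obtain ⟨M, _, _, hM, ⟨e⟩⟩ := hT.exists_homMod_equiv X
  exact ((hT.pdLT_iff d hM).1 (h M)).of_equiv e

/-- Let Z be the kernel of the trace map of M, I its image, and Z₀ the trace of P in Z. Then Z₀ lies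
in T and has dimension at most d, while Z/Z₀ and M/I are killed by Hom(P, -) and have dimension at
most d + 1 by `hkill`. Hence Z has dimension at most d + 1, and I and M at most d + 2. -/
theorem IsPresentedClass.pdLT_of_end (hT : IsPresentedClass R P T)
    (hkill : ∀ (M : Type u) [AddCommGroup M] [Module R M], (∀ f : P →ₗ[R] M, f = 0) →
      ∃ (A B : Type u) (_ : AddCommGroup A) (_ : Module R A) (_ : AddCommGroup B) (_ : Module R B)
        (f : A →ₗ[R] B) (g : B →ₗ[R] M), T A ∧ Module.Projective R B ∧ Function.Injective f ∧
        Function.Surjective g ∧ Function.Exact f g) {d : ℕ}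
    (h : ∀ (X : Type u) [AddCommGroup X] [Module (Module.End R P)ᵐᵒᵖ X],
      PdLT (Module.End R P)ᵐᵒᵖ X (d + 1)) (M : Type u) [AddCommGroup M] [Module R M] :
    PdLT R M (d + 3) := by
  have hk : ∀ (M : Type u) [AddCommGroup M] [Module R M], (∀ f : P →ₗ[R] M, f = 0) →
      PdLT R M (d + 2) := by
    intro M _ _ hM
    obtain ⟨A, B, _, _, _, _, f, g, hA, hB, hf, hg, hfg⟩ := hkill M hM
    exact (pdLT_right_iff hf hg hfg d).2 ((hT.pdLT_iff d hA).2 (h _))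
  let Z := LinearMap.ker (traceMap R P M)
  let Z₀ := LinearMap.range (traceMap R P Z)
  have hZ₀ : T Z₀ := hT.of_injective Z₀ _ (Z.subtype ∘ₗ Z₀.subtype)
    (Z.injective_subtype.comp Z₀.injective_subtype) (hT.finsupp _) surjective_traceMap_range
  have hZ : PdLT R Z (d + 2) := by
    refine PdLT.mid Z₀.injective_subtype (Submodule.mkQ_surjective Z₀)
      (LinearMap.exact_subtype_mkQ Z₀) (((hT.pdLT_iff d hZ₀).2 (h _)).mono (by omega)) ?_
    exact hk _ hom_quotient_range_traceMap_eq_zero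
  have hF : PdLT R ((P →ₗ[R] M) →₀ P) 1 := pdLT_one_iff.2 inferInstance
  let I := LinearMap.range (traceMap R P M)
  have hI : PdLT R I (d + 3) := by
    refine PdLT.right (g := (traceMap R P M).rangeRestrict) Z.injective_subtype
      (LinearMap.surjective_rangeRestrict _) ?_ hZ (hF.mono (by omega))
    intro z
    rw [← LinearMap.mem_ker, LinearMap.ker_rangeRestrict]
    exact ⟨fun hz => ⟨⟨z, hz⟩, rfl⟩, fun ⟨y, hy⟩ => hy ▸ y.2⟩
  exact PdLT.mid I.injective_subtype (Submodule.mkQ_surjective I) (LinearMap.exact_subtype_mkQ I)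
    hI ((hk _ hom_quotient_range_traceMap_eq_zero).mono (by omega))

end PresentedClass

end Nakayama
namespace Nakayama

/-! ### Modules on which an arrow acts bijectively -/

section ArrowBijective

variable {R : Type u} [Ring R]

/-- Multiplication by `a` is injective on the component of `M` cut out by the idempotent `e'`. -/
def ArrowInj (e' a : R) (M : Type u) [AddCommGroup M] [Module R M] : Prop :=
  ∀ m : M, e' • m = m → a • m = 0 → m = 0

/-- Multiplication by `a` maps the component of `M` cut out by the idempotent `e'` onto the one
cut out by `e`. -/
def ArrowSurj (e' e a : R) (M : Type u) [AddCommGroup M] [Module R M] : Prop :=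
  ∀ m : M, e • m = m → ∃ m' : M, e' • m' = m' ∧ a • m' = m

/-- Multiplication by `a` is a bijection from the component of `M` cut out by the idempotent `e'`
to the one cut out by `e`. -/
def ArrowBij (e' e a : R) (M : Type u) [AddCommGroup M] [Module R M] : Prop :=
  ArrowInj e' a M ∧ ArrowSurj e' e a M

variable {e' e a : R} {M N : Type u} [AddCommGroup M] [Module R M] [AddCommGroup N] [Module R N]

theorem ArrowInj.of_injective (h : ArrowInj e' a M) (i : N →ₗ[R] M) (hi : Function.Injective i) :
    ArrowInj e' a N := fun m h1 h2 => hi (by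
  rw [map_zero]
  exact h (i m) (by rw [← map_smul, h1]) (by rw [← map_smul, h2, map_zero]))

theorem ArrowSurj.of_surjective (h : ArrowSurj e' e a M) (he : e * e = e) (g : M →ₗ[R] N)
    (hg : Function.Surjective g) : ArrowSurj e' e a N := fun m hm => by
  obtain ⟨x, rfl⟩ := hg m
  obtain ⟨y, hy1, hy2⟩ := h (e • x) (by rw [smul_smul, he])
  exact ⟨g y, by rw [← map_smul, hy1], by rw [← map_smul, hy2, map_smul, hm]⟩

theorem ArrowBij.finsupp (h : ArrowBij e' e a M) (κ : Type u) : ArrowBij e' e a (κ →₀ M) := by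
  classical
  refine ⟨fun m h1 h2 => Finsupp.ext fun k => h.1 (m k) (DFunLike.congr_fun h1 k)
    (DFunLike.congr_fun h2 k), fun m hm => ?_⟩
  -- The preimages are chosen with 0 ↦ 0, so that the family of preimages has finite support.
  have h1 : ∀ x : M, ∃ y : M, (e • x = x → e' • y = y ∧ a • y = x) ∧ (x = 0 → y = 0) := by
    intro x
    by_cases hx0 : x = 0
    · exact ⟨0, fun _ => ⟨smul_zero _, by rw [smul_zero, hx0]⟩, fun _ => rfl⟩
    · by_cases hx : e • x = x
      · obtain ⟨y, hy⟩ := h.2 x hx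
        exact ⟨y, fun _ => hy, fun h0 => absurd h0 hx0⟩
      · exact ⟨0, fun h => absurd h hx, fun _ => rfl⟩
  choose c hc1 hc2 using h1
  refine ⟨m.mapRange c (hc2 0 rfl), Finsupp.ext fun k => ?_, Finsupp.ext fun k => ?_⟩
  · rw [Finsupp.smul_apply, Finsupp.mapRange_apply]
    exact (hc1 _ (DFunLike.congr_fun hm k)).1
  · rw [Finsupp.smul_apply, Finsupp.mapRange_apply]
    exact (hc1 _ (DFunLike.congr_fun hm k)).2

theorem ArrowBij.ker (hM : ArrowBij e' e a M) (hN : ArrowBij e' e a N) (g : M →ₗ[R] N) :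
    ArrowBij e' e a (LinearMap.ker g) := by
  refine ⟨hM.1.of_injective (LinearMap.ker g).subtype (Submodule.injective_subtype _), ?_⟩
  rintro ⟨m, hm⟩ h
  obtain ⟨y, hy1, hy2⟩ := hM.2 m (congrArg Subtype.val h)
  have hy3 : g y = 0 := hN.1 _ (by rw [← map_smul, hy1]) (by rw [← map_smul, hy2]; exact hm)
  exact ⟨⟨y, hy3⟩, Subtype.ext hy1, Subtype.ext hy2⟩

theorem ArrowBij.quotient (he : e * e = e) (he' : e' * e' = e') (hea : e * a = a)
    (hae : a * e' = a) (N : Submodule R M) (hN : ArrowBij e' e a N) (hM : ArrowBij e' e a M) :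
    ArrowBij e' e a (M ⧸ N) := by
  refine ⟨?_, hM.2.of_surjective he N.mkQ N.mkQ_surjective⟩
  intro m h1 h2
  obtain ⟨m, rfl⟩ := N.mkQ_surjective m
  rw [← map_smul, Submodule.mkQ_apply, Submodule.Quotient.mk_eq_zero] at h2
  -- Surjectivity on N provides y in N with the same product as m, and injectivity on M identifies y
  -- with e'm.
  obtain ⟨⟨y, hyN⟩, hy1, hy2⟩ := hN.2 ⟨a • m, h2⟩ (Subtype.ext (by
    change e • a • m = a • m
    rw [smul_smul, hea]))
  have hy1 : e' • y = y := congrArg Subtype.val hy1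
  have hy2 : a • y = a • m := congrArg Subtype.val hy2
  have h3 : e' • m - y = 0 := hM.1 _ (by rw [smul_sub, smul_smul, he', hy1])
    (by rw [smul_sub, smul_smul, hae, hy2, sub_self])
  rw [← h1, ← map_smul, sub_eq_zero.1 h3, Submodule.mkQ_apply, Submodule.Quotient.mk_eq_zero]
  exact hyN

end ArrowBijective

/-! ### The class of modules attached to the leaf, and the global dimension -/

section NakayamaModules

variable (K : Type u) [Field K] {n : ℕ}

/-- The homomorphism from `P_i` to a module which multiplies an element with the paths. -/
noncomputable def evalMap {n : ℕ} {Y : Relations n} {M : Type u} [AddCommGroup M]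
    [Module (Alg K Y)ᵐᵒᵖ M] (i : Fin n) (m : M) : proj K Y i →ₗ[(Alg K Y)ᵐᵒᵖ] M where
  toFun p := MulOpposite.op (p : Alg K Y) • m
  map_add' p q := by rw [Submodule.coe_add, MulOpposite.op_add, add_smul]
  map_smul' r p := by
    rw [RingHom.id_apply, smul_smul]
    rfl

variable (Y : Relations (n + 1))

theorem projective_proj (i : Fin (n + 1)) :
    Module.Projective (Alg K Y)ᵐᵒᵖ (proj K Y i) := by
  refine Module.Projective.of_lifting_property'' fun f hf => ?_
  obtain ⟨x, hx⟩ := hf (projPath K Y i 0)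
  refine ⟨evalMap K i x, LinearMap.ext fun p => ?_⟩
  change f (MulOpposite.op (p : Alg K Y) • x) = p
  rw [map_smul, hx]
  exact Subtype.ext (proj_idem_mul p)

theorem projective_pPrime : Module.Projective (Alg K Y)ᵐᵒᵖ (PPrime K Y) := by
  have := fun j : Fin n => projective_proj K Y j.castSucc
  exact Module.Projective.of_equiv (DFinsupp.linearEquivFunOnFintype (R := (Alg K Y)ᵐᵒᵖ)
    (M := fun j : Fin n => proj K Y j.castSucc))

theorem finite_pPrime : Module.Finite (Alg K Y)ᵐᵒᵖ (PPrime K Y) := by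
  have : ∀ j : Fin n, Module.Finite (Alg K Y)ᵐᵒᵖ (proj K Y j.castSucc) := fun j =>
    Module.Finite.of_fg (Submodule.fg_span_singleton _)
  infer_instance

variable {Y}

variable (n) in
/-- The vertex before the last one. -/
def penult : Fin (n + 1) := ⟨n - 1, by omega⟩

variable (Y) in
/-- The arrow ending at the last vertex. -/
noncomputable def lastArrow : Alg K Y := pathClass K Y ⟨penult n, 1⟩

theorem idem_mul_lastArrow : idem K Y (penult n) * lastArrow K Y = lastArrow K Y :=
  idem_mul_pathClass K Y ⟨penult n, 1⟩

theorem mul_mul_idem_mul_idem (x y : Alg K Y) (i : Fin (n + 1)) :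
    x * y * idem K Y i * idem K Y i = x * y * idem K Y i := by
  rw [mul_assoc, idem_mul_self]

theorem sum_op_idem_smul {M : Type u} [AddCommGroup M] [Module (Alg K Y)ᵐᵒᵖ M] (m : M) :
    ∑ i : Fin n, MulOpposite.op (idem K Y i.castSucc) • m +
      MulOpposite.op (idem K Y (Fin.last n)) • m = m := by
  rw [← Fin.sum_univ_castSucc (f := fun i => MulOpposite.op (idem K Y i) • m), ← Finset.sum_smul,
    ← Finset.op_sum, sum_idem, MulOpposite.op_one, one_smul]

/-- Exhibits m e_j as a value of a map from P' to M: it lies in the trace of P', and it vanishes if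
there are no nonzero maps. -/
theorem op_idem_smul_eq_evalMap {M : Type u} [AddCommGroup M] [Module (Alg K Y)ᵐᵒᵖ M] (m : M)
    (j : Fin n) : MulOpposite.op (idem K Y j.castSucc) • m =
      (evalMap K j.castSucc m ∘ₗ LinearMap.proj j) (genPPrime K Y j) := by
  change _ = MulOpposite.op ((genPPrime K Y j) j : Alg K Y) • m
  rw [genPPrime, Pi.single_eq_same]
  rfl

theorem nontrivial_alg : Nontrivial (Alg K Y) := by
  refine ⟨idem K Y 0, 0, fun h => ?_⟩
  rw [idem, pathClass_eq_zero_iff, Y.bad_mk_iff] at h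
  have := Y.kupisch_pos 0
  omega

variable [NeZero n]

theorem next_penult : next (penult n) = Fin.last n := by
  refine Fin.ext ?_
  have := NeZero.pos n
  simp only [next, penult, Fin.val_last]
  rw [Nat.sub_add_cancel this, Nat.mod_eq_of_lt (Nat.lt_succ_self n)]

variable (n) in
theorem exists_castSucc_eq_penult : ∃ j : Fin n, j.castSucc = penult n :=
  ⟨⟨n - 1, by have := NeZero.pos n; omega⟩, rfl⟩

theorem lastArrow_mul_idem : lastArrow K Y * idem K Y (Fin.last n) = lastArrow K Y := by
  have h := pathClass_mul_idem K Y ⟨penult n, 1⟩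
  rwa [show (⟨penult n, 1⟩ : CPath (n + 1)).target = Fin.last n from next_penult] at h

variable (Y) in
/-- The class of modules on which the arrow ending at the last vertex acts bijectively. -/
def LeafClass (M : Type u) [AddCommGroup M] [Module (Alg K Y)ᵐᵒᵖ M] : Prop :=
  ArrowBij (MulOpposite.op (idem K Y (penult n))) (MulOpposite.op (idem K Y (Fin.last n)))
    (MulOpposite.op (lastArrow K Y)) M

/-- Only one arrow ends at the leaf, so a path that continues r and ends there finishes with this
arrow. The condition on r excludes the trivial continuation. -/
theorem exists_mul_lastArrow (r : CPath (n + 1)) (hr : r.target ≠ Fin.last n) (y : Alg K Y) :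
    ∃ z, pathClass K Y r * y * idem K Y (Fin.last n) =
      pathClass K Y r * z * idem K Y (penult n) * lastArrow K Y := by
  induction y using Alg.induction_on with
  | zero => exact ⟨0, by simp⟩
  | add y y' h h' =>
    obtain ⟨z, h⟩ := h
    obtain ⟨z', h'⟩ := h'
    exact ⟨z + z', by simp only [mul_add, add_mul, h, h']⟩
  | smul c q =>
    by_cases h1 : r.target = q.start
    · by_cases h2 : q.target = Fin.last n
      · rcases hq : q.len with _ | s
        · rw [CPath.target, hq] at h2
          exact absurd (h1.trans h2) hr
        · have h3 : (⟨q.start, s⟩ : CPath (n + 1)).target = penult n := by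
            apply next_injective
            rw [next_penult, ← h2, CPath.target, CPath.target, hq, Function.iterate_succ_apply']
          refine ⟨c • pathClass K Y ⟨q.start, s⟩, ?_⟩
          have h4 := pathClass_mul_idem K Y q
          rw [h2] at h4
          have h5 : pathClass K Y ⟨q.start, s⟩ * lastArrow K Y = pathClass K Y q := by
            rw [lastArrow, pathClass_mul K Y _ _ h3]
            congr 1
            exact CPath.ext rfl hq.symm
          simp only [mul_smul_comm, smul_mul_assoc, mul_assoc]
          rw [h4, idem_mul_lastArrow, h5]
      · refine ⟨0, ?_⟩
        rw [mul_assoc, smul_mul_assoc, idem, pathClass_mul_of_ne K Y q ⟨Fin.last n, 0⟩ h2]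
        simp
    · refine ⟨0, ?_⟩
      rw [mul_smul_comm, pathClass_mul_of_ne K Y r q h1]
      simp

variable (Y) in
/-- The linear endomorphism of `Λ` removing the last arrow of every path. -/
noncomputable def dropLast : Alg K Y →ₗ[K] Alg K Y :=
  (pathBasis K Y).constr K fun q => pathClass K Y ⟨q.1.start, q.1.len - 1⟩

/-- If a good path ending before the leaf became bad on appending the last arrow, its new length
would be the Kupisch number of its start, and the resolution quiver would have an arrow into the
leaf. Hence the last arrow can be cancelled. -/
theorem dropLast_mul_lastArrow (hY : ∀ a, Y.step a % (n + 1) ≠ n) (y : Alg K Y) :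
    dropLast K Y (y * idem K Y (penult n) * lastArrow K Y) = y * idem K Y (penult n) := by
  induction y using Alg.induction_on with
  | zero => simp
  | add y y' h h' => rw [add_mul, add_mul, map_add, h, h']
  | smul c q =>
    rw [smul_mul_assoc, smul_mul_assoc, map_smul]
    congr 1
    by_cases hb : Y.Bad q
    · rw [pathClass_eq_zero hb]
      simp
    by_cases hq : q.target = penult n
    · have hg : ¬ Y.Bad ⟨q.start, q.len + 1⟩ := by
        intro h
        rw [Y.bad_iff] at hb h
        simp only at h
        refine succ_ne_last hY q.start ?_
        rw [Relations.succ, show Y.kupisch q.start = q.len + 1 by omega,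
          Function.iterate_succ_apply']
        exact (congrArg next hq).trans next_penult
      rw [← hq, pathClass_mul_idem, lastArrow, pathClass_mul K Y q ⟨penult n, 1⟩ hq]
      have h1 : pathClass K Y (q.append ⟨penult n, 1⟩) =
          pathBasis K Y ⟨⟨q.start, q.len + 1⟩, hg⟩ := (pathBasis_apply K Y ⟨⟨q.start, q.len + 1⟩, hg⟩).symm
      rw [h1, dropLast, Module.Basis.constr_basis]
      rfl
    · rw [idem, pathClass_mul_of_ne K Y q ⟨penult n, 0⟩ hq]
      simp

theorem arrowInj_alg (hY : ∀ a, Y.step a % (n + 1) ≠ n) :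
    ArrowInj (MulOpposite.op (idem K Y (penult n))) (MulOpposite.op (lastArrow K Y))
      (Alg K Y) := by
  intro x h1 h2
  have h1 : x * idem K Y (penult n) = x := h1
  have h2 : x * lastArrow K Y = 0 := h2
  have h3 := dropLast_mul_lastArrow K hY x
  rwa [h1, h2, map_zero, eq_comm] at h3

theorem leafClass_proj (hY : ∀ a, Y.step a % (n + 1) ≠ n) (i : Fin n) :
    LeafClass K Y (proj K Y i.castSucc) := by
  refine ⟨(arrowInj_alg K hY).of_injective (proj K Y i.castSucc).subtype
    (Submodule.injective_subtype _), ?_⟩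
  intro m hm
  have hm : (m : Alg K Y) * idem K Y (Fin.last n) = m := congrArg Subtype.val hm
  obtain ⟨z, hz⟩ := exists_mul_lastArrow K ⟨i.castSucc, 0⟩ (Fin.castSucc_lt_last i).ne
    (m : Alg K Y)
  change idem K Y i.castSucc * _ * _ = idem K Y i.castSucc * _ * _ * _ at hz
  rw [proj_idem_mul, hm] at hz
  refine ⟨⟨idem K Y i.castSucc * z * idem K Y (penult n), ?_⟩, Subtype.ext ?_,
    Subtype.ext hz.symm⟩
  · rw [mem_proj_iff, ← mul_assoc, ← mul_assoc, idem_mul_self]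
  · exact mul_mul_idem_mul_idem K _ _ _

theorem leafClass_pPrime (hY : ∀ a, Y.step a % (n + 1) ≠ n) : LeafClass K Y (PPrime K Y) := by
  refine ⟨fun m h1 h2 => funext fun k => (leafClass_proj K hY k).1 (m k) (congrFun h1 k)
    (congrFun h2 k), fun m hm => ?_⟩
  choose y hy1 hy2 using fun k => (leafClass_proj K hY k).2 (m k) (congrFun hm k)
  exact ⟨y, funext hy1, funext hy2⟩

theorem next_last_ne : next (Fin.last n) ≠ Fin.last n := by
  intro h
  have h1 := congrArg Fin.val h
  simp only [next, Fin.val_last, Nat.mod_self] at h1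
  exact NeZero.ne n h1.symm

/-- In P_n the trivial path is the only path that ends at the leaf without passing through the last
arrow, and it is not in the radical. -/
theorem leafClass_radical (hY : ∀ a, Y.step a % (n + 1) ≠ n) :
    LeafClass K Y (projFil K Y (Fin.last n) 1) := by
  refine ⟨(arrowInj_alg K hY).of_injective
    ((proj K Y (Fin.last n)).subtype ∘ₗ (projFil K Y (Fin.last n) 1).subtype)
    ((Submodule.injective_subtype _).comp (Submodule.injective_subtype _)), ?_⟩
  rintro ⟨m, hmem⟩ hm
  have hm : (m : Alg K Y) * idem K Y (Fin.last n) = m :=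
    congrArg Subtype.val (congrArg Subtype.val hm)
  obtain ⟨y, hy⟩ := (mem_projFil_iff K Y _ _ _).1 hmem
  obtain ⟨z, hz⟩ := exists_mul_lastArrow K ⟨Fin.last n, 1⟩ next_last_ne y
  rw [← hy, hm] at hz
  have hmem' : pathClass K Y ⟨Fin.last n, 1⟩ * z * idem K Y (penult n) ∈
      proj K Y (Fin.last n) := by
    rw [mem_proj_iff, ← mul_assoc, ← mul_assoc]
    exact congrArg (· * z * _) (idem_mul_pathClass K Y ⟨Fin.last n, 1⟩)
  exact ⟨⟨⟨_, hmem'⟩, (mem_projFil_iff K Y _ _ _).2 ⟨z * idem K Y (penult n), mul_assoc _ _ _⟩⟩,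
    Subtype.ext (Subtype.ext (mul_mul_idem_mul_idem K _ _ _)),
    Subtype.ext (Subtype.ext hz.symm)⟩

/-- The trace contains the components of M at all vertices but the leaf, and surjectivity of the
last arrow reaches the component at the leaf from its predecessor. -/
theorem surjective_traceMap_of_leafClass {M : Type u} [AddCommGroup M] [Module (Alg K Y)ᵐᵒᵖ M]
    (hM : LeafClass K Y M) : Function.Surjective (traceMap (Alg K Y)ᵐᵒᵖ (PPrime K Y) M) := by
  rw [← LinearMap.range_eq_top, eq_top_iff]
  rintro m -
  have h1 : ∀ (j : Fin n) (m : M), MulOpposite.op (idem K Y j.castSucc) • m ∈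
      LinearMap.range (traceMap (Alg K Y)ᵐᵒᵖ (PPrime K Y) M) := by
    intro j m
    rw [op_idem_smul_eq_evalMap K m j]
    exact range_le_range_traceMap _ ⟨_, rfl⟩
  rw [← sum_op_idem_smul K (Y := Y) m]
  refine add_mem (Submodule.sum_mem _ fun j _ => h1 j m) ?_
  obtain ⟨y, hy1, hy2⟩ := hM.2 (MulOpposite.op (idem K Y (Fin.last n)) • m) (by
    rw [smul_smul, ← MulOpposite.op_mul, idem_mul_self])
  rw [← hy2, ← hy1]
  obtain ⟨j, hj⟩ := exists_castSucc_eq_penult n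
  rw [← hj]
  exact Submodule.smul_mem _ _ (h1 j y)

theorem isPresentedClass_leafClass (hY : ∀ a, Y.step a % (n + 1) ≠ n) :
    IsPresentedClass (Alg K Y)ᵐᵒᵖ (PPrime K Y) (LeafClass K Y) where
  finsupp κ := (leafClass_pPrime K hY).finsupp κ
  traceMap_surjective _ _ _ hM := surjective_traceMap_of_leafClass K hM
  -- Injectivity is inherited from the larger module, surjectivity from the sum of copies of P' that
  -- maps onto the submodule.
  of_injective _ _ _ _ _ _ i hi hM hN := ⟨hM.1.of_injective i hi,
    ((leafClass_pPrime K hY).finsupp _).2.of_surjective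
      (by rw [← MulOpposite.op_mul, idem_mul_self]) _ hN⟩
  ker _ _ _ _ _ _ g hM hN := ArrowBij.ker hM hN g
  quotient _ _ _ N hN hM := ArrowBij.quotient (by rw [← MulOpposite.op_mul, idem_mul_self])
    (by rw [← MulOpposite.op_mul, idem_mul_self]) (by rw [← MulOpposite.op_mul, lastArrow_mul_idem])
    (by rw [← MulOpposite.op_mul, idem_mul_lastArrow]) N hN hM

/-- A module supported at the leaf is a direct sum of copies of the simple module at the leaf, and
has a resolution by copies of `P_n` and of its radical. -/
theorem exists_resolution_of_hom_eq_zero (hY : ∀ a, Y.step a % (n + 1) ≠ n) (M : Type u)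
    [AddCommGroup M] [Module (Alg K Y)ᵐᵒᵖ M]
    (hM : ∀ f : PPrime K Y →ₗ[(Alg K Y)ᵐᵒᵖ] M, f = 0) :
    ∃ (A B : Type u) (_ : AddCommGroup A) (_ : Module (Alg K Y)ᵐᵒᵖ A) (_ : AddCommGroup B)
      (_ : Module (Alg K Y)ᵐᵒᵖ B) (f : A →ₗ[(Alg K Y)ᵐᵒᵖ] B) (g : B →ₗ[(Alg K Y)ᵐᵒᵖ] M),
      LeafClass K Y A ∧ Module.Projective (Alg K Y)ᵐᵒᵖ B ∧ Function.Injective f ∧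
        Function.Surjective g ∧ Function.Exact f g := by
  have hzero : ∀ (j : Fin n) (m : M), MulOpposite.op (idem K Y j.castSucc) • m = 0 := by
    intro j m
    rw [op_idem_smul_eq_evalMap K m j,
      hM (evalMap K j.castSucc m ∘ₗ LinearMap.proj j), LinearMap.zero_apply]
  have hone : ∀ m : M, MulOpposite.op (idem K Y (Fin.last n)) • m = m := by
    intro m
    have := sum_op_idem_smul K (Y := Y) m
    rwa [Finset.sum_eq_zero fun j _ => hzero j m, zero_add] at this
  obtain ⟨j₀, hj₀⟩ : ∃ j : Fin n, j.castSucc = next (Fin.last n) :=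
    ⟨(next (Fin.last n)).castPred next_last_ne, Fin.castSucc_castPred _ _⟩
  have hrad : ∀ (p : proj K Y (Fin.last n)), p ∈ projFil K Y (Fin.last n) 1 → ∀ m : M,
      evalMap K (Fin.last n) m p = 0 := by
    intro p hp m
    obtain ⟨y, hy⟩ := (mem_projFil_iff K Y _ _ _).1 hp
    change MulOpposite.op (p : Alg K Y) • m = 0
    have h1 := pathClass_mul_idem K Y ⟨Fin.last n, 1⟩
    rw [show (⟨Fin.last n, 1⟩ : CPath (n + 1)).target = j₀.castSucc from hj₀.symm] at h1
    rw [hy, ← h1, MulOpposite.op_mul, MulOpposite.op_mul, mul_smul, mul_smul, hzero, smul_zero]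
  let _ : Module K M := Module.compHom M (algebraMap K (Alg K Y)ᵐᵒᵖ)
  have hsmul : ∀ (c : K) (m : M),
      evalMap K (Fin.last n) m (c • projPath K Y (Fin.last n) 0) = c • m := by
    intro c m
    change MulOpposite.op (c • idem K Y (Fin.last n)) • m = algebraMap K (Alg K Y)ᵐᵒᵖ c • m
    rw [MulOpposite.op_smul, Algebra.smul_def, mul_smul, hone]
  -- The top of P_n is one-dimensional. As the radical acts by zero on M, evaluation at p depends
  -- only on its top coefficient c.
  have htop : ∀ p : proj K Y (Fin.last n), ∃ c : K,
      p - c • projPath K Y (Fin.last n) 0 ∈ projFil K Y (Fin.last n) 1 := by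
    intro p
    obtain ⟨c, z, hz⟩ := pathClass_mul_eq_add K Y (Fin.last n) 0 (p : Alg K Y)
    refine ⟨c, (mem_projFil_iff K Y _ _ _).2 ⟨z, ?_⟩⟩
    change (p : Alg K Y) - c • idem K Y (Fin.last n) = _
    rw [← proj_idem_mul p]
    exact sub_eq_of_eq_add' hz
  choose c hc using htop
  have heval : ∀ (p : proj K Y (Fin.last n)) (m : M), evalMap K (Fin.last n) m p = c p • m := by
    intro p m
    rw [← hsmul, ← sub_eq_zero, ← map_sub]
    exact hrad _ (hc p) m
  obtain ⟨κ, ⟨b⟩⟩ : ∃ κ : Type u, Nonempty (Module.Basis κ K M) :=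
    ⟨_, ⟨Module.Basis.ofVectorSpace K M⟩⟩
  let g : (κ →₀ proj K Y (Fin.last n)) →ₗ[(Alg K Y)ᵐᵒᵖ] M :=
    sumMap fun k => evalMap K (Fin.last n) (b k)
  have hproj := projective_proj K Y (Fin.last n)
  refine ⟨κ →₀ projFil K Y (Fin.last n) 1, κ →₀ proj K Y (Fin.last n),
    @Finsupp.instAddCommGroup κ (projFil K Y (Fin.last n) 1) (Submodule.addCommGroup _),
    @Finsupp.module κ (projFil K Y (Fin.last n) 1) (Alg K Y)ᵐᵒᵖ _ _ (Submodule.module _),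
    inferInstance, inferInstance,
    Finsupp.mapRange.linearMap (projFil K Y (Fin.last n) 1).subtype, g,
    (leafClass_radical K hY).finsupp κ, inferInstance, ?_, ?_, ?_⟩
  · exact Finsupp.mapRange_injective _ (map_zero _) (Submodule.injective_subtype _)
  · intro m
    rw [← b.linearCombination_repr m]
    generalize b.repr m = l
    induction l using Finsupp.induction_linear with
    | zero => exact ⟨0, by simp⟩
    | add x y hx hy =>
      obtain ⟨x', hx⟩ := hx
      obtain ⟨y', hy⟩ := hy
      exact ⟨x' + y', by rw [map_add, map_add, hx, hy]⟩
    | single k a =>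
      refine ⟨Finsupp.single k (a • projPath K Y (Fin.last n) 0), ?_⟩
      rw [sumMap_single, hsmul, Finsupp.linearCombination_single]
  · intro z
    constructor
    · intro hz
      -- The map g only sees the top coefficients, paired with the basis b of M; independence forces
      -- them to vanish, so the entries of z lie in the radical.
      have h1 : ∑ k ∈ z.support, c (z k) • b k = 0 := by
        rw [← hz]
        change _ = Finsupp.lsum ℕ _ z
        rw [Finsupp.lsum_apply, Finsupp.sum]
        exact Finset.sum_congr rfl fun k _ => (heval _ _).symm
      have h2 := linearIndependent_iff'.1 b.linearIndependent z.support _ h1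
      have h3 : ∀ k, z k ∈ projFil K Y (Fin.last n) 1 := by
        intro k
        by_cases hk : k ∈ z.support
        · have := hc (z k)
          rwa [h2 k hk, zero_smul, sub_zero] at this
        · rw [Finsupp.notMem_support_iff.1 hk]
          exact zero_mem _
      refine ⟨Finsupp.onFinset z.support (fun k => ⟨z k, h3 k⟩) (fun k hk =>
        Finsupp.mem_support_iff.2 fun h0 => hk (Subtype.ext h0)), Finsupp.ext fun k => rfl⟩
    · rintro ⟨w, rfl⟩
      induction w using Finsupp.induction_linear with
      | zero => simp
      | add x y hx hy => rw [map_add, map_add, hx, hy, add_zero]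
      | single k p =>
        rw [Finsupp.mapRange.linearMap_apply, Finsupp.mapRange_single, sumMap_single]
        exact hrad _ p.2 _

theorem nontrivial_endAlg : Nontrivial (EndAlg K Y) := by
  have h0 : genPPrime K Y 0 ≠ 0 := by
    intro h
    have h1 := congrFun h 0
    rw [genPPrime, Pi.single_eq_same, Pi.zero_apply, projPath_eq_zero_iff] at h1
    have := Y.kupisch_pos (0 : Fin n).castSucc
    omega
  exact ⟨1, 0, fun h => h0 (LinearMap.congr_fun h (genPPrime K Y 0))⟩

theorem globalDim_endAlg_le (hY : ∀ a, Y.step a % (n + 1) ≠ n) :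
    globalDim (EndAlg K Y) ≤ globalDim (Alg K Y) := by
  have := projective_pPrime K Y
  have := finite_pPrime K Y
  have := nontrivial_alg K (Y := Y)
  have key : ∀ d : ℕ, globalDim (Alg K Y) ≤ d → globalDim (EndAlg K Y) ≤ d := fun d hd =>
    (globalDim_le_iff d).2 fun X _ _ =>
      (isPresentedClass_leafClass K hY).pdLT_end ((globalDim_le_iff d).1 hd) X
  have hbot := globalDim_ne_bot (A := Alg K Y)
  -- Only a finite bound carries content: the value ⊥ is excluded and the value ⊤ is trivial.
  generalize globalDim (Alg K Y) = x at *
  induction x with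
  | bot => exact absurd rfl hbot
  | coe x =>
    induction x with
    | top => exact le_top
    | coe d => exact key d le_rfl

theorem globalDim_alg_le (hY : ∀ a, Y.step a % (n + 1) ≠ n) :
    globalDim (Alg K Y) ≤ globalDim (EndAlg K Y) + 2 := by
  have := projective_pPrime K Y
  have := finite_pPrime K Y
  have := nontrivial_endAlg K (Y := Y)
  have key : ∀ d : ℕ, globalDim (EndAlg K Y) ≤ d → globalDim (Alg K Y) ≤ (d + 2 : ℕ) := fun d hd =>
    (globalDim_le_iff (d + 2)).2 fun M _ _ =>
      (isPresentedClass_leafClass K hY).pdLT_of_end (exists_resolution_of_hom_eq_zero K hY)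
        ((globalDim_le_iff d).1 hd) M
  have hbot := globalDim_ne_bot (A := EndAlg K Y)
  generalize globalDim (EndAlg K Y) = x at *
  induction x with
  | bot => exact absurd rfl hbot
  | coe x =>
    induction x with
    | top => exact le_top
    | coe d => exact key d le_rfl

end NakayamaModules

end Nakayama
-- The proposition
open Nakayama in
theorem mainTheorem3 (K : Type u) [Field K] (n : ℕ) (Y : Relations (n + 1))
    (hleaf : IsLeaf (resolutionQuiver K Y) (Fin.last n)) :
    (∃ (Y' : Relations n) (φ : EndAlg K Y ≃ₐ[K] Alg K Y'), IsPresentation K Y Y' φ) ∧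
    (∀ (Y' : Relations n) (φ : EndAlg K Y ≃ₐ[K] Alg K Y'), IsPresentation K Y Y' φ →
      ((∀ i j : Fin n, (resolutionQuiver K Y').Adj i j ↔
          (resolutionQuiver K Y).Adj i.castSucc j.castSucc) ∧
        Nat.card (Component (resolutionQuiver K Y')) =
          Nat.card (Component (resolutionQuiver K Y)) ∧
        Nat.card {i // ¬ OnCycle (resolutionQuiver K Y') i} + 1 =
          Nat.card {i // ¬ OnCycle (resolutionQuiver K Y) i}) ∧
      (∃ w : ℚ, HasWeight K Y w ∧ HasWeight K Y' w) ∧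
      (Nonempty (ContinuousMap.HomotopyEquiv (Realization (relationComplex Y'))
          (Realization (relationComplex Y))) ∧
        eulerChar (relationComplex Y') = eulerChar (relationComplex Y))) ∧
    (globalDim (EndAlg K Y) ≤ globalDim (Alg K Y) ∧
      globalDim (Alg K Y) ≤ globalDim (EndAlg K Y) + 2 ∧
      (globalDim (Alg K Y) < ⊤ ↔ globalDim (EndAlg K Y) < ⊤)) := by
  have hY := (isLeaf_last_iff K).1 hleaf
  -- A quiver with a single vertex has no leaf, since every residue modulo 1 is 0.
  have hn : NeZero n := ⟨fun hn => by
    subst hn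
    exact hY 0 (Nat.mod_one _)⟩
  have h1 := globalDim_endAlg_le K hY
  have h2 := globalDim_alg_le K hY
  refine ⟨?_, fun Y' φ hφ => ?_, h1, h2, fun h => h1.trans_lt h, fun h => h2.trans_lt ?_⟩
  · obtain ⟨Y', hd⟩ := exists_isDeletion hY
    exact ⟨Y', exists_presentation_of_isDeletion K Y hd⟩
  · have hd := IsPresentation.isDeletion K hY hφ
    have hG := resolutionQuiver_adj_iff_succ K Y
    have hG' := resolutionQuiver_adj_iff_succ K Y'
    exact ⟨⟨hd.resolutionQuiver_adj_iff K,
      card_component_eq hG hG' hd.succ_castSucc (succ_ne_last hY),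
      card_not_onCycle_eq hG hG' hd.succ_castSucc (succ_ne_last hY)⟩,
      hd.exists_hasWeight K, hd.relationComplex_equiv hY⟩
  · generalize globalDim (EndAlg K Y) = x at h
    induction x with
    | bot => exact h
    | coe x =>
      induction x with
      | top => exact absurd h (lt_irrefl _)
      | coe d => exact WithBot.coe_lt_coe.2 (ENat.natCast_lt_top (d + 2))
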